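/- Let $F_n$ be the free group with basis $x_1,\dots,x_n$. An $F_n$-graph is a graph whose edges are oriented and labelled by $x_1,\dots,x_n$. For a nontrivial subgroup $H\le F_n$, let $\mathrm{Core}(H)$ be the core (the union of all images of locally injective loops) of the covering, corresponding to $H$, of the rose with $n$ petals labelled $x_1,\dots,x_n$; it is an $F_n$-graph which depends only on the conjugacy class $[H]$. A subgroup is a free factor if some basis of it extends to a basis of $F_n$. A Whitehead automorphism is an automorphism $\varphi=(A,a)$ of $F_n$ given by a letter $a\in\{x_1^{\pm1},\dots,x_n^{\pm1}\}$ and a set of letters $A$ not containing $a,a^{-1}$: $\varphi(a)=a$, and each generator $x_j\neq a^{\pm1}$ is multiplied on the left by $a$ if $x_j\in A$ and on the right by $a^{-1}$ if $x_j^{-1}\in A$. (1) Let $H,K\le F_n$ be nontrivial free factors such that $\mathrm{Core}(H)\sqcup\mathrm{Core}(K)$ contains at least one edge with each label $x_1,\dots,x_n$. Suppose there are conjugates $H'$ of $H$ and $K'$ of $K$ and a free factor $J\neq F_n$ with $H',K'\le J$. Then there is a Whitehead automorphism $\varphi$ such that $\mathrm{Core}(\varphi(H))\sqcup\mathrm{Core}(\varphi(K))$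 has strictly fewer vertices and strictly fewer edges than $\mathrm{Core}(H)\sqcup\mathrm{Core}(K)$. (2) Let the free factor complex of $F_n$ be the flag complex whose vertices are the conjugacy classes of nontrivial proper free factors of $F_n$, two distinct classes being joined by an edge if they have representatives one of which is contained in the other; distance is combinatorial distance in the $1$-skeleton. There is an algorithm which, given $n$ and two nontrivial proper free factors $H,K$ of $F_n$, each as a finite list of words generating it, decides whether $[H]$ and $[K]$ are at distance exactly $2$. -/

import Mathlib

/-- A labelled graph over the `n`-rose: a graph (loops and multiple edges allowed) each of whose
edges carries an orientation and a label in `Fin n`, the index of one of `x_1, …, x_n`. -/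
structure FnGraph (n : ℕ) where
  V : Type
  E : Type
  src : E → V
  tgt : E → V
  label : E → Fin n

namespace FnGraph

variable {n : ℕ}

/-- The start of an edge that is traversed along (`true`) or against (`false`) its orientation. -/
def dartSrc (G : FnGraph n) (d : G.E × Bool) : G.V :=
  if d.2 then G.src d.1 else G.tgt d.1

/-- The end of an edge that is traversed along (`true`) or against (`false`) its orientation. -/
def dartTgt (G : FnGraph n) (d : G.E × Bool) : G.V :=
  if d.2 then G.tgt d.1 else G.src d.1

/-- A non-degenerate loop, that is a locally injective map from the circle to the graph: a closed
edge path of length `k + 1` which never backtracks, cyclically. The index `i + 1` is taken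
modulo `k + 1`. -/
def IsReducedLoop (G : FnGraph n) {k : ℕ} (p : Fin (k + 1) → G.E × Bool) : Prop :=
  ∀ i, G.dartTgt (p i) = G.dartSrc (p (i + 1)) ∧ p (i + 1) ≠ ((p i).1, !(p i).2)

/-- The vertices lying on some non-degenerate loop. -/
def coreV (G : FnGraph n) : Set G.V :=
  {v | ∃ (k : ℕ) (p : Fin (k + 1) → G.E × Bool), G.IsReducedLoop p ∧ ∃ i, G.dartSrc (p i) = v}

/-- The edges lying on some non-degenerate loop. -/
def coreE (G : FnGraph n) : Set G.E :=
  {e | ∃ (k : ℕ) (p : Fin (k + 1) → G.E × Bool), G.IsReducedLoop p ∧ ∃ i, (p i).1 = e}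

theorem src_mem_coreV (G : FnGraph n) {e : G.E} (he : e ∈ G.coreE) : G.src e ∈ G.coreV := by
  obtain ⟨k, p, hp, i, rfl⟩ := he
  cases hb : (p i).2 with
  | true => exact ⟨k, p, hp, i, by simp [dartSrc, hb]⟩
  | false => exact ⟨k, p, hp, i + 1, by rw [← (hp i).1]; simp [dartTgt, hb]⟩

theorem tgt_mem_coreV (G : FnGraph n) {e : G.E} (he : e ∈ G.coreE) : G.tgt e ∈ G.coreV := by
  obtain ⟨k, p, hp, i, rfl⟩ := he
  cases hb : (p i).2 with
  | false => exact ⟨k, p, hp, i, by simp [dartSrc, hb]⟩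
  | true => exact ⟨k, p, hp, i + 1, by rw [← (hp i).1]; simp [dartTgt, hb]⟩

/-- The core of a graph: the subgraph formed by the union of its non-degenerate loops. -/
def core (G : FnGraph n) : FnGraph n where
  V := G.coreV
  E := G.coreE
  src e := ⟨G.src e, G.src_mem_coreV e.2⟩
  tgt e := ⟨G.tgt e, G.tgt_mem_coreV e.2⟩
  label e := G.label e

/-- The disjoint union of two labelled graphs. -/
def disjUnion (G G' : FnGraph n) : FnGraph n where
  V := G.V ⊕ G'.V
  E := G.E ⊕ G'.E
  src := Sum.map G.src G'.src
  tgt := Sum.map G.tgt G'.tgt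
  label := Sum.elim G.label G'.label

end FnGraph

/-- The covering of the `n`-rose that corresponds to `H ≤ F_n`: its vertices are the right cosets
`H g`, and for each `i` an edge labelled `x_i` goes from `H g` to `H g x_i`. -/
def coverGraph {n : ℕ} (H : Subgroup (FreeGroup (Fin n))) : FnGraph n where
  V := Quotient (QuotientGroup.rightRel H)
  E := Quotient (QuotientGroup.rightRel H) × Fin n
  src e := e.1
  tgt e := Quotient.map' (· * FreeGroup.of e.2)
    (fun a b h => by
      rw [QuotientGroup.rightRel_apply] at h ⊢
      simpa [mul_assoc] using h) e.1
  label e := e.2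

/-- The core graph `Core(H)` of a subgroup `H ≤ F_n`. -/
def coreGraph {n : ℕ} (H : Subgroup (FreeGroup (Fin n))) : FnGraph n :=
  (coverGraph H).core

/-- `H` is a free factor: some basis of `H` extends to a basis of the ambient free group. -/
def IsFreeFactor {n : ℕ} (H : Subgroup (FreeGroup (Fin n))) : Prop :=
  ∃ (ι κ : Type) (b : FreeGroupBasis ι H) (c : FreeGroupBasis κ (FreeGroup (Fin n))) (e : ι → κ),
    ∀ i, c (e i) = (b i : FreeGroup (Fin n))

/-- `H` and `H'` are conjugate subgroups: `H' = g H g⁻¹` for some `g`. -/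
def SubgroupConj {n : ℕ} (H H' : Subgroup (FreeGroup (Fin n))) : Prop :=
  ∃ g : FreeGroup (Fin n), H' = H.map (MulAut.conj g).toMonoidHom

/-- A letter: `(i, true)` is `x_i` and `(i, false)` is `x_i⁻¹`. -/
def letterVal {n : ℕ} (a : Fin n × Bool) : FreeGroup (Fin n) :=
  FreeGroup.mk [a]

/-- The inverse letter. -/
def letterInv {n : ℕ} (a : Fin n × Bool) : Fin n × Bool :=
  (a.1, !a.2)

open Classical in
/-- `φ` is a Whitehead automorphism `(A, a)`: the letters `a, a⁻¹` are not in `A`, the letter `a` is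
fixed, and each other generator `x_j` is multiplied on the left by `a` if `x_j ∈ A` and on the right
by `a⁻¹` if `x_j⁻¹ ∈ A`. -/
def IsWhiteheadAut {n : ℕ} (φ : FreeGroup (Fin n) ≃* FreeGroup (Fin n)) : Prop :=
  ∃ (a : Fin n × Bool) (A : Set (Fin n × Bool)), a ∉ A ∧ letterInv a ∉ A ∧
    φ (letterVal a) = letterVal a ∧
    ∀ j : Fin n, j ≠ a.1 →
      φ (FreeGroup.of j) =
        (if (j, true) ∈ A then letterVal a else 1) * FreeGroup.of j *
          (if (j, false) ∈ A then (letterVal a)⁻¹ else 1)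

/-- The non-trivial proper free factors of `F_n`. -/
def ProperFreeFactor (n : ℕ) : Type :=
  {H : Subgroup (FreeGroup (Fin n)) // IsFreeFactor H ∧ H ≠ ⊥ ∧ H ≠ ⊤}

/-- Conjugacy of non-trivial proper free factors. -/
instance freeFactorSetoid (n : ℕ) : Setoid (ProperFreeFactor n) where
  r H K := SubgroupConj H.1 K.1
  iseqv :=
    { refl := fun H => ⟨1, by ext; simp⟩
      symm := by
        rintro ⟨H, _⟩ ⟨K, _⟩ ⟨g, rfl⟩
        refine ⟨g⁻¹, ?_⟩
        ext x
        simp [Subgroup.map_map, Subgroup.mem_map, mul_assoc]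
      trans := by
        rintro ⟨H, _⟩ ⟨K, _⟩ ⟨L, _⟩ ⟨g, rfl⟩ ⟨g', rfl⟩
        refine ⟨g' * g, ?_⟩
        ext x
        simp [Subgroup.map_map, Subgroup.mem_map, mul_assoc] }

/-- The vertices of the free factor complex: conjugacy classes of non-trivial proper free
factors of `F_n`. -/
def FreeFactorVertex (n : ℕ) : Type :=
  Quotient (freeFactorSetoid n)

/-- The conjugacy class of a non-trivial proper free factor. -/
def freeFactorClass {n : ℕ} (H : ProperFreeFactor n) : FreeFactorVertex n :=
  Quotient.mk (freeFactorSetoid n) H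

/-- The `1`-skeleton of the free factor complex: two distinct classes are joined by an edge when
they have representatives one of which is contained in the other. (The complex is the flag complex
over this graph, and distances in it are the combinatorial distances of this graph.) -/
def freeFactorGraph (n : ℕ) : SimpleGraph (FreeFactorVertex n) where
  Adj v w := v ≠ w ∧ ∃ H K : ProperFreeFactor n,
    freeFactorClass H = v ∧ freeFactorClass K = w ∧ (H.1 ≤ K.1 ∨ K.1 ≤ H.1)
  symm := by
    constructor
    rintro v w ⟨h, H, K, hH, hK, hle⟩
    exact ⟨h.symm, K, H, hK, hH, hle.symm⟩
  loopless := by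
    constructor
    rintro v ⟨h, _⟩
    exact h rfl

/-- The subgroup of `F_n` generated by a finite list of words in the letters
`x_1, …, x_n` and their inverses. -/
def wordSubgroup {n : ℕ} (U : List (List (Fin n × Bool))) : Subgroup (FreeGroup (Fin n)) :=
  Subgroup.closure {g | ∃ w ∈ U, g = FreeGroup.mk w}

/-- A list of words, written with natural numbers in place of elements of `Fin n`, so that one
type of inputs serves all ranks `n`. -/
def encodeWords {n : ℕ} (U : List (List (Fin n × Bool))) : List (List (ℕ × Bool)) :=
  U.map fun w => w.map fun a => (a.1.val, a.2)

/-! Everything is read off the Cayley tree of F_n. The edge labelled `a` leaving the coset Hg lies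
in Core(H) exactly when some cyclically reduced loop at Hg begins with it. This is `CoreDart`, and
`mem_coreV_iff` and `mem_coreE_iff` reduce the core graphs to statements about reduced words.

For (1), join two letters when they label edges leaving a common vertex of one of the cores. In this
Whitehead graph every letter has a neighbour, because every label occurs and no core vertex has
degree one. The key is the cut vertex lemma `exists_isCut`: there are a letter a and a set A of
letters avoiding a and a⁻¹, containing a neighbour of a, such that no edge leads from A to a letter
outside A ∪ {a}. It is proved by a parity count. A basis adapted to J, with one element c not
belonging to the part that generates J, gives a function s from F_n to ℤ/2 that changes along a
single edge of the Cayley graph of that basis. It is invariant under right translation by J and has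
finite coboundary, so it is almost constant on the cosets gH and gK. The flux x ↦ ∑_g (s(gx) − s(g))
is a homomorphism with value 1 at c. Without a cut, s could be simplified at a jump vertex farthest
from 1 by flipping it on half-trees whose directions form a union of components of the Whitehead
graph (`exists_flip`). Such a set of letters is closed under inversion, so the flux of the
generators does not change. The process ends at a constant function, so the flux was zero
(`flux_eq_zero`), a contradiction.

Given a cut, consider φ = (A, a). At a core vertex with an outgoing letter in A, all outgoing
letters lie in A ∪ {a}; `moveVert` pushes these vertices along a. Edges then keep their labels,
except that the a-edges leaving pushed vertices collapse (`moveVert_mul_letter`), and Core(φ(H)) is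
contained in the image (`coreDart_map_whitehead`). The neighbour of a in A supplies a collapsed edge
with distinct ends, so both finite counts drop.

For (2), [H] and [K] are at distance two exactly when neither is conjugate into the other and either
both are conjugate into a proper free factor or some conjugates of them meet non-trivially
(`freeFactorGraph_dist_eq_two_iff`). The last case yields a middle vertex because the intersection
of two free factors is a free factor (`IsFreeFactor.inf`), which rests on splitting H ∩ J off H as a
free factor (`exists_free_complement`).

All the conditions are decidable. Membership is tested by quantifying over foldings of a finite
graph (`memTest_iff`). Core vertices are reached along prefixes of the generators, so conjugacy into
a subgroup needs only finitely many conjugators (`conjTest_encode`), and a pigeonhole on pairs of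
core vertices bounds the length of a shared loop (`meetTest_encode`). Finally, by (1), a pair with a
common proper factor loses core vertices under Whitehead automorphisms until some label is missing
from both cores; then both groups are conjugate into the factor generated by the other letters
(`exists_mem_reach`, `commonFactorTest_encode`). The combined test is primitive recursive. -/

open FreeGroup in
/-- The reduced word of `g` begins with the letter `a`. -/
def StartsWith {n : ℕ} (a : Fin n × Bool) (g : FreeGroup (Fin n)) : Prop :=
  g.toWord.head? = some a

/-! ### Reduced words and half-trees of the Cayley tree -/

section Words

variable {n : ℕ}

theorem letterInv_letterInv (a : Fin n × Bool) : letterInv (letterInv a) = a := by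
  simp [letterInv]

theorem letterInv_ne (a : Fin n × Bool) : letterInv a ≠ a := by
  rcases a with ⟨i, b⟩
  cases b <;> simp [letterInv]

theorem letterVal_letterInv (a : Fin n × Bool) : letterVal (letterInv a) = (letterVal a)⁻¹ := by
  simp [letterVal, letterInv, FreeGroup.inv_mk, FreeGroup.invRev]

theorem letterVal_true (i : Fin n) : letterVal (i, true) = FreeGroup.of i := rfl

theorem letterVal_false (i : Fin n) : letterVal (i, false) = (FreeGroup.of i)⁻¹ := by
  rw [← letterVal_true, ← letterVal_letterInv]; rfl

theorem mk_cons (a : Fin n × Bool) (w : List (Fin n × Bool)) :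
    FreeGroup.mk (a :: w) = letterVal a * FreeGroup.mk w := by
  simp [letterVal]

theorem isReduced_pair_iff {a b : Fin n × Bool} : (a.1 = b.1 → a.2 = b.2) ↔ b ≠ letterInv a := by
  rcases a with ⟨i, s⟩
  rcases b with ⟨j, t⟩
  simp only [letterInv, ne_eq, Prod.mk.injEq, not_and]
  constructor
  · rintro h rfl h2
    simp [h rfl] at h2
  · rintro h rfl
    have := h rfl
    cases s <;> cases t <;> simp_all

theorem toWord_eq_of_isReduced {w : List (Fin n × Bool)} (h : FreeGroup.IsReduced w) :
    (FreeGroup.mk w).toWord = w := by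
  rw [FreeGroup.toWord_mk, h.reduce_eq]

theorem toWord_mul_letter (g : FreeGroup (Fin n)) (b : Fin n × Bool) :
    (g * letterVal b).toWord = g.toWord ++ [b] ∨
      g.toWord = (g * letterVal b).toWord ++ [letterInv b] := by
  have hg : FreeGroup.IsReduced g.toWord := FreeGroup.isReduced_toWord
  have hgb : g * letterVal b = FreeGroup.mk (g.toWord ++ [b]) := by
    rw [← FreeGroup.mul_mk, FreeGroup.mk_toWord, letterVal]
  rcases List.eq_nil_or_concat' g.toWord with h | ⟨l, c, h⟩
  · left
    rw [hgb, h]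
    exact toWord_eq_of_isReduced (by simp)
  · rw [h] at hg hgb
    by_cases hc : b = letterInv c
    · right
      subst hc
      rw [hgb, h, letterInv_letterInv]
      have : FreeGroup.mk (l ++ [c] ++ [letterInv c]) = FreeGroup.mk l := by
        rw [← FreeGroup.mul_mk, ← FreeGroup.mul_mk, mul_assoc]
        change FreeGroup.mk l * (letterVal c * letterVal (letterInv c)) = _
        rw [letterVal_letterInv]; simp
      rw [this, toWord_eq_of_isReduced (hg.infix ⟨[], [c], by simp⟩)]
    · left
      rw [hgb, h]
      refine toWord_eq_of_isReduced ?_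
      refine FreeGroup.IsReduced.append_overlap hg ?_ (by simp)
      change FreeGroup.IsReduced [c, b]
      rw [FreeGroup.isReduced_cons_cons, isReduced_pair_iff]
      exact ⟨hc, by simp⟩

theorem toWord_letter_mul (g : FreeGroup (Fin n)) (b : Fin n × Bool) :
    (letterVal b * g).toWord = b :: g.toWord ∨
      g.toWord = letterInv b :: (letterVal b * g).toWord := by
  have h := toWord_mul_letter g⁻¹ (letterInv b)
  rw [letterVal_letterInv, ← mul_inv_rev, FreeGroup.toWord_inv, FreeGroup.toWord_inv] at h
  rcases h with h | h
  · left
    have := congrArg FreeGroup.invRev h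
    simpa [FreeGroup.invRev, letterInv, Function.comp_def] using this
  · right
    have := congrArg FreeGroup.invRev h
    simpa [FreeGroup.invRev, letterInv, Function.comp_def] using this

theorem StartsWith.unique {a b : Fin n × Bool} {g : FreeGroup (Fin n)} (ha : StartsWith a g)
    (hb : StartsWith b g) : a = b := by
  unfold StartsWith at ha hb
  rw [ha] at hb
  exact Option.some_injective _ hb

theorem not_startsWith_one (a : Fin n × Bool) : ¬ StartsWith a (1 : FreeGroup (Fin n)) := by
  simp [StartsWith]

theorem exists_startsWith {g : FreeGroup (Fin n)} (hg : g ≠ 1) : ∃ a, StartsWith a g := by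
  unfold StartsWith
  cases h : g.toWord with
  | nil => exact absurd (FreeGroup.toWord_eq_nil_iff.1 h) hg
  | cons a l => exact ⟨a, rfl⟩

theorem startsWith_iff {a : Fin n × Bool} {g : FreeGroup (Fin n)} :
    StartsWith a g ↔ ∃ w, g.toWord = a :: w := by
  unfold StartsWith
  rw [List.head?_eq_some_iff]

/-- Ping-pong: translation by `a` carries the complement of the half-tree at a⁻¹ onto the half-tree
at `a`. -/
theorem startsWith_letter_mul {a : Fin n × Bool} {g : FreeGroup (Fin n)} :
    StartsWith a (letterVal a * g) ↔ ¬ StartsWith (letterInv a) g := by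
  have hr : FreeGroup.IsReduced g.toWord := FreeGroup.isReduced_toWord
  rcases toWord_letter_mul g a with h | h
  · refine iff_of_true (by simp [StartsWith, h]) ?_
    intro h2
    obtain ⟨w, hw⟩ := startsWith_iff.1 h2
    have hr2 : FreeGroup.IsReduced (letterVal a * g).toWord := FreeGroup.isReduced_toWord
    rw [h, hw, FreeGroup.isReduced_cons_cons, isReduced_pair_iff] at hr2
    exact hr2.1 rfl
  · refine iff_of_false ?_ (by simp [StartsWith, h])
    intro h2
    obtain ⟨w, hw⟩ := startsWith_iff.1 h2
    rw [h, hw, FreeGroup.isReduced_cons_cons, isReduced_pair_iff] at hr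
    exact hr.1 (letterInv_letterInv a).symm

/-- The elements beginning with `a` form a half-tree, which is joined to the rest of the Cayley tree
only by the edge from 1 to `a`. -/
theorem eq_one_of_startsWith_mul_letter {a b : Fin n × Bool} {y : FreeGroup (Fin n)}
    (h1 : ¬ StartsWith a y) (h2 : StartsWith a (y * letterVal b)) : y = 1 ∧ b = a := by
  rcases toWord_mul_letter y b with h | h
  · cases hy : y.toWord with
    | nil =>
      refine ⟨FreeGroup.toWord_eq_nil_iff.1 hy, ?_⟩
      simpa [StartsWith, h, hy] using h2
    | cons c l =>
      exact absurd (by simpa [StartsWith, h, hy] using h2) h1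
  · obtain ⟨w, hw⟩ := startsWith_iff.1 h2
    exact absurd (by simp [StartsWith, h, hw]) h1

theorem eq_letter_of_not_startsWith_mul {a b : Fin n × Bool} {y : FreeGroup (Fin n)}
    (h1 : StartsWith a y) (h2 : ¬ StartsWith a (y * letterVal b)) :
    y = letterVal a ∧ b = letterInv a := by
  have h3 : StartsWith a (y * letterVal b * letterVal (letterInv b)) := by
    rw [letterVal_letterInv]; simpa using h1
  obtain ⟨h4, h5⟩ := eq_one_of_startsWith_mul_letter h2 h3
  have hb : b = letterInv a := by rw [← h5, letterInv_letterInv]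
  refine ⟨?_, hb⟩
  rw [hb, letterVal_letterInv] at h4
  exact mul_inv_eq_one.1 h4

theorem norm_letterVal (a : Fin n × Bool) : (letterVal a).norm = 1 := by
  unfold FreeGroup.norm letterVal
  rw [toWord_eq_of_isReduced (by simp)]; rfl

theorem norm_le_norm_mul_letter (g : FreeGroup (Fin n)) (b : Fin n × Bool) :
    g.norm ≤ (g * letterVal b).norm + 1 := by
  have := FreeGroup.norm_mul_le (g * letterVal b) (letterVal b)⁻¹
  rw [mul_inv_cancel_right, FreeGroup.norm_inv_eq, norm_letterVal] at this
  exact this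

theorem StartsWith.mul_mk {a : Fin n × Bool} (w : List (Fin n × Bool)) :
    ∀ {u : FreeGroup (Fin n)}, StartsWith a u → w.length < u.norm →
      StartsWith a (u * FreeGroup.mk w) := by
  induction w with
  | nil => intro u h _; simpa [← FreeGroup.one_eq_mk] using h
  | cons b w ih =>
    intro u h hl
    rw [mk_cons, ← mul_assoc]
    simp only [List.length_cons] at hl
    apply ih
    · by_contra h2
      obtain ⟨rfl, _⟩ := eq_letter_of_not_startsWith_mul h h2
      rw [norm_letterVal] at hl
      omega
    · have := norm_le_norm_mul_letter u b
      omega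

/-- A factor shorter than `u` cannot cancel the first letter of `u`; the converse follows because
first letters are unique. -/
theorem startsWith_mul_of_norm_lt {a : Fin n × Bool} {u y : FreeGroup (Fin n)}
    (h : y.norm < u.norm) : StartsWith a (u * y) ↔ StartsWith a u := by
  have key : ∀ c, StartsWith c u → StartsWith c (u * y) := by
    intro c hc
    have := StartsWith.mul_mk y.toWord hc h
    rwa [FreeGroup.mk_toWord] at this
  refine ⟨fun h2 => ?_, key a⟩
  obtain ⟨c, hc⟩ : ∃ c, StartsWith c u := by
    apply exists_startsWith
    rintro rfl
    simp at h
  rwa [(key c hc).unique h2] at hc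

theorem toWord_inv_head {w : List (Fin n × Bool)} {c : Fin n × Bool} {g : FreeGroup (Fin n)}
    (h : g.toWord = w ++ [c]) : StartsWith (letterInv c) g⁻¹ := by
  simp [StartsWith, FreeGroup.toWord_inv, h, FreeGroup.invRev, letterInv]

/-- There is no cancellation in `x * y` when no letter begins both `x⁻¹` and `y`. -/
theorem toWord_mul_of_no_cancel {x y : FreeGroup (Fin n)}
    (h : ∀ l, StartsWith l x⁻¹ → ¬ StartsWith l y) : (x * y).toWord = x.toWord ++ y.toWord := by
  have hxy : x * y = FreeGroup.mk (x.toWord ++ y.toWord) := by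
    rw [← FreeGroup.mul_mk, FreeGroup.mk_toWord, FreeGroup.mk_toWord]
  rw [hxy]
  apply toWord_eq_of_isReduced
  rcases List.eq_nil_or_concat' x.toWord with hx | ⟨l, c, hx⟩
  · rw [hx]; exact FreeGroup.isReduced_toWord
  · cases hy : y.toWord with
    | nil => simpa using FreeGroup.isReduced_toWord
    | cons d m =>
      have h1 := h _ (toWord_inv_head hx)
      have h2 : d ≠ letterInv c := by
        rintro rfl
        exact h1 (by simp [StartsWith, hy])
      have hx' : FreeGroup.IsReduced x.toWord := FreeGroup.isReduced_toWord
      have hy' : FreeGroup.IsReduced y.toWord := FreeGroup.isReduced_toWord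
      rw [hx] at hx' ⊢
      rw [hy] at hy'
      refine FreeGroup.IsReduced.append_overlap hx' ?_ (by simp)
      change FreeGroup.IsReduced (c :: d :: m)
      rw [FreeGroup.isReduced_cons_cons, isReduced_pair_iff]
      exact ⟨h2, hy'⟩

theorem StartsWith.mul_of_no_cancel {a : Fin n × Bool} {x y : FreeGroup (Fin n)}
    (ha : StartsWith a x) (h : ∀ l, StartsWith l x⁻¹ → ¬ StartsWith l y) :
    StartsWith a (x * y) := by
  obtain ⟨w, hw⟩ := startsWith_iff.1 ha
  simp [StartsWith, toWord_mul_of_no_cancel h, hw]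

end Words

/-! ### Core edges described by cyclically reduced loops -/

section CoreDart

variable {n : ℕ} {H : Subgroup (FreeGroup (Fin n))}

/-- The edge labelled `a` that leaves the coset `H g` lies on a non-degenerate loop: some `x` whose
reduced word is cyclically reduced and begins with `a` fixes that coset. -/
def CoreDart (H : Subgroup (FreeGroup (Fin n))) (g : FreeGroup (Fin n)) (a : Fin n × Bool) : Prop :=
  ∃ x, g * x * g⁻¹ ∈ H ∧ StartsWith a x ∧ ¬ StartsWith a x⁻¹

/-- The coset `H g` is a vertex of the core. -/
def CoreVert (H : Subgroup (FreeGroup (Fin n))) (g : FreeGroup (Fin n)) : Prop :=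
  ∃ a, CoreDart H g a

theorem coreDart_mul_left_iff {h : FreeGroup (Fin n)} (hh : h ∈ H) {g : FreeGroup (Fin n)}
    {a : Fin n × Bool} : CoreDart H (h * g) a ↔ CoreDart H g a := by
  unfold CoreDart
  refine exists_congr fun x => and_congr_left fun _ => ?_
  have : h * g * x * (h * g)⁻¹ = h * (g * x * g⁻¹) * h⁻¹ := by group
  rw [this, Subgroup.mul_mem_cancel_right _ (H.inv_mem hh), Subgroup.mul_mem_cancel_left _ hh]

/-- Read backwards from the far end of the edge, the loop `x` becomes a⁻¹x⁻¹a, which is again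
cyclically reduced. -/
theorem CoreDart.symm {g : FreeGroup (Fin n)} {a : Fin n × Bool} (h : CoreDart H g a) :
    CoreDart H (g * letterVal a) (letterInv a) := by
  obtain ⟨x, hx, h1, h2⟩ := h
  have hx1 : x⁻¹ ≠ 1 := by
    rintro h3
    rw [inv_eq_one] at h3
    exact not_startsWith_one a (h3 ▸ h1)
  refine ⟨letterVal (letterInv a) * (x⁻¹ * letterVal a), ?_, ?_, ?_⟩
  · have := H.inv_mem hx
    rw [letterVal_letterInv]
    convert this using 1
    group
  · rw [startsWith_letter_mul, letterInv_letterInv]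
    exact fun h3 => hx1 (eq_one_of_startsWith_mul_letter h2 h3).1
  · have : (letterVal (letterInv a) * (x⁻¹ * letterVal a))⁻¹
        = letterVal (letterInv a) * (x * letterVal a) := by
      rw [letterVal_letterInv]; group
    rw [this, startsWith_letter_mul, letterInv_letterInv, not_not]
    by_contra h3
    exact letterInv_ne a (eq_letter_of_not_startsWith_mul h1 h3).2.symm

/-- The reversed loop x⁻¹ leaves the vertex along another edge, so core vertices have degree at
least two. -/
theorem CoreDart.exists_ne {g : FreeGroup (Fin n)} {a : Fin n × Bool} (h : CoreDart H g a) :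
    ∃ b, b ≠ a ∧ CoreDart H g b := by
  obtain ⟨x, hx, h1, h2⟩ := h
  obtain ⟨b, hb⟩ : ∃ b, StartsWith b x⁻¹ := by
    apply exists_startsWith
    rintro h3
    rw [inv_eq_one] at h3
    exact not_startsWith_one a (h3 ▸ h1)
  have hba : b ≠ a := by
    rintro rfl; exact h2 hb
  refine ⟨b, hba, x⁻¹, ?_, hb, ?_⟩
  · convert H.inv_mem hx using 1; group
  · rw [inv_inv]
    exact fun h3 => hba (h3.unique h1)

theorem CoreDart.coreVert_mul {g : FreeGroup (Fin n)} {a : Fin n × Bool} (h : CoreDart H g a) :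
    CoreVert H (g * letterVal a) := ⟨_, h.symm⟩

/-- The powers of a cyclically reduced element translate far along its axis. -/
theorem startsWith_pow_mul {a : Fin n × Bool} {x : FreeGroup (Fin n)} (h1 : StartsWith a x)
    (h2 : ¬ StartsWith a x⁻¹) (y : FreeGroup (Fin n)) (k : ℕ) (hk : y.norm < k) :
    StartsWith a (x ^ k * y) ∧ ¬ StartsWith a (x⁻¹ ^ k * y) := by
  have key : ∀ k : ℕ, StartsWith a (x ^ (k + 1)) ∧ k + 1 ≤ (x ^ (k + 1)).norm ∧
      ¬ StartsWith a (x⁻¹ ^ (k + 1)) := by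
    intro k
    induction k with
    | zero =>
      refine ⟨by simpa using h1, ?_, by simpa using h2⟩
      obtain ⟨w, hw⟩ := startsWith_iff.1 h1
      simp [FreeGroup.norm, hw]
    | succ k ih =>
      obtain ⟨i1, i2, i3⟩ := ih
      have hc : ∀ l, StartsWith l x⁻¹ → ¬ StartsWith l (x ^ (k + 1)) := by
        intro l hl hl2
        rw [hl2.unique i1] at hl
        exact h2 hl
      refine ⟨?_, ?_, ?_⟩
      · rw [pow_succ']
        exact h1.mul_of_no_cancel hc
      · rw [pow_succ']
        unfold FreeGroup.norm at i2 ⊢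
        rw [toWord_mul_of_no_cancel hc, List.length_append]
        obtain ⟨w, hw⟩ := startsWith_iff.1 h1
        rw [hw, List.length_cons]
        omega
      · obtain ⟨b, hb⟩ : ∃ b, StartsWith b x⁻¹ := by
          apply exists_startsWith
          rintro h3
          rw [inv_eq_one] at h3
          exact not_startsWith_one a (h3 ▸ h1)
        have hba : b ≠ a := by
          rintro rfl; exact h2 hb
        have hs : StartsWith b (x⁻¹ * x⁻¹ ^ (k + 1)) := by
          refine hb.mul_of_no_cancel ?_
          intro l hl hl2
          rw [inv_inv] at hl
          rw [hl.unique h1] at hl2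
          exact i3 hl2
        rw [pow_succ']
        exact fun h3 => hba (hs.unique h3)
  obtain ⟨k, rfl⟩ : ∃ j, k = j + 1 := ⟨k - 1, by omega⟩
  obtain ⟨i1, i2, i3⟩ := key k
  rw [startsWith_mul_of_norm_lt (by omega), startsWith_mul_of_norm_lt]
  · exact ⟨i1, i3⟩
  · rw [inv_pow, FreeGroup.norm_inv_eq]; omega

/-- The edge path that starts at `g` and reads the word `w` consists of edges in `Q`. -/
def PathIn (Q : FreeGroup (Fin n) → Fin n × Bool → Prop) :
    FreeGroup (Fin n) → List (Fin n × Bool) → Prop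
  | _, [] => True
  | g, b :: w => Q g b ∧ PathIn Q (g * letterVal b) w

theorem pathIn_append {Q : FreeGroup (Fin n) → Fin n × Bool → Prop} {g : FreeGroup (Fin n)}
    {u v : List (Fin n × Bool)} :
    PathIn Q g (u ++ v) ↔ PathIn Q g u ∧ PathIn Q (g * FreeGroup.mk u) v := by
  induction u generalizing g with
  | nil => simp [PathIn, ← FreeGroup.one_eq_mk]
  | cons b u ih => simp [PathIn, ih, mk_cons, and_assoc, mul_assoc]

theorem PathIn.mul_left {Q : FreeGroup (Fin n) → Fin n × Bool → Prop}
    (hQ : ∀ h ∈ H, ∀ g a, Q g a → Q (h * g) a) {h : FreeGroup (Fin n)} (hh : h ∈ H)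
    {w : List (Fin n × Bool)} {g : FreeGroup (Fin n)} (hw : PathIn Q g w) :
    PathIn Q (h * g) w := by
  induction w generalizing g with
  | nil => trivial
  | cons b w ih => exact ⟨hQ h hh _ _ hw.1, by rw [mul_assoc]; exact ih hw.2⟩

theorem PathIn.reverse {Q : FreeGroup (Fin n) → Fin n × Bool → Prop}
    (hQ : ∀ g a, Q g a → Q (g * letterVal a) (letterInv a))
    {w : List (Fin n × Bool)} {g : FreeGroup (Fin n)} (hw : PathIn Q g w) :
    PathIn Q (g * FreeGroup.mk w) (FreeGroup.invRev w) := by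
  induction w generalizing g with
  | nil => simp [PathIn]
  | cons b w ih =>
    rw [FreeGroup.invRev_cons, pathIn_append, mk_cons, ← mul_assoc]
    refine ⟨ih hw.2, ?_⟩
    rw [← FreeGroup.inv_mk, mul_inv_cancel_right]
    exact ⟨hQ _ _ hw.1, trivial⟩

/-- A path that enters a half-tree uses the edge leading into it. -/
theorem PathIn.crosses {Q : FreeGroup (Fin n) → Fin n × Bool → Prop} {g : FreeGroup (Fin n)}
    {a : Fin n × Bool} {w : List (Fin n × Bool)} {y : FreeGroup (Fin n)} (hw : PathIn Q y w)
    (h1 : ¬ StartsWith a (g⁻¹ * y)) (h2 : StartsWith a (g⁻¹ * (y * FreeGroup.mk w))) : Q g a := by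
  induction w generalizing y with
  | nil =>
    rw [← FreeGroup.one_eq_mk, mul_one] at h2
    exact absurd h2 h1
  | cons b w ih =>
    by_cases h3 : StartsWith a (g⁻¹ * (y * letterVal b))
    · rw [← mul_assoc] at h3
      obtain ⟨h4, rfl⟩ := eq_one_of_startsWith_mul_letter h1 h3
      rw [inv_mul_eq_one] at h4
      rw [h4]; exact hw.1
    · refine ih hw.2 h3 ?_
      rwa [mul_assoc y, ← mk_cons]

/-- A subgraph of the covering that carries a loop for every element of `H` contains the core. -/
theorem CoreDart.mem_of_pathIn {Q : FreeGroup (Fin n) → Fin n × Bool → Prop}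
    (hQ : ∀ h ∈ H, ∀ g a, Q g a → Q (h * g) a) {x₀ : FreeGroup (Fin n)}
    (hpath : ∀ h ∈ H, ∃ w, PathIn Q x₀ w ∧ x₀ * FreeGroup.mk w = h * x₀)
    {g : FreeGroup (Fin n)} {a : Fin n × Bool} (h : CoreDart H g a) : Q g a := by
  obtain ⟨x, hx, h1, h2⟩ := h
  -- This exponent is large enough that, seen from `g`, the points y^k x₀ and y^(-k) x₀ lie on
  -- different sides of the edge labelled `a`.
  set k := (g⁻¹ * x₀).norm + 1 with hk
  obtain ⟨h3, h4⟩ := startsWith_pow_mul h1 h2 (g⁻¹ * x₀) k (by omega)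
  set y := g * x * g⁻¹ with hy
  have hyk : ∀ k : ℕ, y ^ k = g * x ^ k * g⁻¹ := by
    intro k; rw [hy, ← conj_pow]
  have hyk' : (y ^ k)⁻¹ = g * x⁻¹ ^ k * g⁻¹ := by
    rw [hyk, inv_pow]; group
  -- Translated by y^(-k), the path for y^(2k) runs from y^(-k) x₀ to y^k x₀, so it crosses the edge
  -- in question.
  obtain ⟨w, hw, hw2⟩ := hpath (y ^ k * y ^ k) (H.mul_mem (H.pow_mem hx k) (H.pow_mem hx k))
  have hw' := PathIn.mul_left hQ (H.inv_mem (H.pow_mem hx k)) hw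
  refine hw'.crosses (a := a) (g := g) ?_ ?_
  · have : g⁻¹ * ((y ^ k)⁻¹ * x₀) = x⁻¹ ^ k * (g⁻¹ * x₀) := by rw [hyk']; group
    rwa [this]
  · have : g⁻¹ * (y ^ k * x₀) = x ^ k * (g⁻¹ * x₀) := by rw [hyk]; simp [mul_assoc]
    rwa [mul_assoc, hw2, mul_assoc, inv_mul_cancel_left, this]

/-- If `h` both leaves and returns along `y`, it is not itself a suitable loop. A cyclically reduced
loop `x` at the same vertex repairs this: one of x, x⁻¹ and hx is cyclically reduced and begins with
`y`. -/
theorem CoreVert.coreDart_of_startsWith {g h : FreeGroup (Fin n)} {y : Fin n × Bool}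
    (hg : CoreVert H g) (hh : g * h * g⁻¹ ∈ H) (hy : StartsWith y h) : CoreDart H g y := by
  by_cases hy2 : StartsWith y h⁻¹
  · obtain ⟨a, x, hx, h1, h2⟩ := hg
    by_cases hya : y = a
    · subst hya; exact ⟨x, hx, h1, h2⟩
    by_cases hya' : StartsWith y x⁻¹
    · refine ⟨x⁻¹, ?_, hya', ?_⟩
      · convert H.inv_mem hx using 1; group
      · rw [inv_inv]; exact fun h3 => hya (h3.unique h1)
    · refine ⟨h * x, ?_, hy.mul_of_no_cancel ?_, ?_⟩
      · convert H.mul_mem hh hx using 1; group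
      · intro l hl hl2
        exact hya ((hy2.unique hl).trans (hl2.unique h1))
      · obtain ⟨b, hb⟩ : ∃ b, StartsWith b x⁻¹ := by
          apply exists_startsWith
          rintro h3
          rw [inv_eq_one] at h3
          exact not_startsWith_one a (h3 ▸ h1)
        have : StartsWith b (x⁻¹ * h⁻¹) := by
          refine hb.mul_of_no_cancel ?_
          intro l hl hl2
          rw [inv_inv] at hl
          exact hya ((hy2.unique hl2).trans (hl.unique h1))
        rw [mul_inv_rev]
        intro h3
        rw [this.unique h3] at hb
        exact hya' hb
  · exact ⟨h, hh, hy, hy2⟩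

/-- Initial pieces of reduced loops at a vertex of the core stay in the core. -/
theorem CoreVert.pathIn_of_isReduced (k : ℕ) : ∀ {g : FreeGroup (Fin n)}
    {r z : List (Fin n × Bool)}, r.length ≤ k → CoreVert H g → FreeGroup.IsReduced (r ++ z) →
    g * FreeGroup.mk (r ++ z) * g⁻¹ ∈ H → PathIn (CoreDart H) g r := by
  induction k with
  | zero =>
    intro g r z hr _ _ _
    rw [List.eq_nil_of_length_eq_zero (Nat.le_zero.1 hr)]
    trivial
  | succ k ih =>
    intro g r z hr hg hred hmem
    cases r with
    | nil => trivial
    | cons y r =>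
      have hy : CoreDart H g y := by
        refine hg.coreDart_of_startsWith hmem ?_
        rw [StartsWith, toWord_eq_of_isReduced hred]; rfl
      refine ⟨hy, ?_⟩
      have hgy := hy.coreVert_mul
      have hred' : FreeGroup.IsReduced (r ++ z) := hred.infix ⟨[y], [], by simp⟩
      simp only [List.length_cons, add_le_add_iff_right] at hr
      rcases List.eq_nil_or_concat' (r ++ z) with h0 | ⟨l, c, hl⟩
      · obtain ⟨rfl, rfl⟩ := List.append_eq_nil_iff.1 h0
        trivial
      -- The base point moves across `y`. If the loop ends with y⁻¹, conjugation by `y` cancels both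
      -- ends and shortens it; otherwise `y` is appended at the end and the word stays reduced.
      · by_cases hc : y = letterInv c
        · have hc' : c = letterInv y := by rw [hc, letterInv_letterInv]
          have hmeml : g * letterVal y * FreeGroup.mk l * (g * letterVal y)⁻¹ ∈ H := by
            rw [List.cons_append, hl, mk_cons, ← FreeGroup.mul_mk] at hmem
            change g * (letterVal y * (FreeGroup.mk l * letterVal c)) * g⁻¹ ∈ H at hmem
            rw [hc', letterVal_letterInv] at hmem
            convert hmem using 1
            group
          have hredl : FreeGroup.IsReduced l := by
            rw [hl] at hred'
            exact hred'.infix ⟨[], [c], by simp⟩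
          -- When `z` is empty, the cancelled last letter still belongs to the path being traced;
          -- its edge is the first one reversed.
          rcases List.eq_nil_or_concat' z with rfl | ⟨z', d, rfl⟩
          · rw [List.append_nil] at hl
            subst hl
            rw [pathIn_append]
            refine ⟨ih (z := []) (by simp at hr; omega) hgy (by rwa [List.append_nil])
              (by rwa [List.append_nil]), ?_, trivial⟩
            have : g * letterVal y * FreeGroup.mk l
                = (g * letterVal y * FreeGroup.mk l * (g * letterVal y)⁻¹) * (g * letterVal y) := by
              group
            rw [this, coreDart_mul_left_iff hmeml, hc']
            exact hy.symm
          · rw [← List.append_assoc] at hl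
            obtain ⟨rfl, _⟩ := List.append_inj' hl rfl
            exact ih hr hgy hredl hmeml
        · refine ih (z := z ++ [y]) hr hgy ?_ ?_
          · rw [← List.append_assoc, hl]
            rw [hl] at hred'
            refine FreeGroup.IsReduced.append_overlap hred' ?_ (by simp)
            change FreeGroup.IsReduced [c, y]
            rw [FreeGroup.isReduced_cons_cons, isReduced_pair_iff]
            exact ⟨hc, by simp⟩
          · rw [← List.append_assoc, ← FreeGroup.mul_mk]
            change g * letterVal y * (FreeGroup.mk (r ++ z) * letterVal y) * _ ∈ H
            rw [List.cons_append, mk_cons] at hmem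
            convert hmem using 1
            group

theorem CoreVert.pathIn {g h : FreeGroup (Fin n)} (hg : CoreVert H g) (hh : g * h * g⁻¹ ∈ H) :
    PathIn (CoreDart H) g h.toWord := by
  refine hg.pathIn_of_isReduced h.toWord.length (z := []) le_rfl ?_ ?_
  · simpa using FreeGroup.isReduced_toWord
  · simpa [FreeGroup.mk_toWord] using hh

end CoreDart

/-! ### Comparison with the core of the covering graph -/

section CoreGraph

variable {n : ℕ} {H : Subgroup (FreeGroup (Fin n))}

/-- The right coset `H g`, a vertex of the covering graph. -/
def rcoset (H : Subgroup (FreeGroup (Fin n))) (g : FreeGroup (Fin n)) : (coverGraph H).V :=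
  Quotient.mk (QuotientGroup.rightRel H) g

theorem rcoset_eq_iff {g g' : FreeGroup (Fin n)} : rcoset H g = rcoset H g' ↔ g' * g⁻¹ ∈ H :=
  Quotient.eq.trans QuotientGroup.rightRel_apply

theorem exists_rcoset (q : (coverGraph H).V) : ∃ g, rcoset H g = q := by
  obtain ⟨g, hg⟩ := Quotient.exists_rep q
  exact ⟨g, hg⟩

theorem rcoset_mul_left {h : FreeGroup (Fin n)} (hh : h ∈ H) (g : FreeGroup (Fin n)) :
    rcoset H (h * g) = rcoset H g := by
  rw [rcoset_eq_iff]
  simpa using hh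

theorem rcoset_mul_right {g g' : FreeGroup (Fin n)} (h : rcoset H g = rcoset H g')
    (x : FreeGroup (Fin n)) : rcoset H (g * x) = rcoset H (g' * x) := by
  rw [rcoset_eq_iff] at h ⊢
  convert h using 1
  group

theorem coreDart_congr {g g' : FreeGroup (Fin n)} (h : rcoset H g = rcoset H g')
    {a : Fin n × Bool} : CoreDart H g a ↔ CoreDart H g' a := by
  rw [rcoset_eq_iff] at h
  rw [← coreDart_mul_left_iff h, inv_mul_cancel_right]

/-- The dart of the covering graph that leaves `H g` with label `a`. -/
def coverDart (H : Subgroup (FreeGroup (Fin n))) (g : FreeGroup (Fin n)) (a : Fin n × Bool) :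
    (coverGraph H).E × Bool :=
  if a.2 then ((rcoset H g, a.1), true) else ((rcoset H (g * letterVal a), a.1), false)

theorem coverDart_congr {g g' : FreeGroup (Fin n)} (h : rcoset H g = rcoset H g')
    (a : Fin n × Bool) : coverDart H g a = coverDart H g' a := by
  unfold coverDart
  rw [h, rcoset_mul_right h]

theorem coverGraph_tgt (g : FreeGroup (Fin n)) (i : Fin n) :
    (coverGraph H).tgt (rcoset H g, i) = rcoset H (g * letterVal (i, true)) := rfl

theorem dartSrc_coverDart (g : FreeGroup (Fin n)) (a : Fin n × Bool) :
    (coverGraph H).dartSrc (coverDart H g a) = rcoset H g := by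
  rcases a with ⟨i, s⟩
  cases s
  · change (coverGraph H).tgt (rcoset H (g * letterVal (i, false)), i) = _
    rw [coverGraph_tgt, letterVal_false, letterVal_true, inv_mul_cancel_right]
  · rfl

theorem dartTgt_coverDart (g : FreeGroup (Fin n)) (a : Fin n × Bool) :
    (coverGraph H).dartTgt (coverDart H g a) = rcoset H (g * letterVal a) := by
  rcases a with ⟨i, s⟩
  cases s <;> rfl

theorem exists_coverDart (d : (coverGraph H).E × Bool) {g : FreeGroup (Fin n)}
    (hg : (coverGraph H).dartSrc d = rcoset H g) : d = coverDart H g (d.1.2, d.2) := by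
  rcases d with ⟨⟨q, i⟩, s⟩
  cases s
  · obtain ⟨g', rfl⟩ := exists_rcoset q
    change (coverGraph H).tgt (rcoset H g', i) = _ at hg
    rw [coverGraph_tgt] at hg
    have := rcoset_mul_right hg (letterVal (i, false))
    rw [letterVal_false, letterVal_true, mul_inv_cancel_right, ← letterVal_false] at this
    change ((rcoset H g', i), false) = ((rcoset H (g * letterVal (i, false)), i), false)
    rw [this]
  · change q = rcoset H g at hg
    rw [hg]; rfl

theorem coverDart_letterInv (g : FreeGroup (Fin n)) (a : Fin n × Bool) :
    coverDart H (g * letterVal a) (letterInv a) =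
      ((coverDart H g a).1, !(coverDart H g a).2) := by
  rcases a with ⟨i, s⟩
  cases s
  · rfl
  · change ((rcoset H (g * letterVal (i, true) * letterVal (i, false)), i), false) =
      ((rcoset H g, i), false)
    rw [letterVal_false, letterVal_true, mul_inv_cancel_right]

theorem coverDart_letter (g : FreeGroup (Fin n)) (a : Fin n × Bool) :
    ((coverDart H g a).1.2, (coverDart H g a).2) = a := by
  rcases a with ⟨i, s⟩
  cases s <;> rfl

/-- The labels of one full turn, started at position `i`, spell the required cyclically reduced
word. -/
theorem coreDart_of_isReducedLoop {k : ℕ} {p : Fin (k + 1) → (coverGraph H).E × Bool}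
    (hp : (coverGraph H).IsReducedLoop p) (i : Fin (k + 1)) {g : FreeGroup (Fin n)}
    (hg : (coverGraph H).dartSrc (p i) = rcoset H g) : CoreDart H g ((p i).1.2, (p i).2) := by
  -- The loop is unwound: `q m` is the position i + m modulo k + 1.
  let q : ℕ → Fin (k + 1) := fun m => i + Fin.ofNat (k + 1) m
  have hq : ∀ m, q (m + 1) = q m + 1 := by
    intro m
    apply Fin.ext
    simp [q, Fin.ofNat, Fin.val_add, Nat.add_assoc]
  have hq0 : q 0 = i := by
    apply Fin.ext
    simp [q, Fin.ofNat]
  have hqk : q (k + 1) = i := by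
    apply Fin.ext
    simp [q, Fin.ofNat]
  let b : ℕ → Fin n × Bool := fun m => ((p (q m)).1.2, (p (q m)).2)
  let w : ℕ → List (Fin n × Bool) := fun m => (List.range m).map b
  have hw : ∀ m, w (m + 1) = w m ++ [b m] := by
    intro m; simp [w, List.range_succ]
  have hsrc : ∀ m, (coverGraph H).dartSrc (p (q m)) = rcoset H (g * FreeGroup.mk (w m)) := by
    intro m
    induction m with
    | zero => simpa [w, hq0, ← FreeGroup.one_eq_mk] using hg
    | succ m ih =>
      rw [hq, ← (hp _).1, exists_coverDart _ ih, dartTgt_coverDart, hw, ← FreeGroup.mul_mk,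
        mul_assoc]
      rfl
  have hne : ∀ m, b (m + 1) ≠ letterInv (b m) := by
    intro m hb
    apply (hp (q m)).2
    have h1 := exists_coverDart _ (hsrc m)
    have h2 := exists_coverDart _ (hsrc (m + 1))
    rw [← hq]
    conv_lhs => rw [h2]
    change coverDart H (g * FreeGroup.mk (w (m + 1))) (b (m + 1)) = _
    rw [hb, hw, ← FreeGroup.mul_mk, ← mul_assoc]
    change coverDart H (g * FreeGroup.mk (w m) * letterVal (b m)) (letterInv (b m)) = _
    rw [coverDart_letterInv]
    have h3 : p (q m) = coverDart H (g * FreeGroup.mk (w m)) (b m) := h1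
    rw [← h3]
  have hred : ∀ m, FreeGroup.IsReduced (w (m + 1)) := by
    intro m
    induction m with
    | zero => simp [w, List.range_succ]
    | succ m ih =>
      rw [hw (m + 1), hw m]
      rw [hw m] at ih
      refine FreeGroup.IsReduced.append_overlap ih ?_ (by simp)
      change FreeGroup.IsReduced [b m, b (m + 1)]
      rw [FreeGroup.isReduced_cons_cons, isReduced_pair_iff]
      exact ⟨hne m, by simp⟩
  have hb0 : b 0 = ((p i).1.2, (p i).2) := by simp [b, hq0]
  -- After k + 1 steps the walk is back at `i`; the absence of backtracking at this seam makes the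
  -- word cyclically reduced.
  have hbk : b (k + 1) = ((p i).1.2, (p i).2) := by simp [b, hqk]
  refine ⟨FreeGroup.mk (w (k + 1)), ?_, ?_, ?_⟩
  · have := hsrc (k + 1)
    rw [hqk, hg, rcoset_eq_iff] at this
    exact this
  · rw [StartsWith, toWord_eq_of_isReduced (hred k), ← hb0]
    simp [w, List.range_succ_eq_map]
  · intro h
    have h1 := toWord_inv_head (g := FreeGroup.mk (w (k + 1)))
      ((toWord_eq_of_isReduced (hred k)).trans (hw k))
    apply hne k
    rw [hbk, h.unique h1]

/-- Conversely, the word of `x` is traced from Hg, with the darts based at the cosets of its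
prefixes. -/
theorem isReducedLoop_of_coreDart {g : FreeGroup (Fin n)} {a : Fin n × Bool}
    (h : CoreDart H g a) : ∃ (k : ℕ) (p : Fin (k + 1) → (coverGraph H).E × Bool),
      (coverGraph H).IsReducedLoop p ∧ p 0 = coverDart H g a := by
  obtain ⟨x, hx, h1, h2⟩ := h
  obtain ⟨w', hw⟩ := startsWith_iff.1 h1
  set w := x.toWord with hwdef
  have hred : FreeGroup.IsReduced w := FreeGroup.isReduced_toWord
  have hlen : w.length = w'.length + 1 := by rw [hw]; simp
  refine ⟨w'.length, fun j => coverDart H (g * FreeGroup.mk (w.take j.1))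
    (w[j.1]'(by rw [hlen]; exact j.2)), ?_, ?_⟩
  · intro j
    have hj : j.1 < w.length := by rw [hlen]; exact j.2
    have hstep : g * FreeGroup.mk (w.take j.1) * letterVal w[j.1] =
        g * FreeGroup.mk (w.take (j.1 + 1)) := by
      rw [List.take_add_one, List.getElem?_eq_getElem hj, ← FreeGroup.mul_mk, mul_assoc]
      rfl
    -- At the last index the loop closes up because g x g⁻¹ ∈ H, and backtracking is excluded by
    -- cyclic reducedness. At other indices ordinary reducedness suffices.
    by_cases hjk : j.1 = w'.length
    · have hj1 : ((j + 1 : Fin (w'.length + 1))).1 = 0 := by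
        rw [Fin.val_add_one]
        simp [Fin.ext_iff, hjk]
      have hwfull : w.take (j.1 + 1) = w := by
        rw [hjk, ← hlen]; simp
      have hx' : g * FreeGroup.mk w * g⁻¹ ∈ H := by rwa [hwdef, FreeGroup.mk_toWord]
      have hsucc : (coverDart H (g * FreeGroup.mk (w.take (j + 1 : Fin (w'.length + 1)).1))
          (w[(j + 1 : Fin (w'.length + 1)).1]'(by rw [hlen]; exact (j + 1).2))) =
          coverDart H (g * FreeGroup.mk w) a := by
        have e1 : w[(j + 1 : Fin (w'.length + 1)).1]'(by rw [hlen]; exact (j + 1).2) = a := by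
          simp [hj1, hw]
        rw [e1, hj1]
        have e2 : rcoset H g = rcoset H (g * FreeGroup.mk w) := by rwa [rcoset_eq_iff]
        rw [List.take_zero, ← FreeGroup.one_eq_mk, mul_one]
        exact coverDart_congr e2 a
      beta_reduce
      rw [hsucc]
      refine ⟨?_, ?_⟩
      · rw [dartTgt_coverDart, dartSrc_coverDart, hstep, hwfull]
      · intro h3
        rw [← coverDart_letterInv, hstep, hwfull] at h3
        have h4 : a = letterInv w[j.1] := by
          rw [← coverDart_letter (H := H) (g * FreeGroup.mk w) a, h3, coverDart_letter]
        apply h2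
        rw [h4]
        refine toWord_inv_head (w := w.take j.1) ?_
        rw [← hwdef]
        conv_lhs => rw [← hwfull]
        rw [List.take_add_one, List.getElem?_eq_getElem hj]
        rfl
    · have hj1 : ((j + 1 : Fin (w'.length + 1))).1 = j.1 + 1 := by
        rw [Fin.val_add_one]
        simp [Fin.ext_iff, hjk]
      have hj2 : j.1 + 1 < w.length := by have := j.2; omega
      simp only [hj1]
      refine ⟨?_, ?_⟩
      · rw [dartTgt_coverDart, dartSrc_coverDart, hstep]
      · intro h3
        rw [← coverDart_letterInv, hstep] at h3
        have h4 : w[j.1 + 1] = letterInv w[j.1] := by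
          rw [← coverDart_letter (H := H) (g * FreeGroup.mk (w.take (j.1 + 1))) w[j.1 + 1], h3,
            coverDart_letter]
        have h5 := List.isChain_iff_getElem.1 hred j.1 (by omega)
        rw [isReduced_pair_iff] at h5
        exact h5 h4
  · simp [← FreeGroup.one_eq_mk, hw]

theorem mem_coreV_iff {g : FreeGroup (Fin n)} :
    rcoset H g ∈ (coverGraph H).coreV ↔ CoreVert H g := by
  constructor
  · rintro ⟨k, p, hp, i, hi⟩
    exact ⟨_, coreDart_of_isReducedLoop hp i hi⟩
  · rintro ⟨a, ha⟩
    obtain ⟨k, p, hp, h0⟩ := isReducedLoop_of_coreDart ha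
    exact ⟨k, p, hp, 0, by rw [h0, dartSrc_coverDart]⟩

theorem mem_coreE_iff {g : FreeGroup (Fin n)} {i : Fin n} :
    (rcoset H g, i) ∈ (coverGraph H).coreE ↔ CoreDart H g (i, true) := by
  constructor
  · rintro ⟨k, p, hp, j, hj⟩
    cases hs : (p j).2 with
    | true =>
      have := coreDart_of_isReducedLoop hp j (g := g) (by
        unfold FnGraph.dartSrc; rw [hs, hj]; rfl)
      rwa [hs, hj] at this
    | false =>
      have := coreDart_of_isReducedLoop hp j (g := g * letterVal (i, true)) (by
        unfold FnGraph.dartSrc; rw [hs, hj]; rfl)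
      rw [hs, hj] at this
      have := this.symm
      rwa [letterVal_false, letterVal_true, mul_inv_cancel_right] at this
  · intro ha
    obtain ⟨k, p, hp, h0⟩ := isReducedLoop_of_coreDart ha
    exact ⟨k, p, hp, 0, by rw [h0]; rfl⟩

/-- Every non-trivial element is a conjugate of a cyclically reduced one. -/
theorem exists_conj_startsWith {h : FreeGroup (Fin n)} (h1 : h ≠ 1) :
    ∃ u c a, u * c * u⁻¹ = h ∧ StartsWith a c ∧ ¬ StartsWith a c⁻¹ := by
  have hdec := FreeGroup.reduceCyclically.conj_conjugator_reduceCyclically h.toWord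
  set u := FreeGroup.reduceCyclically.conjugator h.toWord
  set c := FreeGroup.reduceCyclically h.toWord with hc
  have hcyc : FreeGroup.IsCyclicallyReduced c :=
    FreeGroup.reduceCyclically.isCyclicallyReduced FreeGroup.isReduced_toWord
  have hconj : FreeGroup.mk u * FreeGroup.mk c * (FreeGroup.mk u)⁻¹ = h := by
    rw [FreeGroup.inv_mk, FreeGroup.mul_mk, FreeGroup.mul_mk, hdec, FreeGroup.mk_toWord]
  have hword := toWord_eq_of_isReduced hcyc.isReduced
  obtain ⟨a, ha⟩ : ∃ a, StartsWith a (FreeGroup.mk c) := by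
    apply exists_startsWith
    intro h2
    rw [h2] at hconj
    exact h1 (by rw [← hconj]; group)
  refine ⟨FreeGroup.mk u, FreeGroup.mk c, a, hconj, ha, ?_⟩
  intro ha2
  rcases List.eq_nil_or_concat' c with h0 | ⟨l, d, h0⟩
  · simp [h0, StartsWith] at ha
  · have h3 := toWord_inv_head (hword.trans h0)
    have h4 := hcyc.2 d (by simp [h0]) a (by rwa [StartsWith, hword] at ha)
    rw [isReduced_pair_iff] at h4
    exact h4 (ha2.unique h3)

theorem exists_coreVert (hH : H ≠ ⊥) : ∃ g, CoreVert H g := by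
  obtain ⟨⟨h, hh⟩, h0⟩ := Subgroup.ne_bot_iff_exists_ne_one.1 hH
  obtain ⟨u, c, a, rfl, ha, ha'⟩ := exists_conj_startsWith fun e => h0 (Subtype.ext e)
  exact ⟨u, a, c, hh, ha, ha'⟩

end CoreGraph

/-! ### The Whitehead graph, almost invariant functions and their flux -/

section CutLetters

variable {n : ℕ}

/-- The Whitehead graph of a family of subgroups: two letters are adjacent when they label two edges
that leave a common vertex of one of the cores. -/
def LinkAdj (𝓗 : Set (Subgroup (FreeGroup (Fin n)))) (a b : Fin n × Bool) : Prop :=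
  a ≠ b ∧ ∃ H ∈ 𝓗, ∃ g, CoreDart H g a ∧ CoreDart H g b

/-- `A` is a union of components of the Whitehead graph without the letter `a`; it avoids `a⁻¹` and
has a neighbour of `a`. -/
structure IsCut (𝓗 : Set (Subgroup (FreeGroup (Fin n)))) (a : Fin n × Bool)
    (A : Set (Fin n × Bool)) : Prop where
  notMem : a ∉ A
  inv_notMem : letterInv a ∉ A
  closed : ∀ b ∈ A, ∀ d, LinkAdj 𝓗 b d → d ∈ A ∨ d = a
  exists_adj : ∃ b ∈ A, LinkAdj 𝓗 a b

variable {𝓗 : Set (Subgroup (FreeGroup (Fin n)))}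

theorem LinkAdj.symm {a b : Fin n × Bool} (h : LinkAdj 𝓗 a b) : LinkAdj 𝓗 b a := by
  obtain ⟨h1, H, hH, g, h2, h3⟩ := h
  exact ⟨h1.symm, H, hH, g, h3, h2⟩

/-- If E contained `a` but not a⁻¹, then E without `a` would be a cut at `a`; a neighbour of `a`
supplies the required adjacency. -/
theorem letterInv_mem_of_closed (hcut : ∀ a A, ¬ IsCut 𝓗 a A) (hdeg : ∀ a, ∃ b, LinkAdj 𝓗 a b)
    {E : Set (Fin n × Bool)} (hE : ∀ b ∈ E, ∀ d, LinkAdj 𝓗 b d → d ∈ E) {a : Fin n × Bool}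
    (ha : a ∈ E) : letterInv a ∈ E := by
  by_contra hinv
  apply hcut a (E \ {a})
  refine ⟨by simp, fun h => hinv h.1, ?_, ?_⟩
  · intro b hb d hd
    by_cases hda : d = a
    · exact Or.inr hda
    · exact Or.inl ⟨hE b hb.1 d hd, hda⟩
  · obtain ⟨b, hb⟩ := hdeg a
    exact ⟨b, ⟨hE a ha b hb, hb.1.symm⟩, hb⟩

theorem finite_norm_le (k : ℕ) : {g : FreeGroup (Fin n) | g.norm ≤ k}.Finite := by
  have := (List.finite_length_le (Fin n × Bool) k).preimage
    (FreeGroup.toWord_injective (α := Fin n)).injOn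
  exact this

/-- For two elements of yH in the same half-tree, the longer times the inverse of the shorter is an
element of yHy⁻¹ with the given first letter. Applied to `a` and `b`, this gives q and r, and one of
q, r⁻¹ and qr is cyclically reduced and begins with `a`. -/
theorem coreDart_of_infinite {H : Subgroup (FreeGroup (Fin n))} {a b : Fin n × Bool} (hab : a ≠ b)
    {y : FreeGroup (Fin n)} (ha : {h | h ∈ H ∧ StartsWith a (y * h)}.Infinite)
    (hb : {h | h ∈ H ∧ StartsWith b (y * h)}.Infinite) : CoreDart H y⁻¹ a := by
  have key : ∀ c, {h | h ∈ H ∧ StartsWith c (y * h)}.Infinite →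
      ∃ q, y⁻¹ * q * y⁻¹⁻¹ ∈ H ∧ StartsWith c q := by
    intro c hc
    obtain ⟨h1, hh1, hc1⟩ := hc.nonempty
    obtain ⟨h2, ⟨hh2, hc2⟩, hn⟩ : ∃ h2 ∈ {h | h ∈ H ∧ StartsWith c (y * h)},
        (y * h1).norm < (y * h2).norm := by
      by_contra! hcon
      apply hc
      have : {h | y * h ∈ {g : FreeGroup (Fin n) | g.norm ≤ (y * h1).norm}}.Finite :=
        (finite_norm_le _).preimage (mul_right_injective y).injOn
      exact this.subset hcon
    refine ⟨y * h2 * (y * h1)⁻¹, ?_, ?_⟩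
    · convert H.mul_mem hh2 (H.inv_mem hh1) using 1
      group
    · rw [startsWith_mul_of_norm_lt (by rwa [FreeGroup.norm_inv_eq])]
      exact hc2
  obtain ⟨q, hq, hqa⟩ := key a ha
  obtain ⟨r, hr, hrb⟩ := key b hb
  by_cases h1 : StartsWith a q⁻¹
  · by_cases h2 : StartsWith a r⁻¹
    · refine ⟨r⁻¹, ?_, h2, ?_⟩
      · convert H.inv_mem hr using 1; group
      · rw [inv_inv]; exact fun h3 => hab (h3.unique hrb)
    · refine ⟨q * r, ?_, hqa.mul_of_no_cancel ?_, ?_⟩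
      · convert H.mul_mem hq hr using 1; group
      · intro l hl hl2
        exact hab ((h1.unique hl).trans (hl2.unique hrb))
      · obtain ⟨z, hz⟩ : ∃ z, StartsWith z r⁻¹ := by
          apply exists_startsWith
          rintro h3
          rw [inv_eq_one] at h3
          exact not_startsWith_one b (h3 ▸ hrb)
        have h4 : StartsWith z (r⁻¹ * q⁻¹) := by
          refine hz.mul_of_no_cancel ?_
          intro l hl hl2
          rw [inv_inv] at hl
          exact hab ((h1.unique hl2).trans (hl.unique hrb))
        rw [mul_inv_rev]
        intro h5
        rw [h4.unique h5] at hz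
        exact h2 hz
  · exact ⟨q, hq, hqa, h1⟩

/-- The functions on the free group with finite coboundary that are, up to finitely many values,
constant on each coset `g H`, for `H` in the family. -/
structure IsAlmostInvariant (𝓗 : Set (Subgroup (FreeGroup (Fin n))))
    (s : FreeGroup (Fin n) → ZMod 2) : Prop where
  finite_ne : ∀ i, {g | s (g * FreeGroup.of i) ≠ s g}.Finite
  coset : ∀ H ∈ 𝓗, ∀ g, ∃ c, {h | h ∈ H ∧ s (g * h) ≠ c}.Finite

/-- The number, modulo `2`, of edges labelled `x` on which `s` changes. -/
noncomputable def flux (s : FreeGroup (Fin n) → ZMod 2) (x : FreeGroup (Fin n)) : ZMod 2 :=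
  ∑ᶠ g, (s (g * x) - s g)

/-- The vertices at which `s` differs from its value at some adjacent vertex farther from `1`. -/
def jumpSet (s : FreeGroup (Fin n) → ZMod 2) : Set (FreeGroup (Fin n)) :=
  {p | ∃ a, ¬ StartsWith a p⁻¹ ∧ s (p * letterVal a) ≠ s p}

theorem IsAlmostInvariant.finite_jumpSet {s : FreeGroup (Fin n) → ZMod 2}
    (hs : IsAlmostInvariant 𝓗 s) : (jumpSet s).Finite := by
  have h1 : (⋃ i, {g | s (g * FreeGroup.of i) ≠ s g}).Finite :=
    Set.finite_iUnion hs.finite_ne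
  have h2 : (⋃ i, (fun g => g * FreeGroup.of i) '' {g | s (g * FreeGroup.of i) ≠ s g}).Finite :=
    Set.finite_iUnion fun i => (hs.finite_ne i).image _
  refine (h1.union h2).subset ?_
  rintro p ⟨⟨i, b⟩, _, hp⟩
  cases b with
  | true => exact Or.inl (Set.mem_iUnion.2 ⟨i, hp⟩)
  | false =>
    refine Or.inr (Set.mem_iUnion.2 ⟨i, p * letterVal (i, false), ?_, ?_⟩)
    · simpa [letterVal_false] using hp.symm
    · simp [letterVal_false]

theorem toWord_mul_letter_of_not {p : FreeGroup (Fin n)} {a : Fin n × Bool}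
    (h : ¬ StartsWith a p⁻¹) : (p * letterVal a).toWord = p.toWord ++ [a] := by
  rcases toWord_mul_letter p a with h1 | h1
  · exact h1
  · have := toWord_inv_head h1
    rw [letterInv_letterInv] at this
    exact absurd this h

theorem eq_of_jumpSet_eq_empty {s : FreeGroup (Fin n) → ZMod 2} (hs : jumpSet s = ∅)
    (g : FreeGroup (Fin n)) : s g = s 1 := by
  have key : ∀ w, FreeGroup.IsReduced w → s (FreeGroup.mk w) = s 1 := by
    intro w
    induction w using List.reverseRecOn with
    | nil => intro _; rw [← FreeGroup.one_eq_mk]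
    | append_singleton w a ih =>
      intro hred
      have hw : FreeGroup.IsReduced w := hred.infix ⟨[], [a], by simp⟩
      rw [← ih hw]
      by_contra hne
      have : FreeGroup.mk w ∈ jumpSet s := by
        refine ⟨a, ?_, ?_⟩
        · intro h
          have h2 : StartsWith (letterInv a) (FreeGroup.mk (w ++ [a]))⁻¹ :=
            toWord_inv_head (toWord_eq_of_isReduced hred)
          rw [← FreeGroup.mul_mk, mul_inv_rev] at h2
          change StartsWith (letterInv a) ((letterVal a)⁻¹ * _) at h2
          rw [← letterVal_letterInv, startsWith_letter_mul, letterInv_letterInv] at h2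
          exact h2 h
        · rw [letterVal, FreeGroup.mul_mk]; exact hne
      rw [hs] at this
      exact this
  have := key g.toWord FreeGroup.isReduced_toWord
  rwa [FreeGroup.mk_toWord] at this

/-- Beyond a vertex of `jumpSet s` of maximal norm, `s` is constant on half-trees. -/
theorem eq_on_halfTree {s : FreeGroup (Fin n) → ZMod 2} {p : FreeGroup (Fin n)}
    (hmax : ∀ q ∈ jumpSet s, q.norm ≤ p.norm) {a : Fin n × Bool} (ha : ¬ StartsWith a p⁻¹)
    {y : FreeGroup (Fin n)} (hy : StartsWith a y) : s (p * y) = s (p * letterVal a) := by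
  have key : ∀ w, FreeGroup.IsReduced (a :: w) →
      s (p * FreeGroup.mk (a :: w)) = s (p * letterVal a) := by
    intro w
    induction w using List.reverseRecOn with
    | nil => intro _; rfl
    | append_singleton w d ih =>
      intro hred
      rw [← List.cons_append] at hred
      have hw : FreeGroup.IsReduced (a :: w) := hred.infix ⟨[], [d], by simp⟩
      rw [← ih hw]
      by_contra hne
      have hnc : ∀ v, FreeGroup.IsReduced (a :: v) →
          (p * FreeGroup.mk (a :: v)).toWord = p.toWord ++ (a :: v) := by
        intro v hv
        have h0 := toWord_eq_of_isReduced hv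
        rw [toWord_mul_of_no_cancel, h0]
        intro l hl hl2
        rw [StartsWith, h0] at hl2
        obtain rfl : a = l := by simpa using hl2
        exact ha hl
      -- A further change of `s` beyond `p` would produce a jump vertex longer than `p`.
      have hmem : p * FreeGroup.mk (a :: w) ∈ jumpSet s := by
        refine ⟨d, ?_, ?_⟩
        · intro h
          have h1 := hnc (w ++ [d]) hred
          rw [← List.cons_append, ← List.append_assoc] at h1
          have h2 := toWord_inv_head h1
          rw [← FreeGroup.mul_mk, ← mul_assoc, mul_inv_rev] at h2
          change StartsWith (letterInv d) ((letterVal d)⁻¹ * _) at h2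
          rw [← letterVal_letterInv, startsWith_letter_mul, letterInv_letterInv] at h2
          exact h2 h
        · rw [letterVal, mul_assoc, FreeGroup.mul_mk]; exact hne
      have h3 := hmax _ hmem
      unfold FreeGroup.norm at h3
      rw [hnc w hw] at h3
      simp at h3
  obtain ⟨w, hw⟩ := startsWith_iff.1 hy
  have hr : FreeGroup.IsReduced y.toWord := FreeGroup.isReduced_toWord
  rw [hw] at hr
  have := key w hr
  rwa [← hw, FreeGroup.mk_toWord] at this

/-- The powers of a loop through the edge give infinitely many elements of H in the half-tree behind
it. -/
theorem CoreDart.infinite {H : Subgroup (FreeGroup (Fin n))} {g : FreeGroup (Fin n)}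
    {a : Fin n × Bool} (h : CoreDart H g a) : {h | h ∈ H ∧ StartsWith a (g⁻¹ * h)}.Infinite := by
  obtain ⟨x, hx, h1, h2⟩ := h
  have hx1 : x ≠ 1 := by
    rintro rfl
    exact not_startsWith_one a h1
  have hinj : Function.Injective fun k : ℕ => g * x ^ (k + (g⁻¹.norm + 1)) * g⁻¹ := by
    intro k l hkl
    have := not_isOfFinOrder_of_isMulTorsionFree hx1
    have := (injective_pow_iff_not_isOfFinOrder.2 this) (mul_left_cancel (mul_right_cancel hkl))
    omega
  refine Set.infinite_of_injective_forall_mem hinj ?_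
  intro k
  refine ⟨?_, ?_⟩
  · rw [← conj_pow]; exact H.pow_mem hx _
  · have := (startsWith_pow_mul h1 h2 g⁻¹ (k + (g⁻¹.norm + 1)) (by omega)).1
    simpa [mul_assoc] using this

/-- The half-trees at `p` in directions from a closed set of letters give almost invariant sets. -/
theorem isAlmostInvariant_halfTrees {E : Set (Fin n × Bool)}
    (hE : ∀ b ∈ E, ∀ d, LinkAdj 𝓗 b d → d ∈ E) (p : FreeGroup (Fin n))
    {r : FreeGroup (Fin n) → ZMod 2}
    (hr1 : ∀ g a, a ∈ E → StartsWith a (p⁻¹ * g) → r g = 1)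
    (hr0 : ∀ g a, a ∉ E → StartsWith a (p⁻¹ * g) → r g = 0) :
    (∀ g a, r (g * letterVal a) ≠ r g → g = p ∨ g * letterVal a = p) ∧
      IsAlmostInvariant 𝓗 r := by
  have hcross : ∀ g a, r (g * letterVal a) ≠ r g → g = p ∨ g * letterVal a = p := by
    intro g a hne
    by_contra! hcon
    obtain ⟨b, hb⟩ : ∃ b, StartsWith b (p⁻¹ * g) := by
      apply exists_startsWith
      intro h; exact hcon.1 (inv_mul_eq_one.1 h).symm
    have hb2 : StartsWith b (p⁻¹ * (g * letterVal a)) := by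
      by_contra h
      rw [← mul_assoc] at h
      obtain ⟨h1, h2⟩ := eq_letter_of_not_startsWith_mul hb h
      apply hcon.2
      rw [h2, letterVal_letterInv, ← h1]
      group
    apply hne
    by_cases hbE : b ∈ E
    · rw [hr1 _ _ hbE hb, hr1 _ _ hbE hb2]
    · rw [hr0 _ _ hbE hb, hr0 _ _ hbE hb2]
  refine ⟨hcross, ?_, ?_⟩
  · intro i
    refine Set.Finite.subset (Set.toFinite {p, p * (FreeGroup.of i)⁻¹}) ?_
    intro g hg
    rcases hcross g (i, true) hg with h | h
    · exact Or.inl h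
    · refine Or.inr ?_
      rw [letterVal_true] at h
      rw [← h, mul_inv_cancel_right]; rfl
  · intro H hH g
    let N : Fin n × Bool → Set (FreeGroup (Fin n)) :=
      fun a => {h | h ∈ H ∧ StartsWith a (p⁻¹ * g * h)}
    have hone : {h | h ∈ H ∧ p⁻¹ * g * h = 1}.Finite := by
      refine Set.Finite.subset (Set.finite_singleton (p⁻¹ * g)⁻¹) ?_
      rintro h ⟨_, hh⟩
      exact eq_inv_of_mul_eq_one_right hh
    -- A coset cannot have infinitely many points both in a direction from E and in one outside E:
    -- these two directions would be adjacent in the Whitehead graph, against closedness.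
    by_cases hinf : ∃ a ∈ E, (N a).Infinite
    · obtain ⟨a, haE, ha⟩ := hinf
      have hfin : ∀ b ∈ Eᶜ, (N b).Finite := by
        intro b hb
        by_contra hbinf
        have hab : a ≠ b := by rintro rfl; exact hb haE
        exact hb (hE a haE b ⟨hab, H, hH, _, coreDart_of_infinite hab ha hbinf,
          coreDart_of_infinite hab.symm hbinf ha⟩)
      refine ⟨1, (((Set.toFinite Eᶜ).biUnion hfin).union hone).subset ?_⟩
      rintro h ⟨hh, hne⟩
      by_cases h1 : p⁻¹ * g * h = 1
      · exact Or.inr ⟨hh, h1⟩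
      · obtain ⟨b, hb⟩ := exists_startsWith h1
        refine Or.inl (Set.mem_biUnion (x := b) ?_ ⟨hh, hb⟩)
        intro hbE
        exact hne (hr1 _ b hbE (by rwa [← mul_assoc]))
    · push Not at hinf
      refine ⟨0, (((Set.toFinite E).biUnion hinf).union hone).subset ?_⟩
      rintro h ⟨hh, hne⟩
      by_cases h1 : p⁻¹ * g * h = 1
      · exact Or.inr ⟨hh, h1⟩
      · obtain ⟨b, hb⟩ := exists_startsWith h1
        refine Or.inl (Set.mem_biUnion (x := b) ?_ ⟨hh, hb⟩)
        by_contra hbE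
        exact hne (hr0 _ b hbE (by rwa [← mul_assoc]))

theorem IsAlmostInvariant.add {s r : FreeGroup (Fin n) → ZMod 2} (hs : IsAlmostInvariant 𝓗 s)
    (hr : IsAlmostInvariant 𝓗 r) : IsAlmostInvariant 𝓗 (s + r) := by
  refine ⟨fun i => ?_, fun H hH g => ?_⟩
  · refine ((hs.finite_ne i).union (hr.finite_ne i)).subset ?_
    intro g hg
    by_contra! hcon
    simp only [Set.mem_union, Set.mem_ofPred_eq, not_or, not_not] at hcon
    exact hg (by simp [hcon.1, hcon.2])
  · obtain ⟨c, hc⟩ := hs.coset H hH g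
    obtain ⟨d, hd⟩ := hr.coset H hH g
    refine ⟨c + d, (hc.union hd).subset ?_⟩
    rintro h ⟨hh, hne⟩
    by_contra! hcon
    simp only [Set.mem_union, Set.mem_ofPred_eq, not_or, not_and, not_not] at hcon
    exact hne (by simp [hcon.1 hh, hcon.2 hh])

theorem flux_add {s r : FreeGroup (Fin n) → ZMod 2} {x : FreeGroup (Fin n)}
    (hs : {g | s (g * x) ≠ s g}.Finite) (hr : {g | r (g * x) ≠ r g}.Finite) :
    flux (s + r) x = flux s x + flux r x := by
  unfold flux
  rw [← finsum_add_distrib]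
  · refine finsum_congr fun g => ?_
    simp only [Pi.add_apply]; ring
  · refine hs.subset fun g hg h => hg (by simp [h])
  · refine hr.subset fun g hg h => hg (by simp [h])

/-- Only the two edges labelled x_i at `p` contribute, and their sum is r(p x_i) − r(p x_i⁻¹). The
two values agree because E is closed under inversion; the value of `r` at `p` drops out and may be
chosen freely. -/
theorem flux_halfTrees {E : Set (Fin n × Bool)} (hinv : ∀ a ∈ E, letterInv a ∈ E)
    {p : FreeGroup (Fin n)} {r : FreeGroup (Fin n) → ZMod 2}
    (hr1 : ∀ g a, a ∈ E → StartsWith a (p⁻¹ * g) → r g = 1)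
    (hr0 : ∀ g a, a ∉ E → StartsWith a (p⁻¹ * g) → r g = 0)
    (hcross : ∀ g a, r (g * letterVal a) ≠ r g → g = p ∨ g * letterVal a = p) (i : Fin n) :
    flux r (FreeGroup.of i) = 0 := by
  unfold flux
  have hne : p ≠ p * (FreeGroup.of i)⁻¹ := by
    intro h
    have h2 : (FreeGroup.of i)⁻¹ = 1 := by simpa using h.symm
    exact FreeGroup.of_ne_one i (inv_eq_one.1 h2)
  rw [finsum_eq_sum_of_support_subset (s := {p, p * (FreeGroup.of i)⁻¹})]
  · rw [Finset.sum_pair hne]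
    have hs : ∀ a : Fin n × Bool, StartsWith a (p⁻¹ * (p * letterVal a)) := by
      intro a
      rw [inv_mul_cancel_left, StartsWith, letterVal, toWord_eq_of_isReduced (by simp)]
      rfl
    have h1 := hs (i, true)
    have h2 := hs (i, false)
    rw [letterVal_true] at h1
    rw [letterVal_false] at h2
    rw [inv_mul_cancel_right]
    by_cases hE : (i, true) ∈ E
    · rw [hr1 _ _ hE h1, hr1 _ _ (hinv _ hE) h2]; ring
    · have hE2 : (i, false) ∉ E := fun h => hE (hinv _ h)
      rw [hr0 _ _ hE h1, hr0 _ _ hE2 h2]; ring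
  · intro g hg
    have hg' : r (g * letterVal (i, true)) ≠ r g := fun h => hg (sub_eq_zero.2 h)
    rcases hcross g _ hg' with h | h
    · simp [h]
    · rw [letterVal_true] at h
      simp [← h]

end CutLetters

/-! ### Vanishing of the flux when there is no cut -/

section FluxVanishes

variable {n : ℕ} {𝓗 : Set (Subgroup (FreeGroup (Fin n)))}

/-- At a vertex of `jumpSet s` of maximal norm, without cut letters, `s` can be flipped on half-trees
so that the vertex leaves the jump set, and only its predecessor may join it. -/
theorem exists_flip (hcut : ∀ a A, ¬ IsCut 𝓗 a A) (hdeg : ∀ a, ∃ b, LinkAdj 𝓗 a b)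
    {s : FreeGroup (Fin n) → ZMod 2} (hs : IsAlmostInvariant 𝓗 s) {p : FreeGroup (Fin n)}
    (hmax : ∀ q ∈ jumpSet s, q.norm ≤ p.norm) :
    ∃ s', IsAlmostInvariant 𝓗 s' ∧ (∀ i, flux s' (FreeGroup.of i) = flux s (FreeGroup.of i)) ∧
      p ∉ jumpSet s' ∧
      ∀ q ∈ jumpSet s', q ∈ jumpSet s ∨ ∃ d, p.toWord = q.toWord ++ [d] := by
  classical
  have hconst : ∀ H ∈ 𝓗, ∀ g c, {h | h ∈ H ∧ s (p * g⁻¹ * h) ≠ c}.Finite → ∀ a,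
      CoreDart H g a → ¬ StartsWith a p⁻¹ → s (p * letterVal a) = c := by
    intro H _ g c hc a ha hap
    by_contra hne
    refine ha.infinite (hc.subset ?_)
    rintro h ⟨hh, hst⟩
    refine ⟨hh, ?_⟩
    rw [mul_assoc, eq_on_halfTree hmax hap hst]
    exact hne
  have hadj : ∀ a b, LinkAdj 𝓗 a b → ¬ StartsWith a p⁻¹ → ¬ StartsWith b p⁻¹ →
      s (p * letterVal a) = s (p * letterVal b) := by
    rintro a b ⟨_, H, hH, g, hga, hgb⟩ ha hb
    obtain ⟨c, hc⟩ := hs.coset H hH (p * g⁻¹)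
    rw [hconst H hH g c hc a hga ha, hconst H hH g c hc b hgb hb]
  -- D and D' split the letters pointing away from `p` by whether `s` changes. Adjacent such letters
  -- carry the same value of `s`, so only the letter pointing back to 1 can link D or D' to its
  -- complement.
  set D : Set (Fin n × Bool) := {a | ¬ StartsWith a p⁻¹ ∧ s (p * letterVal a) ≠ s p} with hD
  set D' : Set (Fin n × Bool) := {a | ¬ StartsWith a p⁻¹ ∧ s (p * letterVal a) = s p} with hD'
  have hDcl : ∀ b ∈ D, ∀ d, LinkAdj 𝓗 b d → d ∈ D ∨ StartsWith d p⁻¹ := by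
    intro b hb d hd
    by_cases hdp : StartsWith d p⁻¹
    · exact Or.inr hdp
    · exact Or.inl ⟨hdp, by rw [← hadj b d hd hb.1 hdp]; exact hb.2⟩
  have hDcl' : ∀ b ∈ D', ∀ d, LinkAdj 𝓗 b d → d ∈ D' ∨ StartsWith d p⁻¹ := by
    intro b hb d hd
    by_cases hdp : StartsWith d p⁻¹
    · exact Or.inr hdp
    · exact Or.inl ⟨hdp, by rw [← hadj b d hd hb.1 hdp]; exact hb.2⟩
  have hclosed : (∀ b ∈ D, ∀ d, LinkAdj 𝓗 b d → d ∈ D) ∨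
      (∀ b ∈ D', ∀ d, LinkAdj 𝓗 b d → d ∈ D') := by
    by_contra! hcon
    obtain ⟨⟨b, hb, c, hbc, hc⟩, b', hb', c', hbc', hc'⟩ := hcon
    have hcp : StartsWith c p⁻¹ := (hDcl b hb c hbc).resolve_left hc
    have hcp' : StartsWith c' p⁻¹ := (hDcl' b' hb' c' hbc').resolve_left hc'
    obtain rfl := hcp.unique hcp'
    -- Both sets are now adjacent to the back letter `c`. Its inverse points away from `p` and so
    -- lies in just one of them; the other set is a cut at `c`.
    have hinv : ¬ StartsWith (letterInv c) p⁻¹ := fun h => letterInv_ne c (h.unique hcp)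
    by_cases hv : s (p * letterVal (letterInv c)) = s p
    · refine hcut c D ⟨hc, fun h => h.2 hv, ?_, b, hb, hbc.symm⟩
      intro e he d hd
      exact (hDcl e he d hd).imp_right fun h => h.unique hcp
    · refine hcut c D' ⟨hc', fun h => hv h.2, ?_, b', hb', hbc'.symm⟩
      intro e he d hd
      exact (hDcl' e he d hd).imp_right fun h => h.unique hcp
  -- the general flip by a function `r` that is constant on the half-trees at `p`
  have main : ∀ E : Set (Fin n × Bool), (∀ b ∈ E, ∀ d, LinkAdj 𝓗 b d → d ∈ E) →
      ∀ r : FreeGroup (Fin n) → ZMod 2,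
      (∀ g a, a ∈ E → StartsWith a (p⁻¹ * g) → r g = 1) →
      (∀ g a, a ∉ E → StartsWith a (p⁻¹ * g) → r g = 0) →
      (∀ a, ¬ StartsWith a p⁻¹ →
        s (p * letterVal a) + r (p * letterVal a) = s p + r p) →
      ∃ s', IsAlmostInvariant 𝓗 s' ∧
        (∀ i, flux s' (FreeGroup.of i) = flux s (FreeGroup.of i)) ∧ p ∉ jumpSet s' ∧
        ∀ q ∈ jumpSet s', q ∈ jumpSet s ∨ ∃ d, p.toWord = q.toWord ++ [d] := by
    intro E hE r hr1 hr0 hp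
    obtain ⟨hcross, hr⟩ := isAlmostInvariant_halfTrees hE p hr1 hr0
    have hinv : ∀ a ∈ E, letterInv a ∈ E := fun a => letterInv_mem_of_closed hcut hdeg hE
    refine ⟨s + r, hs.add hr, ?_, ?_, ?_⟩
    · intro i
      rw [flux_add (hs.finite_ne i) (hr.finite_ne i), flux_halfTrees hinv hr1 hr0 hcross, add_zero]
    · rintro ⟨a, ha, hne⟩
      exact hne (hp a ha)
    · rintro q ⟨a, ha, hne⟩
      by_cases hq : s (q * letterVal a) = s q
      · refine Or.inr ⟨a, ?_⟩
        have hrq : r (q * letterVal a) ≠ r q := by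
          intro h; exact hne (by simp [hq, h])
        rcases hcross q a hrq with rfl | h
        · exact absurd (hp a ha) hne
        · rw [← h, toWord_mul_letter_of_not ha]
      · exact Or.inl ⟨a, ha, hq⟩
  have hstart : ∀ a, StartsWith a (p⁻¹ * (p * letterVal a)) := by
    intro a
    rw [inv_mul_cancel_left, StartsWith, letterVal, toWord_eq_of_isReduced (by simp)]
    rfl
  have hz : ∀ x y : ZMod 2, x ≠ y → x + 1 = y := by decide
  rcases hclosed with hcl | hcl
  · refine main D hcl (fun g => if ∃ a ∈ D, StartsWith a (p⁻¹ * g) then 1 else 0) ?_ ?_ ?_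
    · intro g a ha hst
      exact if_pos ⟨a, ha, hst⟩
    · intro g a ha hst
      refine if_neg ?_
      rintro ⟨b, hb, hst'⟩
      exact ha (by rwa [hst.unique hst'])
    · intro a ha
      have h0 : ¬ ∃ a ∈ D, StartsWith a (p⁻¹ * p) := by
        rintro ⟨b, _, hb⟩
        rw [inv_mul_cancel] at hb
        exact not_startsWith_one b hb
      simp only [if_neg h0]
      by_cases hv : s (p * letterVal a) = s p
      · have h1 : ¬ ∃ b ∈ D, StartsWith b (p⁻¹ * (p * letterVal a)) := by
          rintro ⟨b, hb, hst⟩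
          rw [← (hstart a).unique hst] at hb
          exact hb.2 hv
        rw [if_neg h1, hv]
      · rw [if_pos ⟨a, ⟨ha, hv⟩, hstart a⟩, add_zero]
        exact hz _ _ hv
  -- Here `p` is flipped too, together with the directions in which `s` agrees with s(p): agreement
  -- persists there, and the disagreement in the remaining outward directions is repaired.
  · refine main D' hcl
      (fun g => if g = p ∨ ∃ a ∈ D', StartsWith a (p⁻¹ * g) then 1 else 0) ?_ ?_ ?_
    · intro g a ha hst
      exact if_pos (Or.inr ⟨a, ha, hst⟩)
    · intro g a ha hst
      refine if_neg ?_
      rintro (rfl | ⟨b, hb, hst'⟩)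
      · rw [inv_mul_cancel] at hst
        exact not_startsWith_one a hst
      · exact ha (by rwa [hst.unique hst'])
    · intro a ha
      simp only [true_or, if_true]
      by_cases hv : s (p * letterVal a) = s p
      · rw [if_pos (Or.inr ⟨a, ⟨ha, hv⟩, hstart a⟩), hv]
      · have h1 : ¬ (p * letterVal a = p ∨ ∃ b ∈ D', StartsWith b (p⁻¹ * (p * letterVal a))) := by
          rintro (h | ⟨b, hb, hst⟩)
          · exact hv (by rw [h])
          · rw [← (hstart a).unique hst] at hb
            exact hv hb.2
        rw [if_neg h1, add_zero]
        exact (hz _ _ (Ne.symm hv)).symm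

/-- Induction on the total weight of the jump set. A flip trades a farthest vertex for at most its
predecessor, which is one letter shorter. The summand 1 in the weight makes the removal of the
vertex 1 count as well. -/
theorem flux_eq_zero (hcut : ∀ a A, ¬ IsCut 𝓗 a A) (hdeg : ∀ a, ∃ b, LinkAdj 𝓗 a b) (m : ℕ) :
    ∀ {s : FreeGroup (Fin n) → ZMod 2} (hs : IsAlmostInvariant 𝓗 s),
      ∑ p ∈ hs.finite_jumpSet.toFinset, (p.norm + 1) = m →
      ∀ i, flux s (FreeGroup.of i) = 0 := by
  classical
  induction m using Nat.strong_induction_on with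
  | _ m ih =>
    intro s hs hm i
    rcases Set.eq_empty_or_nonempty (jumpSet s) with h0 | hne
    · unfold flux
      rw [← finsum_zero (α := FreeGroup (Fin n))]
      refine finsum_congr fun g => ?_
      rw [eq_of_jumpSet_eq_empty h0, eq_of_jumpSet_eq_empty h0 g, sub_self]
    · obtain ⟨p, hp, hmax⟩ := Set.exists_max_image _ FreeGroup.norm hs.finite_jumpSet hne
      obtain ⟨s', hs', hflux, hps', hsub⟩ := exists_flip hcut hdeg hs hmax
      rw [← hflux i]
      refine ih _ ?_ hs' rfl i
      rw [← hm, ← Finset.add_sum_erase _ _ (hs.finite_jumpSet.mem_toFinset.2 hp)]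
      set P := hs.finite_jumpSet.toFinset.erase p with hP
      by_cases hall : hs'.finite_jumpSet.toFinset ⊆ P
      · have := Finset.sum_le_sum_of_subset (f := fun q => FreeGroup.norm q + 1) hall
        omega
      · obtain ⟨q, hq, hqP⟩ := Finset.not_subset.1 hall
        have hmemP : ∀ q ∈ jumpSet s', q ∈ jumpSet s → q ∈ P := by
          intro q h1 h2
          refine Finset.mem_erase.2 ⟨?_, hs.finite_jumpSet.mem_toFinset.2 h2⟩
          rintro rfl; exact hps' h1
        rw [Set.Finite.mem_toFinset] at hq
        obtain ⟨d, hd⟩ := (hsub q hq).resolve_left fun h => hqP (hmemP q hq h)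
        -- The predecessor of `p` is determined by the word of `p`, so at most one vertex is new.
        have hins : hs'.finite_jumpSet.toFinset ⊆ insert q P := by
          intro q' hq'
          rw [Set.Finite.mem_toFinset] at hq'
          rcases hsub q' hq' with h | ⟨d', hd'⟩
          · exact Finset.mem_insert_of_mem (hmemP q' hq' h)
          · rw [hd] at hd'
            obtain ⟨h1, _⟩ := List.append_inj' hd' rfl
            rw [FreeGroup.toWord_injective h1]
            exact Finset.mem_insert_self _ _
        have h1 := Finset.sum_le_sum_of_subset (f := fun q => FreeGroup.norm q + 1) hins
        rw [Finset.sum_insert hqP] at h1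
        have h2 : p.norm = q.norm + 1 := by
          unfold FreeGroup.norm; rw [hd]; simp
        omega

end FluxVanishes

/-! ### The cut vertex lemma -/

section FreeFactorFlux

variable {n : ℕ}

theorem FreeGroupBasis.closure_range {ι G : Type*} [Group G] (b : FreeGroupBasis ι G) :
    Subgroup.closure (Set.range b) = ⊤ := by
  have h : Set.range b = b.repr.symm.toMonoidHom '' Set.range FreeGroup.of := by
    rw [← Set.range_comp]; rfl
  rw [h, ← MonoidHom.map_closure, FreeGroup.closure_range_of,
    Subgroup.map_top_of_surjective _ b.repr.symm.surjective]

open Classical in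
/-- A function on a free group that changes only along a single edge of the Cayley graph of a given
basis. -/
theorem exists_jump_at_one {κ G : Type*} [Group G] (c : FreeGroupBasis κ G) (m : κ) :
    ∃ s : G → ZMod 2, ∀ g j, s (g * c j) = s g + if j = m ∧ g = 1 then 1 else 0 := by
  let e : κ → G → ZMod 2 := fun j g => if j = m ∧ g = 1 then 1 else 0
  -- The function is the second coordinate of an orbit: each basis element acts on G × ℤ/2 by right
  -- translation and a shear that records the prescribed jump.
  let σ : κ → Equiv.Perm (G × ZMod 2) := fun j =>
    { toFun := fun x => (x.1 * c j, x.2 + e j x.1)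
      invFun := fun x => (x.1 * (c j)⁻¹, x.2 - e j (x.1 * (c j)⁻¹))
      left_inv := fun x => by simp
      right_inv := fun x => by simp }
  -- Inverses turn right translations into a left action, so that `ρ g⁻¹` sends (1, 0) to a point
  -- above `g`.
  let ρ : G →* Equiv.Perm (G × ZMod 2) := c.lift fun j => (σ j)⁻¹
  have hρ : ∀ j, ρ (c j) = (σ j)⁻¹ := fun j => by simp [ρ]
  have hfst : ∀ h x, (ρ h x).1 = x.1 * h⁻¹ := by
    intro h
    have hh : h ∈ Subgroup.closure (Set.range c) := by rw [c.closure_range]; trivial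
    induction hh using Subgroup.closure_induction with
    | mem h hmem =>
      obtain ⟨j, rfl⟩ := hmem
      intro x; rw [hρ]; rfl
    | one => simp
    | mul a b _ _ iha ihb =>
      intro x
      rw [map_mul, Equiv.Perm.mul_apply, iha, ihb, mul_inv_rev, mul_assoc]
    | inv a _ iha =>
      intro x
      have := iha (ρ a⁻¹ x)
      rw [← Equiv.Perm.mul_apply, ← map_mul, mul_inv_cancel, map_one, Equiv.Perm.one_apply] at this
      rw [this]; simp
  refine ⟨fun g => (ρ g⁻¹ (1, 0)).2, fun g j => ?_⟩
  have hfg : ρ g⁻¹ (1, 0) = (g, (ρ g⁻¹ (1, 0)).2) := by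
    apply Prod.ext
    · rw [hfst]; simp
    · rfl
  change (ρ (g * c j)⁻¹ (1, 0)).2 = (ρ g⁻¹ (1, 0)).2 + e j g
  rw [mul_inv_rev, map_mul, Equiv.Perm.mul_apply, map_inv, hρ, inv_inv, hfg]
  rfl

theorem exists_notMem_range_of_ne_top {J : Subgroup (FreeGroup (Fin n))} (hJ : J ≠ ⊤)
    {ι κ : Type} {b : FreeGroupBasis ι J} {c : FreeGroupBasis κ (FreeGroup (Fin n))} {e : ι → κ}
    (he : ∀ i, c (e i) = (b i : FreeGroup (Fin n))) : ∃ m, m ∉ Set.range e := by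
  by_contra! hall
  apply hJ
  rw [eq_top_iff, ← c.closure_range, Subgroup.closure_le]
  rintro _ ⟨j, rfl⟩
  obtain ⟨i, rfl⟩ := hall j
  rw [he]
  exact (b i).2

/-- Whitehead's cut vertex lemma for subgroups: subgroups which are conjugate into a proper free
factor have a Whitehead graph with a cut letter, if each letter has a neighbour. -/
theorem exists_isCut {𝓗 : Set (Subgroup (FreeGroup (Fin n)))}
    (hdeg : ∀ a, ∃ b, LinkAdj 𝓗 a b) {J : Subgroup (FreeGroup (Fin n))} (hJ : IsFreeFactor J)
    (hJtop : J ≠ ⊤) (hHJ : ∀ H ∈ 𝓗, ∃ u : FreeGroup (Fin n), ∀ h ∈ H, u * h * u⁻¹ ∈ J) :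
    ∃ a A, IsCut 𝓗 a A := by
  classical
  by_contra! hcut
  obtain ⟨ι, κ, b, c, e, he⟩ := hJ
  obtain ⟨m, hm⟩ := exists_notMem_range_of_ne_top hJtop he
  obtain ⟨s, hs⟩ := exists_jump_at_one c m
  -- The elements whose right translation changes `s` at only finitely many points form a subgroup.
  -- It contains the basis `c`, hence everything, so finiteness passes to the standard generators.
  let K : Subgroup (FreeGroup (Fin n)) :=
    { carrier := {h | {g | s (g * h) ≠ s g}.Finite}
      one_mem' := by simp
      mul_mem' := by
        intro x y hx hy
        refine ((hy.preimage (mul_left_injective x).injOn).union hx).subset ?_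
        intro g hg
        by_contra! hcon
        simp only [Set.mem_union, Set.mem_preimage, Set.mem_ofPred_eq, not_or, not_not] at hcon
        exact hg (by rw [← mul_assoc, hcon.1, hcon.2])
      inv_mem' := by
        intro x hx
        refine (hx.image fun g => g * x).subset ?_
        intro g hg
        exact ⟨g * x⁻¹, by simpa using Ne.symm hg, by simp⟩ }
  have hfin : ∀ h, {g | s (g * h) ≠ s g}.Finite := by
    intro h
    have : h ∈ K := by
      have htop : h ∈ Subgroup.closure (Set.range c) := by rw [c.closure_range]; trivial
      refine (Subgroup.closure_le K).2 ?_ htop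
      rintro _ ⟨j, rfl⟩
      refine (Set.finite_singleton (1 : FreeGroup (Fin n))).subset ?_
      intro g hg
      by_contra h1
      exact hg (by rw [hs, if_neg (fun h => h1 h.2), add_zero])
    exact this
  -- The jump occurs along the basis element `m`, which is not among those generating J.
  have hJs : ∀ h ∈ J, ∀ g, s (g * h) = s g := by
    intro h hh
    have h1 : (⟨h, hh⟩ : J) ∈ Subgroup.closure (Set.range b) := by rw [b.closure_range]; trivial
    have key : ∀ x : J, x ∈ Subgroup.closure (Set.range b) → ∀ g, s (g * x) = s g := by
      intro x hx
      induction hx using Subgroup.closure_induction with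
      | mem x hmem =>
        obtain ⟨i, rfl⟩ := hmem
        intro g
        rw [← he, hs, if_neg, add_zero]
        rintro ⟨h2, _⟩
        exact hm ⟨i, h2⟩
      | one => simp
      | mul x y _ _ ihx ihy =>
        intro g
        rw [Subgroup.coe_mul, ← mul_assoc, ihy, ihx]
      | inv x _ ihx =>
        intro g
        rw [← ihx (g * _)]; simp
    exact key _ h1
  -- Since g h u⁻¹ = (g u⁻¹)(u h u⁻¹) with u h u⁻¹ in J, the value s(g h u⁻¹) does not depend on
  -- `h`, and it differs from s(gh) only finitely often.
  have hinv : IsAlmostInvariant 𝓗 s := by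
    refine ⟨fun i => hfin _, fun H hH g => ?_⟩
    obtain ⟨u, hu⟩ := hHJ H hH
    refine ⟨s (g * u⁻¹), ((hfin u⁻¹).preimage (mul_right_injective g).injOn).subset ?_⟩
    rintro h ⟨hh, hne⟩
    intro heq
    apply hne
    rw [← heq]
    have : g * h * u⁻¹ = g * u⁻¹ * (u * h * u⁻¹) := by group
    rw [this, hJs _ (hu h hh)]
  have hzero : ∀ i, flux s (FreeGroup.of i) = 0 := fun i =>
    flux_eq_zero hcut hdeg _ hinv rfl i
  -- The difference s(gxy) − s(g) telescopes through gx, and g ↦ gx permutes the group.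
  have hmul : ∀ x y, flux s (x * y) = flux s x + flux s y := by
    intro x y
    have hsupp : ∀ x, (Function.support fun g => s (g * x) - s g).Finite := fun x =>
      (hfin x).subset fun g hg h => hg (sub_eq_zero.2 h)
    unfold flux
    rw [← finsum_comp_equiv (Equiv.mulRight x) (f := fun g => s (g * y) - s g), add_comm,
      ← finsum_add_distrib]
    · refine finsum_congr fun g => ?_
      simp only [Equiv.coe_mulRight, mul_assoc]; ring
    · exact (hsupp y).preimage (Equiv.mulRight x).injective.injOn
    · exact hsupp x
  let Φ : FreeGroup (Fin n) →* Multiplicative (ZMod 2) :=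
    MonoidHom.mk' (fun x => Multiplicative.ofAdd (flux s x)) fun x y => by rw [hmul]; rfl
  have hΦ : Φ = 1 := by
    apply FreeGroup.ext_hom
    intro i
    change Multiplicative.ofAdd (flux s (FreeGroup.of i)) = 1
    rw [hzero]; rfl
  have h1 : flux s (c m) = 0 := congrArg Multiplicative.toAdd (DFunLike.congr_fun hΦ (c m))
  have h2 : flux s (c m) = 1 := by
    unfold flux
    rw [finsum_eq_single _ 1]
    · rw [hs, if_pos ⟨rfl, rfl⟩]; ring
    · intro g hg
      rw [hs, if_neg (fun h => hg h.2)]; ring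
  rw [h1] at h2
  exact absurd h2 (by decide)

end FreeFactorFlux

/-! ### Whitehead automorphisms -/

section WhiteheadAut

variable {n : ℕ}

theorem letterVal_fst (b : Fin n × Bool) :
    letterVal b = if b.2 then FreeGroup.of b.1 else (FreeGroup.of b.1)⁻¹ := by
  rcases b with ⟨i, s⟩
  cases s
  · simp [letterVal_false]
  · simp [letterVal_true]

open Classical in
/-- The Whitehead endomorphism `(A, a)`. -/
noncomputable def whiteheadHom (a : Fin n × Bool) (A : Set (Fin n × Bool)) :
    FreeGroup (Fin n) →* FreeGroup (Fin n) :=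
  FreeGroup.lift fun j => if j = a.1 then FreeGroup.of j else
    (if (j, true) ∈ A then letterVal a else 1) * FreeGroup.of j *
      (if (j, false) ∈ A then (letterVal a)⁻¹ else 1)

theorem whiteheadHom_of_fst (a : Fin n × Bool) (A : Set (Fin n × Bool)) {b : Fin n × Bool}
    (hb : b.1 = a.1) : whiteheadHom a A (letterVal b) = letterVal b := by
  rw [letterVal_fst]
  split_ifs <;> simp [whiteheadHom, hb]

open Classical in
theorem whiteheadHom_of_ne (a : Fin n × Bool) (A : Set (Fin n × Bool)) {b : Fin n × Bool}
    (hb : b.1 ≠ a.1) : whiteheadHom a A (letterVal b) =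
      (if b ∈ A then letterVal a else 1) * letterVal b *
        (if letterInv b ∈ A then (letterVal a)⁻¹ else 1) := by
  rcases b with ⟨i, s⟩
  cases s
  · simp only [letterVal_false, map_inv, letterInv, Bool.not_false]
    simp only [whiteheadHom, FreeGroup.lift_apply_of, if_neg hb, mul_inv_rev]
    split_ifs <;> simp [mul_assoc]
  · simp only [letterVal_true, letterInv, Bool.not_true]
    simp only [whiteheadHom, FreeGroup.lift_apply_of, if_neg hb]

/-- Both maps fix the letter `a`, so the factors inserted by the first are cancelled by the second.
-/
theorem whiteheadHom_comp (a : Fin n × Bool) (A : Set (Fin n × Bool)) :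
    (whiteheadHom (letterInv a) A).comp (whiteheadHom a A) = MonoidHom.id _ := by
  apply FreeGroup.ext_hom
  intro j
  rw [MonoidHom.comp_apply, MonoidHom.id_apply, ← letterVal_true]
  by_cases hj : j = a.1
  · rw [whiteheadHom_of_fst a A (b := (j, true)) hj,
      whiteheadHom_of_fst (letterInv a) A (b := (j, true)) hj]
  · have ha : whiteheadHom (letterInv a) A (letterVal a) = letterVal a :=
      whiteheadHom_of_fst _ _ rfl
    rw [whiteheadHom_of_ne a A (b := (j, true)) hj, map_mul, map_mul,
      whiteheadHom_of_ne (letterInv a) A (b := (j, true)) hj, letterVal_letterInv]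
    split_ifs <;> simp [ha, mul_assoc]

/-- The Whitehead automorphism `(A, a)`. -/
noncomputable def whiteheadEquiv (a : Fin n × Bool) (A : Set (Fin n × Bool)) :
    FreeGroup (Fin n) ≃* FreeGroup (Fin n) :=
  MonoidHom.toMulEquiv (whiteheadHom a A) (whiteheadHom (letterInv a) A) (whiteheadHom_comp a A)
    (by simpa [letterInv_letterInv] using whiteheadHom_comp (letterInv a) A)

theorem whiteheadEquiv_apply (a : Fin n × Bool) (A : Set (Fin n × Bool))
    (g : FreeGroup (Fin n)) : whiteheadEquiv a A g = whiteheadHom a A g := rfl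

theorem isWhiteheadAut_whiteheadEquiv {a : Fin n × Bool} {A : Set (Fin n × Bool)} (ha : a ∉ A)
    (ha' : letterInv a ∉ A) : IsWhiteheadAut (whiteheadEquiv a A) := by
  refine ⟨a, A, ha, ha', whiteheadHom_of_fst a A rfl, fun j hj => ?_⟩
  exact whiteheadHom_of_ne a A (b := (j, true)) hj

theorem exists_eq_whiteheadEquiv {φ : FreeGroup (Fin n) ≃* FreeGroup (Fin n)}
    (hφ : IsWhiteheadAut φ) : ∃ a A, φ = whiteheadEquiv a A := by
  obtain ⟨a, A, _, _, hfix, h⟩ := hφ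
  refine ⟨a, A, ?_⟩
  have : φ.toMonoidHom = whiteheadHom a A := by
    apply FreeGroup.ext_hom
    intro j
    by_cases hj : j = a.1
    · have h1 : whiteheadHom a A (letterVal (j, true)) = letterVal (j, true) :=
        whiteheadHom_of_fst a A hj
      rw [letterVal_true] at h1
      rw [h1]
      rw [letterVal_fst, ← hj] at hfix
      split_ifs at hfix
      · exact hfix
      · rw [map_inv, inv_inj] at hfix
        exact hfix
    · have h1 := whiteheadHom_of_ne a A (b := (j, true)) hj
      rw [letterVal_true] at h1
      rw [h1]
      exact h j hj
  ext g
  exact DFunLike.congr_fun this g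

end WhiteheadAut

/-! ### The effect of a Whitehead automorphism on the core -/

section CoreReduction

variable {n : ℕ} {H : Subgroup (FreeGroup (Fin n))} {a : Fin n × Bool} {A : Set (Fin n × Bool)}

/-- Some edge of the core that leaves `H g` has its label in `A`. -/
def TypeA (H : Subgroup (FreeGroup (Fin n))) (A : Set (Fin n × Bool)) (g : FreeGroup (Fin n)) :
    Prop := ∃ b ∈ A, CoreDart H g b

open Classical in
/-- The vertex of the covering for `φ(H)` that a vertex `H g` of the core for `H` is moved to by a
Whitehead automorphism `φ = (A, a)`. -/
noncomputable def moveVert (H : Subgroup (FreeGroup (Fin n))) (a : Fin n × Bool)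
    (A : Set (Fin n × Bool)) (g : FreeGroup (Fin n)) : FreeGroup (Fin n) :=
  whiteheadHom a A g * if TypeA H A g then letterVal a else 1

/-- The edges that a Whitehead automorphism `(A, a)` collapses. -/
def Collapsed (H : Subgroup (FreeGroup (Fin n))) (a : Fin n × Bool)
    (A : Set (Fin n × Bool)) (g : FreeGroup (Fin n)) (b : Fin n × Bool) : Prop :=
  (b = a ∧ TypeA H A g) ∨ (b = letterInv a ∧ TypeA H A (g * letterVal b))

theorem typeA_mul_left_iff {h : FreeGroup (Fin n)} (hh : h ∈ H) {g : FreeGroup (Fin n)} :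
    TypeA H A (h * g) ↔ TypeA H A g := by
  simp only [TypeA, coreDart_mul_left_iff hh]

theorem moveVert_mul_left {h : FreeGroup (Fin n)} (hh : h ∈ H) (g : FreeGroup (Fin n)) :
    moveVert H a A (h * g) = whiteheadHom a A h * moveVert H a A g := by
  unfold moveVert
  by_cases hg : TypeA H A g
  · rw [if_pos hg, if_pos ((typeA_mul_left_iff hh).2 hg), map_mul, mul_assoc]
  · rw [if_neg hg, if_neg fun h1 => hg ((typeA_mul_left_iff hh).1 h1), map_mul, mul_assoc]

theorem not_typeA_of_coreDart_inv (haA : letterInv a ∉ A)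
    (hcl : ∀ g b c, CoreDart H g b → CoreDart H g c → b ∈ A → c ∈ A ∨ c = a)
    {g : FreeGroup (Fin n)} (h : CoreDart H g (letterInv a)) :
    ¬ TypeA H A g := by
  rintro ⟨b, hb, hbg⟩
  rcases hcl g b _ hbg h hb with h1 | h1
  · exact haA h1
  · exact letterInv_ne a h1

theorem typeA_iff_of_coreDart
    (hcl : ∀ g b c, CoreDart H g b → CoreDart H g c → b ∈ A → c ∈ A ∨ c = a)
    {g : FreeGroup (Fin n)} {b : Fin n × Bool} (h : CoreDart H g b)
    (hb : b ≠ a) : TypeA H A g ↔ b ∈ A := by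
  refine ⟨?_, fun h1 => ⟨b, h1, h⟩⟩
  rintro ⟨c, hc, hcg⟩
  exact (hcl g c b hcg h hc).resolve_right hb

/-- For an edge with a label other than a and a⁻¹, the label lies in A exactly when the start is
pushed, and its inverse lies in A exactly when the end is pushed. The letters inserted by φ
therefore cancel against the pushes, and only a-edges with a pushed start shrink to a point. -/
theorem moveVert_mul_letter (haA : letterInv a ∉ A)
    (hcl : ∀ g b c, CoreDart H g b → CoreDart H g c → b ∈ A → c ∈ A ∨ c = a)
    {g : FreeGroup (Fin n)} {b : Fin n × Bool} (h : CoreDart H g b) :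
    (Collapsed H a A g b ∧ moveVert H a A (g * letterVal b) = moveVert H a A g) ∨
    (¬ Collapsed H a A g b ∧
      moveVert H a A (g * letterVal b) = moveVert H a A g * letterVal b) := by
  unfold moveVert
  rw [map_mul]
  by_cases hba : b = a
  · subst hba
    have h1 : ¬ TypeA H A (g * letterVal b) := not_typeA_of_coreDart_inv haA hcl h.symm
    rw [if_neg h1, whiteheadHom_of_fst _ _ rfl, mul_one]
    by_cases h2 : TypeA H A g
    · exact Or.inl ⟨Or.inl ⟨rfl, h2⟩, by rw [if_pos h2]⟩
    · refine Or.inr ⟨?_, by rw [if_neg h2, mul_one]⟩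
      rintro (h3 | h3)
      · exact h2 h3.2
      · exact letterInv_ne b h3.1.symm
  · by_cases hba' : b = letterInv a
    · subst hba'
      have h1 : ¬ TypeA H A g := not_typeA_of_coreDart_inv haA hcl h
      rw [if_neg h1, whiteheadHom_of_fst a A (b := letterInv a) rfl, mul_one]
      by_cases h2 : TypeA H A (g * letterVal (letterInv a))
      · refine Or.inl ⟨Or.inr ⟨rfl, h2⟩, ?_⟩
        rw [if_pos h2, letterVal_letterInv, inv_mul_cancel_right]
      · refine Or.inr ⟨?_, by rw [if_neg h2, mul_one]⟩
        rintro (h3 | h3)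
        · exact hba h3.1
        · exact h2 h3.2
    · have hb1 : b.1 ≠ a.1 := by
        rcases a with ⟨i, s⟩
        rcases b with ⟨j, t⟩
        rintro rfl
        cases s <;> cases t <;> simp_all [letterInv]
      have hb2 : letterInv b ≠ a := fun h3 => hba' (by rw [← h3, letterInv_letterInv])
      refine Or.inr ⟨?_, ?_⟩
      · rintro (h3 | h3)
        · exact hba h3.1
        · exact hba' h3.1
      · rw [whiteheadHom_of_ne a A hb1]
        have e1 := typeA_iff_of_coreDart hcl h hba
        have e2 := typeA_iff_of_coreDart hcl h.symm hb2
        by_cases h1 : b ∈ A <;> by_cases h2 : letterInv b ∈ A <;>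
          simp [h1, h2, e1, e2, mul_assoc]

/-- The core for `φ(H)` is contained in the image of the edges that are not collapsed. -/
theorem coreDart_map_whitehead (haA : letterInv a ∉ A)
    (hcl : ∀ g b c, CoreDart H g b → CoreDart H g c → b ∈ A → c ∈ A ∨ c = a)
    {y : FreeGroup (Fin n)} {b : Fin n × Bool}
    (hy : CoreDart (H.map (whiteheadHom a A)) y b) :
    ∃ g, CoreDart H g b ∧ ¬ Collapsed H a A g b ∧
      ∃ h ∈ H.map (whiteheadHom a A), y = h * moveVert H a A g := by
  -- Q is the image of the surviving edges. Moved core paths stay in Q, so Q carries a loop for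
  -- every element of φ(H) and hence contains the core.
  let Q : FreeGroup (Fin n) → Fin n × Bool → Prop := fun y b =>
    ∃ g, CoreDart H g b ∧ ¬ Collapsed H a A g b ∧
      ∃ h ∈ H.map (whiteheadHom a A), y = h * moveVert H a A g
  have hQ : ∀ h ∈ H.map (whiteheadHom a A), ∀ y b, Q y b → Q (h * y) b := by
    rintro h hh y b ⟨g, h1, h2, h', hh', rfl⟩
    exact ⟨g, h1, h2, h * h', Subgroup.mul_mem _ hh hh', by rw [mul_assoc]⟩
  have hpath : ∀ w g, PathIn (CoreDart H) g w → ∃ w', PathIn Q (moveVert H a A g) w' ∧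
      moveVert H a A g * FreeGroup.mk w' = moveVert H a A (g * FreeGroup.mk w) := by
    intro w
    induction w with
    | nil => intro g _; exact ⟨[], trivial, by simp [← FreeGroup.one_eq_mk]⟩
    | cons b w ih =>
      intro g hw
      obtain ⟨w', hw', hend⟩ := ih _ hw.2
      rw [mul_assoc, ← mk_cons] at hend
      rcases moveVert_mul_letter haA hcl hw.1 with ⟨_, h2⟩ | ⟨h1, h2⟩
      · rw [h2] at hw' hend
        exact ⟨w', hw', hend⟩
      · rw [h2] at hw' hend
        refine ⟨b :: w', ⟨⟨g, hw.1, h1, 1, Subgroup.one_mem _, (one_mul _).symm⟩, hw'⟩, ?_⟩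
        rw [mk_cons, ← mul_assoc, hend]
  have hbot : H ≠ ⊥ := by
    rintro rfl
    obtain ⟨x, hx, h1, _⟩ := hy
    rw [Subgroup.map_bot, Subgroup.mem_bot, conj_eq_one_iff] at hx
    exact not_startsWith_one b (hx ▸ h1)
  obtain ⟨g₀, hg₀⟩ := exists_coreVert hbot
  refine CoreDart.mem_of_pathIn (Q := Q) hQ (x₀ := moveVert H a A g₀) ?_ hy
  rintro _ ⟨h, hh, rfl⟩
  -- The element `h` is rewritten as a loop based at the core vertex `g₀`, whose path stays in the
  -- core.
  have hmem : g₀ * (g₀⁻¹ * h * g₀) * g₀⁻¹ ∈ H := by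
    convert (show h ∈ H from hh) using 1; group
  obtain ⟨w', hw', hend⟩ := hpath _ _ (hg₀.pathIn hmem)
  refine ⟨w', hw', ?_⟩
  rw [hend, FreeGroup.mk_toWord, ← moveVert_mul_left hh]
  congr 1
  group

end CoreReduction

/-! ### Counting vertices and edges after a Whitehead automorphism -/

section CoreCard

variable {n : ℕ} {H : Subgroup (FreeGroup (Fin n))} {a : Fin n × Bool} {A : Set (Fin n × Bool)}

/-- The map on vertices of the coverings that `moveVert` induces. -/
noncomputable def moveCoset (H : Subgroup (FreeGroup (Fin n))) (a : Fin n × Bool)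
    (A : Set (Fin n × Bool)) (q : (coverGraph H).V) :
    (coverGraph (H.map (whiteheadHom a A))).V :=
  rcoset _ (moveVert H a A (Classical.choose (exists_rcoset q)))

theorem moveCoset_rcoset (g : FreeGroup (Fin n)) :
    moveCoset H a A (rcoset H g) = rcoset _ (moveVert H a A g) := by
  have h := Classical.choose_spec (exists_rcoset (rcoset H g))
  rw [rcoset_eq_iff] at h
  unfold moveCoset
  set g' := Classical.choose (exists_rcoset (rcoset H g))
  have hg : g = g * g'⁻¹ * g' := by group
  conv_rhs => rw [hg, moveVert_mul_left h]
  exact (rcoset_mul_left (Subgroup.mem_map_of_mem _ h) _).symm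

/-- A pushed vertex with an outgoing a-edge has the same image as the other end of that edge. That
end is never pushed, so it can serve as the preimage instead. -/
theorem coreV_map_subset (haA : letterInv a ∉ A)
    (hcl : ∀ g b c, CoreDart H g b → CoreDart H g c → b ∈ A → c ∈ A ∨ c = a) :
    (coverGraph (H.map (whiteheadHom a A))).coreV ⊆
      moveCoset H a A '' ((coverGraph H).coreV \ {q | ∃ g, rcoset H g = q ∧ CoreDart H g a ∧
        TypeA H A g}) := by
  intro q hq
  obtain ⟨y, rfl⟩ := exists_rcoset q
  obtain ⟨b, hb⟩ := mem_coreV_iff.1 hq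
  obtain ⟨g, hgb, _, h, hh, rfl⟩ := coreDart_map_whitehead haA hcl hb
  rw [rcoset_mul_left hh]
  have hiff : ∀ {g'}, (∃ g'', rcoset H g'' = rcoset H g' ∧ CoreDart H g'' a ∧ TypeA H A g'') ↔
      CoreDart H g' a ∧ TypeA H A g' := by
    intro g'
    refine ⟨?_, fun h => ⟨g', rfl, h⟩⟩
    rintro ⟨g'', h1, h2, c, hc, h3⟩
    exact ⟨(coreDart_congr h1).1 h2, c, hc, (coreDart_congr h1).1 h3⟩
  by_cases hbad : CoreDart H g a ∧ TypeA H A g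
  · refine ⟨rcoset H (g * letterVal a), ⟨mem_coreV_iff.2 hbad.1.coreVert_mul, ?_⟩, ?_⟩
    · rw [Set.mem_ofPred_eq, hiff]
      exact fun h => not_typeA_of_coreDart_inv haA hcl hbad.1.symm h.2
    · rw [moveCoset_rcoset]
      rcases moveVert_mul_letter haA hcl hbad.1 with ⟨_, h2⟩ | ⟨h1, _⟩
      · rw [h2]
      · exact absurd (Or.inl ⟨rfl, hbad.2⟩) h1
  · refine ⟨rcoset H g, ⟨mem_coreV_iff.2 ⟨b, hgb⟩, ?_⟩, moveCoset_rcoset g⟩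
    rwa [Set.mem_ofPred_eq, hiff]

/-- Surviving edges keep their labels, so the map is the identity on the second component. -/
theorem coreE_map_subset (haA : letterInv a ∉ A)
    (hcl : ∀ g b c, CoreDart H g b → CoreDart H g c → b ∈ A → c ∈ A ∨ c = a) :
    (coverGraph (H.map (whiteheadHom a A))).coreE ⊆
      (fun e : (coverGraph H).V × Fin n => (moveCoset H a A e.1, e.2)) ''
        ((coverGraph H).coreE \ {e | ∃ g, (rcoset H g, e.2) = e ∧
          Collapsed H a A g (e.2, true)}) := by
  rintro ⟨q, i⟩ hq
  obtain ⟨y, rfl⟩ := exists_rcoset q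
  obtain ⟨g, hgb, hcol, h, hh, rfl⟩ := coreDart_map_whitehead haA hcl (mem_coreE_iff.1 hq)
  refine ⟨(rcoset H g, i), ⟨mem_coreE_iff.2 hgb, ?_⟩, ?_⟩
  · rintro ⟨g', h1, h2⟩
    have h3 : rcoset H g' = rcoset H g := congrArg Prod.fst h1
    apply hcol
    rcases h2 with ⟨h2, c, hc, h4⟩ | ⟨h2, c, hc, h4⟩
    · exact Or.inl ⟨h2, c, hc, (coreDart_congr h3).1 h4⟩
    · exact Or.inr ⟨h2, c, hc, (coreDart_congr (rcoset_mul_right h3 _)).1 h4⟩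
  · change (moveCoset H a A (rcoset H g), i) = _
    rw [moveCoset_rcoset, rcoset_mul_left hh]
    rfl

theorem Set.encard_le_of_subset_image_diff {α β : Type*} {s : Set α} {t : Set β} {B : Set α}
    {f : α → β} (h : t ⊆ f '' (s \ B)) : t.encard ≤ s.encard :=
  (Set.encard_le_encard h).trans ((Set.encard_image_le f _).trans
    (Set.encard_le_encard Set.sdiff_subset))

theorem Set.encard_lt_of_subset_image_diff {α β : Type*} {s : Set α} {t : Set β} {B : Set α}
    {f : α → β} (hs : s.Finite) (hB : ∃ x ∈ s, x ∈ B) (h : t ⊆ f '' (s \ B)) :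
    t.encard < s.encard := by
  obtain ⟨x, hx, hxB⟩ := hB
  exact ((Set.encard_le_encard h).trans (Set.encard_image_le f _)).trans_lt
    ((hs.subset Set.sdiff_subset).encard_lt_encard
      (Set.ssubset_iff_subset_ne.2 ⟨Set.sdiff_subset, fun h2 => (h2.symm.subset hx).2 hxB⟩))

end CoreCard

/-! ### Finiteness of cores -/

section CoreFinite

variable {n : ℕ}

/-- All prefixes of the words in a list, including the empty word. -/
def wordPrefixes {α : Type*} (U : List (List α)) : List (List α) :=
  [] :: U.flatMap List.inits

theorem mem_wordPrefixes {α : Type*} {U : List (List α)} {p : List α} :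
    p ∈ wordPrefixes U ↔ p = [] ∨ ∃ u ∈ U, p <+: u := by
  simp [wordPrefixes]

theorem mk_mem_wordSubgroup {U : List (List (Fin n × Bool))} {u : List (Fin n × Bool)}
    (hu : u ∈ U) : FreeGroup.mk u ∈ wordSubgroup U :=
  Subgroup.subset_closure ⟨u, hu, rfl⟩

/-- Each vertex of the core is reached along a prefix of a generator. -/
theorem CoreVert.exists_prefix {U : List (List (Fin n × Bool))} {g : FreeGroup (Fin n)}
    (hg : CoreVert (wordSubgroup U) g) : ∃ p ∈ wordPrefixes U,
      rcoset (wordSubgroup U) g = rcoset (wordSubgroup U) (FreeGroup.mk p) := by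
  set H := wordSubgroup U with hH
  -- C marks the vertices on the loops that the generators spell at the base coset, and Q the edges
  -- between marked vertices. Every element of H is a loop in Q, so the core lies in Q.
  let C : FreeGroup (Fin n) → Prop := fun y =>
    ∃ p ∈ wordPrefixes U, rcoset H y = rcoset H (FreeGroup.mk p)
  let Q : FreeGroup (Fin n) → Fin n × Bool → Prop := fun y b => C y ∧ C (y * letterVal b)
  have hC : ∀ h ∈ H, ∀ y, C y → C (h * y) := by
    rintro h hh y ⟨p, hp, h1⟩
    exact ⟨p, hp, by rw [rcoset_mul_left hh, h1]⟩
  have hQ : ∀ h ∈ H, ∀ y b, Q y b → Q (h * y) b := by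
    rintro h hh y b ⟨h1, h2⟩
    exact ⟨hC h hh _ h1, by rw [mul_assoc]; exact hC h hh _ h2⟩
  have hsymm : ∀ y b, Q y b → Q (y * letterVal b) (letterInv b) := by
    rintro y b ⟨h1, h2⟩
    refine ⟨h2, ?_⟩
    rw [letterVal_letterInv, mul_inv_cancel_right]
    exact h1
  have hgen : ∀ u ∈ U, ∀ v p, p ++ v = u → PathIn Q (FreeGroup.mk p) v := by
    intro u hu v
    induction v with
    | nil => intro p _; trivial
    | cons b v ih =>
      intro p hp
      have hb : FreeGroup.mk p * letterVal b = FreeGroup.mk (p ++ [b]) := by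
        rw [← FreeGroup.mul_mk]; rfl
      refine ⟨⟨⟨p, mem_wordPrefixes.2 (Or.inr ⟨u, hu, _, hp⟩), rfl⟩,
        p ++ [b], mem_wordPrefixes.2 (Or.inr ⟨u, hu, v, by simpa using hp⟩), by rw [hb]⟩, ?_⟩
      rw [hb]
      exact ih _ (by simpa using hp)
  have hpath : ∀ h ∈ H, ∃ w, PathIn Q 1 w ∧ FreeGroup.mk w = h := by
    intro h hh
    rw [hH, wordSubgroup] at hh
    induction hh using Subgroup.closure_induction with
    | mem h hmem =>
      obtain ⟨u, hu, rfl⟩ := hmem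
      exact ⟨u, by simpa [← FreeGroup.one_eq_mk] using hgen u hu u [] rfl, rfl⟩
    | one => exact ⟨[], trivial, FreeGroup.one_eq_mk.symm⟩
    | mul x y hx hy ihx ihy =>
      obtain ⟨u, hu, rfl⟩ := ihx
      obtain ⟨v, hv, rfl⟩ := ihy
      refine ⟨u ++ v, pathIn_append.2 ⟨hu, ?_⟩, FreeGroup.mul_mk.symm⟩
      have := hv.mul_left hQ hx
      rwa [mul_one, ← one_mul (FreeGroup.mk u)] at this
    | inv x hx ihx =>
      obtain ⟨u, hu, rfl⟩ := ihx
      refine ⟨FreeGroup.invRev u, ?_, FreeGroup.inv_mk.symm⟩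
      have := (hu.reverse hsymm).mul_left hQ (H.inv_mem hx)
      rwa [one_mul, inv_mul_cancel] at this
  obtain ⟨a, ha⟩ := hg
  have := ha.mem_of_pathIn (Q := Q) hQ (x₀ := 1) (fun h hh => by
    obtain ⟨w, hw, rfl⟩ := hpath h hh
    exact ⟨w, hw, by simp⟩)
  exact this.1

theorem coreV_subset_prefixes (U : List (List (Fin n × Bool))) :
    (coverGraph (wordSubgroup U)).coreV ⊆
      (fun p => rcoset (wordSubgroup U) (FreeGroup.mk p)) '' {p | p ∈ wordPrefixes U} := by
  intro q hq
  obtain ⟨g, rfl⟩ := exists_rcoset q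
  obtain ⟨p, hp, h⟩ := (mem_coreV_iff.1 hq).exists_prefix
  exact ⟨p, hp, h.symm⟩

theorem encard_coreV_le (U : List (List (Fin n × Bool))) :
    (coverGraph (wordSubgroup U)).coreV.encard ≤ (wordPrefixes U).length := by
  classical
  refine (Set.encard_le_encard (coreV_subset_prefixes U)).trans ?_
  refine (Set.encard_image_le _ _).trans ?_
  have : {p | p ∈ wordPrefixes U} = ((wordPrefixes U).toFinset : Set _) := by ext; simp
  rw [this, Set.encard_coe_eq_coe_finsetCard]
  exact_mod_cast List.toFinset_card_le _

theorem exists_wordSubgroup_of_fg {H : Subgroup (FreeGroup (Fin n))} (hH : H.FG) :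
    ∃ U, H = wordSubgroup U := by
  obtain ⟨S, rfl⟩ := hH
  refine ⟨S.toList.map FreeGroup.toWord, congrArg _ ?_⟩
  ext g
  simp [FreeGroup.mk_toWord]

theorem finite_coreV {H : Subgroup (FreeGroup (Fin n))} (hH : H.FG) :
    (coverGraph H).coreV.Finite := by
  obtain ⟨U, rfl⟩ := exists_wordSubgroup_of_fg hH
  exact ((List.finite_toSet _).image _).subset (coreV_subset_prefixes U)

theorem finite_coreE {H : Subgroup (FreeGroup (Fin n))} (hH : H.FG) :
    (coverGraph H).coreE.Finite := by
  refine ((finite_coreV hH).prod (Set.finite_univ (α := Fin n))).subset ?_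
  rintro ⟨q, i⟩ hq
  obtain ⟨g, rfl⟩ := exists_rcoset q
  exact ⟨mem_coreV_iff.2 ⟨_, mem_coreE_iff.1 hq⟩, trivial⟩

/-- Killing the remaining basis elements retracts F_n onto a free factor, which is thus a quotient
of a finitely generated group. -/
theorem IsFreeFactor.fg {H : Subgroup (FreeGroup (Fin n))} (hH : IsFreeFactor H) : H.FG := by
  classical
  obtain ⟨ι, κ, b, c, e, he⟩ := hH
  rw [← Group.fg_iff_subgroup_fg]
  have hinj : Function.Injective e := by
    intro i j hij
    apply b.injective
    apply Subtype.ext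
    rw [← he, ← he, hij]
  let f : κ → H := fun k => if h : ∃ i, e i = k then b h.choose else 1
  have hf : ∀ i, f (e i) = b i := by
    intro i
    have h : ∃ j, e j = e i := ⟨i, rfl⟩
    change (if h : ∃ j, e j = e i then b h.choose else 1) = _
    rw [dif_pos h, hinj h.choose_spec]
  let ρ : FreeGroup (Fin n) →* H := c.lift f
  have hρ : ρ.comp H.subtype = MonoidHom.id H := by
    apply b.ext_hom
    intro i
    simp only [MonoidHom.comp_apply, Subgroup.coe_subtype, MonoidHom.id_apply]
    rw [← he, ← hf]
    simp [ρ]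
  refine Group.fg_of_surjective (f := ρ) fun x => ⟨x, DFunLike.congr_fun hρ x⟩

end CoreFinite

/-! ### The reduction theorem -/

section Reduction

variable {n : ℕ}

/-- The cut given by the cut vertex lemma for the family {H, K} is used as the Whitehead
automorphism. Neither core grows, and a core in which `a` is adjacent to A loses a vertex and an
edge. -/
theorem exists_whitehead_reduction (H K : Subgroup (FreeGroup (Fin n)))
    (hH : IsFreeFactor H) (hK : IsFreeFactor K)
    (hlab : ∀ i : Fin n, ∃ e, ((coreGraph H).disjUnion (coreGraph K)).label e = i)
    (hJ : ∃ H' K' J : Subgroup (FreeGroup (Fin n)), SubgroupConj H H' ∧ SubgroupConj K K' ∧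
      IsFreeFactor J ∧ J ≠ ⊤ ∧ H' ≤ J ∧ K' ≤ J) :
    ∃ φ : FreeGroup (Fin n) ≃* FreeGroup (Fin n), IsWhiteheadAut φ ∧
      ENat.card ((coreGraph (H.map φ.toMonoidHom)).disjUnion (coreGraph (K.map φ.toMonoidHom))).V
        < ENat.card ((coreGraph H).disjUnion (coreGraph K)).V ∧
      ENat.card ((coreGraph (H.map φ.toMonoidHom)).disjUnion (coreGraph (K.map φ.toMonoidHom))).E
        < ENat.card ((coreGraph H).disjUnion (coreGraph K)).E := by
  obtain ⟨_, _, J, ⟨u, rfl⟩, ⟨v, rfl⟩, hJ, hJtop, hHJ, hKJ⟩ := hJ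
  set 𝓗 : Set (Subgroup (FreeGroup (Fin n))) := {H, K} with h𝓗
  have hdart : ∀ i, ∃ L ∈ 𝓗, ∃ g, CoreDart L g (i, true) := by
    intro i
    obtain ⟨e | e, he⟩ := hlab i
    · obtain ⟨⟨q, j⟩, hq⟩ := e
      obtain ⟨g, rfl⟩ := exists_rcoset q
      obtain rfl : j = i := he
      exact ⟨H, by simp [h𝓗], g, mem_coreE_iff.1 hq⟩
    · obtain ⟨⟨q, j⟩, hq⟩ := e
      obtain ⟨g, rfl⟩ := exists_rcoset q
      obtain rfl : j = i := he
      exact ⟨K, by simp [h𝓗], g, mem_coreE_iff.1 hq⟩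
  have hdeg : ∀ a, ∃ b, LinkAdj 𝓗 a b := by
    rintro ⟨i, s⟩
    obtain ⟨L, hL, g, hg⟩ := hdart i
    cases s with
    | true =>
      obtain ⟨b, hb, hgb⟩ := hg.exists_ne
      exact ⟨b, hb.symm, L, hL, g, hg, hgb⟩
    | false =>
      obtain ⟨b, hb, hgb⟩ := hg.symm.exists_ne
      exact ⟨b, hb.symm, L, hL, _, hg.symm, hgb⟩
  have hconj : ∀ L ∈ 𝓗, ∃ w : FreeGroup (Fin n), ∀ h ∈ L, w * h * w⁻¹ ∈ J := by
    rintro L (rfl | rfl)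
    · exact ⟨u, fun h hh => hHJ ⟨h, hh, by simp⟩⟩
    · exact ⟨v, fun h hh => hKJ ⟨h, hh, by simp⟩⟩
  obtain ⟨a, A, hcut⟩ := exists_isCut hdeg hJ hJtop hconj
  have haA := hcut.inv_notMem
  have hcl : ∀ L ∈ 𝓗, ∀ g b c, CoreDart L g b → CoreDart L g c → b ∈ A → c ∈ A ∨ c = a := by
    intro L hL g b c hb hc hbA
    by_cases hbc : b = c
    · exact Or.inl (hbc ▸ hbA)
    · exact hcut.closed b hbA c ⟨hbc, L, hL, g, hb, hc⟩
  obtain ⟨b, hbA, _, L, hL, g, hga, hgb⟩ := hcut.exists_adj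
  refine ⟨whiteheadEquiv a A, isWhiteheadAut_whiteheadEquiv hcut.notMem haA, ?_⟩
  have hmap : ∀ L : Subgroup (FreeGroup (Fin n)),
      L.map (whiteheadEquiv a A).toMonoidHom = L.map (whiteheadHom a A) := fun _ => rfl
  rw [hmap, hmap]
  have hV : ∀ L M : Subgroup (FreeGroup (Fin n)),
      ENat.card ((coreGraph L).disjUnion (coreGraph M)).V =
        (coverGraph L).coreV.encard + (coverGraph M).coreV.encard := fun L M => ENat.card_sum _ _
  have hE : ∀ L M : Subgroup (FreeGroup (Fin n)),
      ENat.card ((coreGraph L).disjUnion (coreGraph M)).E =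
        (coverGraph L).coreE.encard + (coverGraph M).coreE.encard := fun L M => ENat.card_sum _ _
  rw [hV, hV, hE, hE]
  have hle : ∀ L ∈ 𝓗, (coverGraph (L.map (whiteheadHom a A))).coreV.encard ≤
      (coverGraph L).coreV.encard ∧ (coverGraph (L.map (whiteheadHom a A))).coreE.encard ≤
      (coverGraph L).coreE.encard := fun L hL =>
    ⟨Set.encard_le_of_subset_image_diff (coreV_map_subset haA (hcl L hL)),
      Set.encard_le_of_subset_image_diff (coreE_map_subset haA (hcl L hL))⟩
  have hfg : ∀ L ∈ 𝓗, L.FG := by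
    rintro L (rfl | rfl)
    · exact hH.fg
    · exact hK.fg
  have hlt : (coverGraph (L.map (whiteheadHom a A))).coreV.encard <
      (coverGraph L).coreV.encard ∧ (coverGraph (L.map (whiteheadHom a A))).coreE.encard <
      (coverGraph L).coreE.encard := by
    have hA : TypeA L A g := ⟨b, hbA, hgb⟩
    have hVs := coreV_map_subset haA (hcl L hL)
    have hEs := coreE_map_subset haA (hcl L hL)
    constructor
    · refine Set.encard_lt_of_subset_image_diff (finite_coreV (hfg L hL)) ?_ hVs
      exact ⟨rcoset L g, mem_coreV_iff.2 ⟨a, hga⟩, g, rfl, hga, hA⟩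
    -- Edges are stored with their orientation: for a = x_i⁻¹ the collapsed edge originates at the
    -- coset of g a.
    · rcases hs : a with ⟨i, s⟩
      subst hs
      cases s with
      | true =>
        refine Set.encard_lt_of_subset_image_diff (finite_coreE (hfg L hL)) ?_ hEs
        exact ⟨(rcoset L g, i), mem_coreE_iff.2 hga, g, rfl, Or.inl ⟨rfl, hA⟩⟩
      | false =>
        refine Set.encard_lt_of_subset_image_diff (finite_coreE (hfg L hL)) ?_ hEs
        refine ⟨(rcoset L (g * letterVal (i, false)), i), mem_coreE_iff.2 hga.symm,
          g * letterVal (i, false), rfl, Or.inr ⟨rfl, ?_⟩⟩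
        rw [letterVal_true, letterVal_false, inv_mul_cancel_right]
        exact hA
  have hHm : H ∈ 𝓗 := by simp [h𝓗]
  have hKm : K ∈ 𝓗 := by simp [h𝓗]
  -- A strict inequality in one summand survives addition of extended naturals only if the other
  -- summand is finite.
  have hfinV : ∀ L ∈ 𝓗, (coverGraph L).coreV.encard ≠ ⊤ := fun L hL =>
    Set.encard_ne_top_iff.2 (finite_coreV (hfg L hL))
  have hfinE : ∀ L ∈ 𝓗, (coverGraph L).coreE.encard ≠ ⊤ := fun L hL =>
    Set.encard_ne_top_iff.2 (finite_coreE (hfg L hL))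
  rcases hL with rfl | rfl
  · exact ⟨ENat.add_lt_add_of_lt_of_le
        (ne_top_of_le_ne_top (hfinV K hKm) (hle K hKm).1) hlt.1 (hle K hKm).1,
      ENat.add_lt_add_of_lt_of_le
        (ne_top_of_le_ne_top (hfinE K hKm) (hle K hKm).2) hlt.2 (hle K hKm).2⟩
  · exact ⟨ENat.add_lt_add_of_le_of_lt
        (ne_top_of_le_ne_top (hfinV H hHm) (hle H hHm).1) (hle H hHm).1 hlt.1,
      ENat.add_lt_add_of_le_of_lt
        (ne_top_of_le_ne_top (hfinE H hHm) (hle H hHm).2) (hle H hHm).2 hlt.2⟩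

end Reduction

/-! ### Splitting off the intersection with a free factor -/

section FreeProduct

/-- A function defined by recursion along a map that decreases a rank outside of a set. -/
theorem exists_recursive_function {V X : Type*} (l : V → ℕ) (O : Set V) (base : V → X)
    (next : V → V) (step : V → X → X) (hnext : ∀ v, v ∉ O → l (next v) < l v) :
    ∃ t : V → X, (∀ v ∈ O, t v = base v) ∧ ∀ v, v ∉ O → t v = step v (t (next v)) := by
  classical
  let F : ∀ v, (∀ u, l u < l v → X) → X := fun v rec =>
    if h : v ∈ O then base v else step v (rec (next v) (hnext v h))
  refine ⟨(measure l).wf.fix F, fun v hv => ?_, fun v hv => ?_⟩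
  · rw [WellFounded.fix_eq]; exact dif_pos hv
  · rw [WellFounded.fix_eq]; exact dif_neg hv

variable {G κ : Type} [Group G]

/-- A Schreier transversal for `G ⧸ H` that is adapted to the subgroup `J` generated by a part of a
basis. -/
theorem exists_adapted_transversal (c : FreeGroupBasis κ G) (H J : Subgroup G) :
    ∃ (t : G ⧸ H → G) (l : G ⧸ H → ℕ) (O : Set (G ⧸ H)), t ((1 : G) : G ⧸ H) = 1 ∧
      (∀ v, ((t v : G) : G ⧸ H) = v) ∧ ((1 : G) : G ⧸ H) ∈ O ∧
      (∀ j ∈ J, ∀ v ∈ O, j • v ∈ O) ∧ (∀ v ∈ O, t v ∈ J) ∧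
      ∀ v, v ∉ O → ∃ u k, l u < l v ∧
        ((v = c k • u ∧ t v = c k * t u) ∨ (c k • v = u ∧ t v = (c k)⁻¹ * t u)) := by
  classical
  let ev : List (κ × Bool) → G := fun w => c.repr.symm (FreeGroup.mk w)
  have hev : ∀ y w, ev (y :: w) = (if y.2 then c y.1 else (c y.1)⁻¹) * ev w := by
    rintro ⟨k, s⟩ w
    have h1 : FreeGroup.mk ((k, s) :: w) = FreeGroup.mk [(k, s)] * FreeGroup.mk w := by simp
    simp only [ev]
    rw [h1, map_mul]
    congr 1
    cases s
    · have h2 : FreeGroup.mk [(k, false)] = (FreeGroup.of k)⁻¹ := by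
        simp [FreeGroup.of, FreeGroup.inv_mk, FreeGroup.invRev]
      rw [h2, map_inv]; rfl
    · rfl
  -- O is the J-orbit of the base coset, and the rank `l` is the distance to O in the Schreier
  -- graph. The transversal stays in J over O and outside O grows along edges leading towards it.
  let O : Set (G ⧸ H) := {v | ∃ j ∈ J, ((j : G) : G ⧸ H) = v}
  let R : G ⧸ H → ℕ → Prop := fun v m =>
    ∃ w : List (κ × Bool), w.length = m ∧ ∃ j ∈ J, ((ev w * j : G) : G ⧸ H) = v
  have hR : ∀ v, ∃ m, R v m := by
    intro v
    obtain ⟨g, rfl⟩ := QuotientGroup.mk_surjective v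
    refine ⟨_, (c.repr g).toWord, rfl, 1, J.one_mem, ?_⟩
    simp [ev, FreeGroup.mk_toWord]
  let l : G ⧸ H → ℕ := fun v => Nat.find (hR v)
  have hstep : ∀ v, v ∉ O → ∃ y : G, l (y⁻¹ • v) < l v ∧ ∃ k, y = c k ∨ y = (c k)⁻¹ := by
    intro v hv
    obtain ⟨w, hw, j, hj, hwj⟩ := Nat.find_spec (hR v)
    cases w with
    | nil =>
      refine absurd ⟨j, hj, ?_⟩ hv
      rw [← hwj]
      simp [ev, ← FreeGroup.one_eq_mk]
    | cons y w =>
      refine ⟨if y.2 then c y.1 else (c y.1)⁻¹, ?_, y.1, ?_⟩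
      · change Nat.find (hR _) < Nat.find (hR v)
        rw [← hw]
        refine lt_of_le_of_lt (Nat.find_min' _ ⟨w, rfl, j, hj, ?_⟩) (Nat.lt_succ_self _)
        rw [← hwj, MulAction.Quotient.smul_coe, hev, smul_eq_mul, mul_assoc, inv_mul_cancel_left]
      · split_ifs
        · exact Or.inl rfl
        · exact Or.inr rfl
  choose! y hlt hy using hstep
  have hbase : ∀ v ∈ O, ∃ j ∈ J, ((j : G) : G ⧸ H) = v := fun v hv => hv
  choose! base hbJ hbv using hbase
  obtain ⟨t, ht1, ht2⟩ := exists_recursive_function l O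
    (fun v => if v = ((1 : G) : G ⧸ H) then 1 else base v) (fun v => (y v)⁻¹ • v)
    (fun v x => y v * x) hlt
  have h1O : ((1 : G) : G ⧸ H) ∈ O := ⟨1, J.one_mem, rfl⟩
  have htv : ∀ m v, l v = m → ((t v : G) : G ⧸ H) = v := by
    intro m
    induction m using Nat.strong_induction_on with
    | _ m ih =>
      rintro v rfl
      by_cases hv : v ∈ O
      · rw [ht1 v hv]
        split_ifs with h
        · exact h.symm
        · exact hbv v hv
      · rw [ht2 v hv, ← smul_eq_mul, ← MulAction.Quotient.smul_coe, ih _ (hlt v hv) _ rfl,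
          smul_inv_smul]
  refine ⟨t, l, O, ?_, fun v => htv _ v rfl, h1O, ?_, ?_, ?_⟩
  · rw [ht1 _ h1O, if_pos rfl]
  · rintro j hj _ ⟨j', hj', rfl⟩
    exact ⟨j * j', J.mul_mem hj hj', rfl⟩
  · intro v hv
    rw [ht1 v hv]
    split_ifs
    · exact J.one_mem
    · exact hbJ v hv
  · intro v hv
    obtain ⟨k, hk⟩ := hy v hv
    refine ⟨(y v)⁻¹ • v, k, hlt v hv, ?_⟩
    have h1 := ht2 v hv
    rcases hk with hk | hk
    · rw [hk] at h1 ⊢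
      exact Or.inl ⟨by simp, h1⟩
    · rw [hk] at h1 ⊢
      exact Or.inr ⟨by simp, h1⟩

/-- The left action of a free group on `V × A` given by an assignment of elements of `A` to the
edges of a Schreier graph. -/
theorem exists_cocycle (c : FreeGroupBasis κ G) {V A : Type*} [MulAction G V] [Group A]
    (f : κ → V → A) : ∃ C : G → V → A,
      (∀ k v, C (c k) v = f k v) ∧ ∀ g h v, C (g * h) v = C g (h • v) * C h v := by
  -- The cocycle is built as a skew product: each basis element moves the point of V and multiplies
  -- the A-coordinate on the left by the label of the edge.
  let σ : κ → Equiv.Perm (V × A) := fun k =>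
    { toFun := fun x => (c k • x.1, f k x.1 * x.2)
      invFun := fun x => ((c k)⁻¹ • x.1, (f k ((c k)⁻¹ • x.1))⁻¹ * x.2)
      left_inv := fun x => by simp
      right_inv := fun x => by simp }
  let ρ : G →* Equiv.Perm (V × A) := c.lift σ
  have hρ : ∀ k, ρ (c k) = σ k := fun k => by simp [ρ]
  have key : ∀ g v x, (ρ g (v, x)).1 = g • v ∧ (ρ g (v, x)).2 = (ρ g (v, 1)).2 * x := by
    intro g
    have hg : g ∈ Subgroup.closure (Set.range c) := by rw [c.closure_range]; trivial
    induction hg using Subgroup.closure_induction with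
    | mem g hmem =>
      obtain ⟨k, rfl⟩ := hmem
      intro v x
      rw [hρ]
      exact ⟨rfl, by simp [σ]⟩
    | one => simp
    | mul a b _ _ iha ihb =>
      intro v x
      rw [map_mul, Equiv.Perm.mul_apply, Equiv.Perm.mul_apply]
      have e1 := ihb v x
      have e2 := ihb v 1
      have hb : ρ b (v, x) = (b • v, (ρ b (v, 1)).2 * x) := Prod.ext e1.1 e1.2
      have hb1 : ρ b (v, 1) = (b • v, (ρ b (v, 1)).2) := Prod.ext e2.1 rfl
      rw [hb, (iha _ _).1, (iha _ _).2]
      refine ⟨by rw [mul_smul], ?_⟩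
      rw [hb1, (iha _ (ρ b (v, 1)).2).2, mul_assoc]
    | inv a _ iha =>
      intro v x
      have hinv : ∀ z, ρ a (ρ a⁻¹ z) = z := by
        intro z
        rw [← Equiv.Perm.mul_apply, ← map_mul, mul_inv_cancel, map_one, Equiv.Perm.one_apply]
      have h1 : ∀ x, (ρ a⁻¹ (v, x)).1 = a⁻¹ • v := by
        intro x
        rw [eq_inv_smul_iff, ← (iha (ρ a⁻¹ (v, x)).1 (ρ a⁻¹ (v, x)).2).1, Prod.mk.eta, hinv]
      refine ⟨h1 x, ?_⟩
      have h2 : ∀ x, (ρ a (a⁻¹ • v, 1)).2 * (ρ a⁻¹ (v, x)).2 = x := by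
        intro x
        have := (iha (ρ a⁻¹ (v, x)).1 (ρ a⁻¹ (v, x)).2).2
        rw [Prod.mk.eta, hinv, h1] at this
        exact this.symm
      have h3 := h2 1
      rw [mul_eq_one_iff_inv_eq] at h3
      rw [← h3, inv_mul_eq_iff_eq_mul.2 (h2 x).symm]
  refine ⟨fun g v => (ρ g (v, 1)).2, fun k v => ?_, fun g h v => ?_⟩
  · change (ρ (c k) (v, 1)).2 = _
    rw [hρ]; simp [σ]
  · change (ρ (g * h) (v, 1)).2 = (ρ g (h • v, 1)).2 * (ρ h (v, 1)).2
    rw [map_mul, Equiv.Perm.mul_apply]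
    have hb : ρ h (v, 1) = (h • v, (ρ h (v, 1)).2) := Prod.ext (key h v 1).1 rfl
    rw [hb, (key g _ _).2]

/-- A subgroup `H` of a free group is the free product of its intersection with a free factor and
some other subgroup. -/
theorem exists_free_complement (c : FreeGroupBasis κ G) (Y : Set κ) (H : Subgroup G) :
    ∃ M : Subgroup G, M ≤ H ∧ H ≤ (H ⊓ Subgroup.closure (c '' Y)) ⊔ M ∧
      ∀ {A : Type} [Group A] (α : (H ⊓ Subgroup.closure (c '' Y) : Subgroup G) →* A) (β : M →* A),
        ∃ Ψ : H →* A, (∀ (x : H) (hx : (x : G) ∈ H ⊓ Subgroup.closure (c '' Y)),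
          Ψ x = α ⟨x, hx⟩) ∧ ∀ (x : H) (hx : (x : G) ∈ M), Ψ x = β ⟨x, hx⟩ := by
  classical
  set J := Subgroup.closure (c '' Y) with hJ
  obtain ⟨t, l, O, ht1, htv, h1O, hJO, htJ, hnext⟩ := exists_adapted_transversal c H J
  set v₀ : G ⧸ H := ((1 : G) : G ⧸ H) with hv₀
  have htv' : ∀ v, t v • v₀ = v := by
    intro v
    conv_rhs => rw [← htv v]
    rw [hv₀, MulAction.Quotient.smul_coe, smul_eq_mul, mul_one]
  have hstab : ∀ h : G, h ∈ H ↔ h • v₀ = v₀ := by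
    intro h
    rw [hv₀, MulAction.Quotient.smul_coe, smul_eq_mul, mul_one, eq_comm, QuotientGroup.eq]
    simp
  have hs : ∀ g v, (t (g • v))⁻¹ * g * t v ∈ H := by
    intro g v
    rw [hstab, mul_smul, mul_smul, htv', inv_smul_eq_iff, htv']
  have hckJ : ∀ k ∈ Y, c k ∈ J := fun k hk => Subgroup.subset_closure ⟨k, hk, rfl⟩
  -- M is generated by the Schreier generators of all edges except those labelled by Y within O; the
  -- excepted ones lie in H ∩ J.
  let S : Set G := {x | ∃ k v, ¬ (k ∈ Y ∧ v ∈ O) ∧ (t (c k • v))⁻¹ * c k * t v = x}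
  let M := Subgroup.closure S
  have hMH : M ≤ H := by
    refine (Subgroup.closure_le H).2 ?_
    rintro _ ⟨k, v, _, rfl⟩
    exact hs _ _
  have hsJ : ∀ k v, k ∈ Y → v ∈ O → (t (c k • v))⁻¹ * c k * t v ∈ H ⊓ J := fun k v hk hv =>
    ⟨hs _ _, J.mul_mem (J.mul_mem (J.inv_mem (htJ _ (hJO _ (hckJ k hk) v hv))) (hckJ k hk))
      (htJ v hv)⟩
  refine ⟨M, hMH, ?_, ?_⟩
  · have key : ∀ g v, (t (g • v))⁻¹ * g * t v ∈ (H ⊓ J) ⊔ M := by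
      intro g
      have hg : g ∈ Subgroup.closure (Set.range c) := by rw [c.closure_range]; trivial
      induction hg using Subgroup.closure_induction with
      | mem g hmem =>
        obtain ⟨k, rfl⟩ := hmem
        intro v
        by_cases hkv : k ∈ Y ∧ v ∈ O
        · exact Subgroup.mem_sup_left (hsJ k v hkv.1 hkv.2)
        · exact Subgroup.mem_sup_right (Subgroup.subset_closure ⟨k, v, hkv, rfl⟩)
      | one => intro v; rw [one_smul, mul_one, inv_mul_cancel]; exact Subgroup.one_mem _
      | mul a b _ _ iha ihb =>
        intro v
        convert Subgroup.mul_mem _ (iha (b • v)) (ihb v) using 1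
        rw [mul_smul]; group
      | inv a _ iha =>
        intro v
        convert Subgroup.inv_mem _ (iha (a⁻¹ • v)) using 1
        rw [smul_inv_smul]; group
    intro h hh
    have := key h v₀
    rwa [(hstab h).1 hh, ht1, inv_one, one_mul, mul_one] at this
  · intro A _ α β
    -- The default value 1 plays no role: the Schreier generators to which these extensions are
    -- applied always lie in the right subgroup.
    let α' : G → A := fun g => if h : g ∈ H ⊓ J then α ⟨g, h⟩ else 1
    let β' : G → A := fun g => if h : g ∈ M then β ⟨g, h⟩ else 1
    have hα : ∀ g (h : g ∈ H ⊓ J), α' g = α ⟨g, h⟩ := fun g h => dif_pos h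
    have hβ : ∀ g (h : g ∈ M), β' g = β ⟨g, h⟩ := fun g h => dif_pos h
    have hα1 : α' 1 = 1 := by rw [hα 1 (Subgroup.one_mem _)]; exact map_one α
    have hβ1 : β' 1 = 1 := by rw [hβ 1 (Subgroup.one_mem _)]; exact map_one β
    have hαmul : ∀ x y, x ∈ H ⊓ J → y ∈ H ⊓ J → α' (x * y) = α' x * α' y := by
      intro x y hx hy
      rw [hα x hx, hα y hy, hα _ (Subgroup.mul_mem _ hx hy), ← map_mul]; rfl
    -- Edges are labelled by α or β of their Schreier generators. The resulting cocycle, restricted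
    -- to the stabiliser H of the base coset, is the common extension.
    obtain ⟨C, hCk, hCmul⟩ := exists_cocycle c (V := G ⧸ H)
      (fun k v => if k ∈ Y ∧ v ∈ O then α' ((t (c k • v))⁻¹ * c k * t v)
        else β' ((t (c k • v))⁻¹ * c k * t v))
    have hC1 : ∀ v, C 1 v = 1 := by
      intro v
      have := hCmul 1 1 v
      rwa [one_smul, mul_one, left_eq_mul] at this
    have hCinv : ∀ g v, C g⁻¹ (g • v) = (C g v)⁻¹ := by
      intro g v
      rw [eq_inv_iff_mul_eq_one, ← hCmul, inv_mul_cancel, hC1]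
    have hCJ : ∀ j ∈ J, ∀ v ∈ O, C j v = α' ((t (j • v))⁻¹ * j * t v) := by
      intro j hj
      have hmemJ : ∀ j ∈ J, ∀ v ∈ O, (t (j • v))⁻¹ * j * t v ∈ H ⊓ J := fun j hj v hv =>
        ⟨hs _ _, J.mul_mem (J.mul_mem (J.inv_mem (htJ _ (hJO j hj v hv))) hj) (htJ v hv)⟩
      rw [hJ] at hj
      induction hj using Subgroup.closure_induction with
      | mem g hmem =>
        obtain ⟨k, hk, rfl⟩ := hmem
        intro v hv
        rw [hCk, if_pos ⟨hk, hv⟩]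
      | one => intro v hv; rw [hC1, one_smul, mul_one, inv_mul_cancel, hα1]
      | mul a b ha hb iha ihb =>
        intro v hv
        rw [hCmul, iha _ (hJO b hb v hv), ihb v hv,
          ← hαmul _ _ (hmemJ a ha _ (hJO b hb v hv)) (hmemJ b hb v hv), mul_smul]
        congr 1
        group
      | inv a ha iha =>
        intro v hv
        have hav := hJO _ (J.inv_mem ha) v hv
        have h1 := hCinv a (a⁻¹ • v)
        rw [smul_inv_smul] at h1
        rw [h1, iha _ hav, inv_eq_iff_mul_eq_one, ← hαmul _ _ (hmemJ a ha _ hav)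
          (hmemJ _ (J.inv_mem ha) v hv), smul_inv_smul]
        convert hα1 using 2
        group
    -- The cocycle is trivial along the transversal: over O by multiplicativity of α on J, and
    -- outside O because the connecting edges have trivial Schreier generator and fall under β.
    have hCt : ∀ m v, l v = m → C (t v) v₀ = 1 := by
      intro m
      induction m using Nat.strong_induction_on with
      | _ m ih =>
        rintro v rfl
        by_cases hv : v ∈ O
        · rw [hCJ _ (htJ v hv) _ h1O, htv', ht1, mul_one, inv_mul_cancel, hα1]
        · obtain ⟨u, k, hlt, ⟨h1, h2⟩ | ⟨h1, h2⟩⟩ := hnext v hv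
          · rw [h2, hCmul, ih _ hlt _ rfl, mul_one, htv', hCk, if_neg]
            · rw [← h1, h2]
              convert hβ1 using 2
              group
            · rintro ⟨hk, hu⟩
              exact hv (h1 ▸ hJO _ (hckJ k hk) u hu)
          · have h3 := hCinv (c k) v
            rw [h1] at h3
            rw [h2, hCmul, ih _ hlt _ rfl, mul_one, htv', h3, inv_eq_one, hCk,
              if_neg (fun h => hv h.2), h1, h2]
            convert hβ1 using 2
            group
    let Ψ : H →* A := MonoidHom.mk' (fun h => C h v₀) fun x y => by
      rw [Subgroup.coe_mul, hCmul, (hstab y).1 y.2]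
    refine ⟨Ψ, ?_, ?_⟩
    · intro x hx
      change C x v₀ = _
      rw [hCJ _ hx.2 _ h1O, (hstab x).1 x.2, ht1, inv_one, one_mul, mul_one, hα _ hx]
    · have key : ∀ x (hx : x ∈ M), C x v₀ = β ⟨x, hx⟩ := by
        intro x hx
        induction hx using Subgroup.closure_induction with
        | mem x hmem =>
          have hmem' := hmem
          obtain ⟨k, v, hkv, rfl⟩ := hmem'
          have h1 : ((t (c k • v))⁻¹ * c k) • v = v₀ := by
            rw [mul_smul, inv_smul_eq_iff, htv']
          have h2 := hCinv (t (c k • v)) v₀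
          rw [htv', hCt _ _ rfl, inv_one] at h2
          rw [hCmul, hCt _ _ rfl, htv', mul_one, hCmul, h2, one_mul, hCk, if_neg hkv,
            hβ _ (Subgroup.subset_closure hmem)]
        | one => rw [hC1]; exact (map_one β).symm
        | mul x y hx hy ihx ihy =>
          rw [hCmul, (hstab y).1 (hMH hy), ihx, ihy, ← map_mul]; rfl
        | inv x hx ihx =>
          have h1 := hCinv x v₀
          rw [(hstab x).1 (hMH hx)] at h1
          rw [h1, ihx, ← map_inv]; rfl
      exact fun x hx => key x hx

end FreeProduct

/-! ### Free factors and their intersections -/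

section FreeFactors

/-- A generating family with the lifting property of a basis is a basis. -/
theorem FreeGroupBasis.exists_of_lift {X G : Type} [Group G] (of : X → G)
    (hgen : Subgroup.closure (Set.range of) = ⊤)
    (hlift : ∀ {A : Type} [Group A] (f : X → A), ∃ F : G →* A, ∀ x, F (of x) = f x) :
    ∃ b : FreeGroupBasis X G, ∀ x, b x = of x := by
  refine ⟨FreeGroupBasis.ofUniqueLift X of fun {A} _ f => ?_, fun x => ?_⟩
  · obtain ⟨F, hF⟩ := hlift f
    refine ⟨F, hF, fun F' hF' => MonoidHom.eq_of_eqOn_dense hgen ?_⟩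
    rintro _ ⟨x, rfl⟩
    rw [hF, hF']
  · exact FreeGroup.lift_apply_of ..

variable {n : ℕ}

/-- Any part of a basis is a basis of what it generates: a map on that part extends by 1 to the
whole basis, and the resulting homomorphism restricts. -/
theorem isFreeFactor_iff {H : Subgroup (FreeGroup (Fin n))} :
    IsFreeFactor H ↔ ∃ (κ : Type) (c : FreeGroupBasis κ (FreeGroup (Fin n))) (Y : Set κ),
      H = Subgroup.closure (c '' Y) := by
  constructor
  · rintro ⟨ι, κ, b, c, e, hce⟩
    refine ⟨κ, c, Set.range e, ?_⟩
    rw [← Set.range_comp]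
    have h1 : (c ∘ e : ι → FreeGroup (Fin n)) = H.subtype ∘ b := funext hce
    rw [h1, Set.range_comp, ← MonoidHom.map_closure, b.closure_range, ← MonoidHom.range_eq_map,
      Subgroup.range_subtype]
  · rintro ⟨κ, c, Y, rfl⟩
    classical
    let of : Y → Subgroup.closure (c '' Y) := fun k =>
      ⟨c k, Subgroup.subset_closure ⟨k, k.2, rfl⟩⟩
    have hgen : Subgroup.closure (Set.range of) = ⊤ := by
      apply Subgroup.map_injective (Subgroup.closure (c '' Y)).subtype_injective
      rw [MonoidHom.map_closure, ← MonoidHom.range_eq_map, Subgroup.range_subtype,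
        ← Set.range_comp]
      congr 1
      ext x
      simp [of]
    obtain ⟨b, hb⟩ := FreeGroupBasis.exists_of_lift of hgen fun {A} _ f =>
      ⟨(c.lift fun k => if h : k ∈ Y then f ⟨k, h⟩ else 1).comp (Subgroup.subtype _), fun x => by
        simp [of]⟩
    exact ⟨Y, κ, b, c, Subtype.val, fun i => by rw [hb]⟩

theorem IsFreeFactor.map {H : Subgroup (FreeGroup (Fin n))} (hH : IsFreeFactor H)
    (φ : FreeGroup (Fin n) ≃* FreeGroup (Fin n)) : IsFreeFactor (H.map φ.toMonoidHom) := by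
  obtain ⟨κ, c, Y, rfl⟩ := isFreeFactor_iff.1 hH
  refine isFreeFactor_iff.2 ⟨κ, c.map φ, Y, ?_⟩
  rw [MonoidHom.map_closure, Set.image_image]
  rfl

/-- The intersection of two free factors is a free factor. -/
theorem IsFreeFactor.inf {H J : Subgroup (FreeGroup (Fin n))} (hH : IsFreeFactor H)
    (hJ : IsFreeFactor J) : IsFreeFactor (H ⊓ J) := by
  classical
  obtain ⟨κ, c, Y, rfl⟩ := isFreeFactor_iff.1 hH
  obtain ⟨κ', d, Z, rfl⟩ := isFreeFactor_iff.1 hJ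
  set H := Subgroup.closure (c '' Y) with hHdef
  obtain ⟨M, hMH, hle, hlift⟩ := exists_free_complement d Z H
  set P := H ⊓ Subgroup.closure (d '' Z) with hP
  let b₁ := IsFreeGroup.basis P
  let b₂ := IsFreeGroup.basis M
  -- The new basis consists of bases of the intersection and of its complement in H, which are free
  -- by Nielsen–Schreier, together with the basis elements outside H's part.
  let of : (IsFreeGroup.Generators P ⊕ IsFreeGroup.Generators M) ⊕ (Yᶜ : Set κ) →
      FreeGroup (Fin n) :=
    Sum.elim (Sum.elim (fun i => (b₁ i : FreeGroup (Fin n))) fun i => (b₂ i)) fun k => c k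
  have hcY : ∀ k ∈ Y, c k ∈ H := fun k hk => Subgroup.subset_closure ⟨k, hk, rfl⟩
  have hgen : Subgroup.closure (Set.range of) = ⊤ := by
    have hP' : P ≤ Subgroup.closure (Set.range of) := by
      calc P = (⊤ : Subgroup P).map P.subtype := by
              rw [← MonoidHom.range_eq_map, Subgroup.range_subtype]
        _ = Subgroup.closure (P.subtype '' Set.range b₁) := by
              rw [← b₁.closure_range, MonoidHom.map_closure]
        _ ≤ _ := by
              refine Subgroup.closure_mono ?_
              rintro _ ⟨_, ⟨i, rfl⟩, rfl⟩
              exact ⟨Sum.inl (Sum.inl i), rfl⟩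
    have hM' : M ≤ Subgroup.closure (Set.range of) := by
      calc M = (⊤ : Subgroup M).map M.subtype := by
              rw [← MonoidHom.range_eq_map, Subgroup.range_subtype]
        _ = Subgroup.closure (M.subtype '' Set.range b₂) := by
              rw [← b₂.closure_range, MonoidHom.map_closure]
        _ ≤ _ := by
              refine Subgroup.closure_mono ?_
              rintro _ ⟨_, ⟨i, rfl⟩, rfl⟩
              exact ⟨Sum.inl (Sum.inr i), rfl⟩
    rw [eq_top_iff, ← c.closure_range, Subgroup.closure_le]
    rintro _ ⟨k, rfl⟩
    by_cases hk : k ∈ Y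
    · exact (hle.trans (sup_le hP' hM')) (hcY k hk)
    · exact Subgroup.subset_closure ⟨Sum.inr ⟨k, hk⟩, rfl⟩
  have hlift' : ∀ {A : Type} [Group A] (f : _ → A), ∃ F : FreeGroup (Fin n) →* A,
      ∀ x, F (of x) = f x := by
    intro A _ f
    obtain ⟨Ψ, hΨ1, hΨ2⟩ := hlift (b₁.lift fun i => f (Sum.inl (Sum.inl i)))
      (b₂.lift fun i => f (Sum.inl (Sum.inr i)))
    let F := c.lift fun k => if h : k ∈ Y then Ψ ⟨c k, hcY k h⟩ else
      f (Sum.inr ⟨k, h⟩)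
    have hF : ∀ x (hx : x ∈ H), F x = Ψ ⟨x, hx⟩ := by
      intro x hx
      induction hx using Subgroup.closure_induction with
      | mem x hmem =>
        obtain ⟨k, hk, rfl⟩ := hmem
        simp [F, hk]
      | one => rw [map_one]; exact (map_one Ψ).symm
      | mul x y hx hy ihx ihy => rw [map_mul, ihx, ihy, ← map_mul]; rfl
      | inv x hx ihx => rw [map_inv, ihx, ← map_inv]; rfl
    refine ⟨F, ?_⟩
    rintro ((i | i) | ⟨k, hk⟩)
    · change F (b₁ i) = _
      rw [hF _ (b₁ i).2.1, hΨ1 _ (b₁ i).2]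
      simp
    · change F (b₂ i) = _
      rw [hF _ (hMH (b₂ i).2), hΨ2 _ (b₂ i).2]
      simp
    · have hk' : k ∉ Y := hk
      change F (c k) = _
      simp [F, hk']
  obtain ⟨b, hb⟩ := FreeGroupBasis.exists_of_lift of hgen hlift'
  exact ⟨_, _, b₁, b, fun i => Sum.inl (Sum.inl i), fun i => hb _⟩

/-- The free factor generated by the basis elements other than `x_i`. -/
def coordFactor (i : Fin n) : Subgroup (FreeGroup (Fin n)) :=
  Subgroup.closure (FreeGroup.of '' {j | j ≠ i})

theorem isFreeFactor_coordFactor (i : Fin n) : IsFreeFactor (coordFactor i) :=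
  isFreeFactor_iff.2 ⟨Fin n, FreeGroupBasis.ofFreeGroup (Fin n), {j | j ≠ i}, rfl⟩

theorem coordFactor_ne_top (i : Fin n) : coordFactor i ≠ ⊤ := by
  intro h
  let F : FreeGroup (Fin n) →* Multiplicative ℤ :=
    FreeGroup.lift fun j => if j = i then Multiplicative.ofAdd 1 else 1
  have h1 : coordFactor i ≤ F.ker := by
    refine (Subgroup.closure_le _).2 ?_
    rintro _ ⟨j, hj, rfl⟩
    have hj' : j ≠ i := hj
    simp [F, MonoidHom.mem_ker, hj']
  rw [h] at h1
  have h2 := h1 (Subgroup.mem_top (FreeGroup.of i))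
  rw [MonoidHom.mem_ker] at h2
  simp [F] at h2

theorem mk_mem_coordFactor {i : Fin n} {w : List (Fin n × Bool)} (hw : ∀ a ∈ w, a.1 ≠ i) :
    FreeGroup.mk w ∈ coordFactor i := by
  induction w with
  | nil => exact Subgroup.one_mem _
  | cons a w ih =>
    rw [mk_cons]
    refine Subgroup.mul_mem _ ?_ (ih fun b hb => hw b (List.mem_cons_of_mem _ hb))
    have ha : FreeGroup.of a.1 ∈ coordFactor i :=
      Subgroup.subset_closure ⟨a.1, hw a List.mem_cons_self, rfl⟩
    obtain ⟨j, s⟩ := a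
    cases s
    · rw [letterVal_false]; exact Subgroup.inv_mem _ ha
    · rw [letterVal_true]; exact ha

/-- Some conjugate of `H` is contained in `K`. -/
def ConjInto (H K : Subgroup (FreeGroup (Fin n))) : Prop :=
  ∃ g, ∀ h ∈ H, g * h * g⁻¹ ∈ K

theorem ConjInto.trans {H K L : Subgroup (FreeGroup (Fin n))} (h₁ : ConjInto H K)
    (h₂ : ConjInto K L) : ConjInto H L := by
  obtain ⟨g, hg⟩ := h₁
  obtain ⟨k, hk⟩ := h₂
  refine ⟨k * g, fun h hh => ?_⟩
  have := hk _ (hg h hh)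
  convert this using 1
  group

theorem ConjInto.map {H K : Subgroup (FreeGroup (Fin n))} (h : ConjInto H K)
    (φ : FreeGroup (Fin n) ≃* FreeGroup (Fin n)) :
    ConjInto (H.map φ.toMonoidHom) (K.map φ.toMonoidHom) := by
  obtain ⟨g, hg⟩ := h
  refine ⟨φ g, ?_⟩
  rintro _ ⟨h, hh, rfl⟩
  exact ⟨_, hg h hh, by simp⟩

theorem SubgroupConj.conjInto {H K : Subgroup (FreeGroup (Fin n))} (h : SubgroupConj H K) :
    ConjInto H K ∧ ConjInto K H := by
  obtain ⟨g, rfl⟩ := h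
  refine ⟨⟨g, fun h hh => ⟨h, hh, by simp⟩⟩, g⁻¹, ?_⟩
  rintro _ ⟨h, hh, rfl⟩
  simpa [mul_assoc] using hh

theorem conjInto_iff {H K : Subgroup (FreeGroup (Fin n))} :
    ConjInto H K ↔ ∃ H', SubgroupConj H H' ∧ H' ≤ K := by
  constructor
  · rintro ⟨g, hg⟩
    refine ⟨_, ⟨g, rfl⟩, ?_⟩
    rintro _ ⟨h, hh, rfl⟩
    simpa using hg h hh
  · rintro ⟨_, ⟨g, rfl⟩, h⟩
    exact ⟨g, fun x hx => h ⟨x, hx, by simp⟩⟩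

/-- Conjugated to a base point in the core, every element of H traces a path in the core, whose
labels all avoid x_i. -/
theorem conjInto_coordFactor {H : Subgroup (FreeGroup (Fin n))} (hH : H ≠ ⊥) {i : Fin n}
    (hi : ∀ g, ¬ CoreDart H g (i, true)) : ConjInto H (coordFactor i) := by
  obtain ⟨g₀, hg₀⟩ := exists_coreVert hH
  have hi' : ∀ g s, ¬ CoreDart H g (i, s) := by
    intro g s
    cases s
    · intro h
      exact hi _ h.symm
    · exact hi g
  have hpath : ∀ g w, PathIn (CoreDart H) g w → ∀ a ∈ w, a.1 ≠ i := by
    intro g w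
    induction w generalizing g with
    | nil => simp
    | cons b w ih =>
      rintro ⟨h1, h2⟩ a ha rfl
      rcases List.mem_cons.1 ha with rfl | ha
      · exact hi' g a.2 h1
      · exact ih _ h2 a ha rfl
  refine ⟨g₀⁻¹, fun h hh => ?_⟩
  have h1 := hg₀.pathIn (h := g₀⁻¹ * h * g₀⁻¹⁻¹) (by simpa [mul_assoc] using hh)
  rw [← FreeGroup.mk_toWord (x := g₀⁻¹ * h * g₀⁻¹⁻¹)]
  exact mk_mem_coordFactor (hpath _ _ h1)

end FreeFactors

/-! ### Distance two in the free factor complex -/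

section Distance

/-- The distance is 0 by convention between vertices in different components, so the value 2 already
forces a path. -/
theorem SimpleGraph.dist_eq_two_iff' {V : Type*} {G : SimpleGraph V} {u w : V} :
    G.dist u w = 2 ↔ u ≠ w ∧ ¬ G.Adj u w ∧ ∃ v, G.Adj u v ∧ G.Adj v w := by
  constructor
  · intro h
    refine ⟨?_, ?_, ?_⟩
    · rintro rfl; simp at h
    · intro h1; rw [SimpleGraph.dist_eq_one_iff_adj.2 h1] at h; omega
    · have hr : G.Reachable u w := by
        by_contra hr
        rw [SimpleGraph.dist_eq_zero_of_not_reachable hr] at h; omega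
      obtain ⟨p, hp⟩ := hr.exists_walk_length_eq_dist
      rw [h] at hp
      match p, hp with
      | .cons h1 (.cons h2 .nil), _ => exact ⟨_, h1, h2⟩
  · rintro ⟨h1, h2, v, h3, h4⟩
    let p : G.Walk u w := .cons h3 (.cons h4 .nil)
    have hp : G.dist u w ≤ 2 := SimpleGraph.dist_le p
    have h5 : G.dist u w ≠ 0 := fun h => h1 ((SimpleGraph.Reachable.dist_eq_zero_iff ⟨p⟩).1 h)
    have h6 : G.dist u w ≠ 1 := fun h => h2 (SimpleGraph.dist_eq_one_iff_adj.1 h)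
    omega

variable {n : ℕ}

/-- Including equality on the left avoids having to show that factors conjugate into each other are
conjugate. -/
theorem freeFactorClass_eq_or_adj_iff {H K : ProperFreeFactor n} :
    (freeFactorClass H = freeFactorClass K ∨
      (freeFactorGraph n).Adj (freeFactorClass H) (freeFactorClass K)) ↔
      ConjInto H.1 K.1 ∨ ConjInto K.1 H.1 := by
  have hconj : ∀ {H K : ProperFreeFactor n}, freeFactorClass H = freeFactorClass K →
      ConjInto H.1 K.1 ∧ ConjInto K.1 H.1 := fun {H K} h =>
    SubgroupConj.conjInto (Quotient.exact h)
  have hinto : ∀ {H K : ProperFreeFactor n}, ConjInto H.1 K.1 →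
      ∃ H' : ProperFreeFactor n, freeFactorClass H' = freeFactorClass H ∧ H'.1 ≤ K.1 := by
    rintro ⟨H, hH, hbot, htop⟩ ⟨K, _⟩ h
    obtain ⟨_, ⟨g, rfl⟩, hle⟩ := conjInto_iff.1 h
    refine ⟨⟨_, hH.map _, ?_, ?_⟩, (Quotient.sound ⟨g, rfl⟩ : freeFactorClass _ = _).symm, hle⟩
    · rwa [Ne, Subgroup.map_eq_bot_iff_of_injective]
      exact (MulAut.conj g).injective
    · intro h
      rw [← Subgroup.map_top_of_surjective (MulAut.conj g).toMonoidHom (MulAut.conj g).surjective] at h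
      exact htop (Subgroup.map_injective (MulAut.conj g).injective h)
  constructor
  · rintro (h | ⟨_, H', K', hH, hK, hle | hle⟩)
    · exact Or.inl (hconj h).1
    · exact Or.inl (((hconj hH).2.trans ⟨1, fun h hh => by simpa using hle hh⟩).trans (hconj hK).1)
    · exact Or.inr (((hconj hK).2.trans ⟨1, fun h hh => by simpa using hle hh⟩).trans (hconj hH).1)
  · intro h
    by_cases heq : freeFactorClass H = freeFactorClass K
    · exact Or.inl heq
    refine Or.inr ⟨heq, ?_⟩
    rcases h with h | h
    · obtain ⟨H', h1, h2⟩ := hinto h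
      exact ⟨H', K, h1, rfl, Or.inl h2⟩
    · obtain ⟨K', h1, h2⟩ := hinto h
      exact ⟨H, K', rfl, h1, Or.inr h2⟩

/-- A characterisation of the pairs of free factors at distance two. -/
theorem freeFactorGraph_dist_eq_two_iff {H K : ProperFreeFactor n} :
    (freeFactorGraph n).dist (freeFactorClass H) (freeFactorClass K) = 2 ↔
      ¬ ConjInto H.1 K.1 ∧ ¬ ConjInto K.1 H.1 ∧
        ((∃ J, IsFreeFactor J ∧ J ≠ ⊤ ∧ ConjInto H.1 J ∧ ConjInto K.1 J) ∨
          ∃ g x, x ≠ 1 ∧ x ∈ H.1 ∧ g * x * g⁻¹ ∈ K.1) := by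
  rw [SimpleGraph.dist_eq_two_iff', ← and_assoc, ← and_assoc, ← not_or, ← not_or,
    freeFactorClass_eq_or_adj_iff]
  refine and_congr_right fun hHK => ?_
  rw [not_or] at hHK
  constructor
  · rintro ⟨v, h1, h2⟩
    obtain ⟨L, rfl⟩ := Quotient.exists_rep v
    -- A middle class L lies above both, below both, or between the two. The last case is excluded,
    -- the first gives a common factor, and the second gives a shared non-trivial element.
    rcases freeFactorClass_eq_or_adj_iff.1 (Or.inr h1) with h1 | h1 <;>
    rcases freeFactorClass_eq_or_adj_iff.1 (Or.inr h2) with h2 | h2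
    · exact absurd (h1.trans h2) hHK.1
    · exact Or.inl ⟨L.1, L.2.1, L.2.2.2, h1, h2⟩
    · obtain ⟨x, hx1⟩ := Subgroup.ne_bot_iff_exists_ne_one.1 L.2.2.1
      obtain ⟨g, hg⟩ := h1
      obtain ⟨k, hk⟩ := h2
      refine Or.inr ⟨k * g⁻¹, g * x * g⁻¹, ?_, hg _ x.2, ?_⟩
      · simpa using hx1
      · simpa [mul_assoc] using hk _ x.2
    · exact absurd (h2.trans h1) hHK.2
  · intro h
    -- The last two conditions keep the class of L distinct from both given classes, so that
    -- comparability becomes adjacency.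
    obtain ⟨L, hL1, hL2⟩ : ∃ L : ProperFreeFactor n,
        (ConjInto H.1 L.1 ∨ ConjInto L.1 H.1) ∧ (ConjInto L.1 K.1 ∨ ConjInto K.1 L.1) ∧
        ¬ (ConjInto L.1 H.1 ∧ ConjInto H.1 L.1) ∧ ¬ (ConjInto L.1 K.1 ∧ ConjInto K.1 L.1) := by
      rcases h with ⟨J, hJ, htop, h1, h2⟩ | ⟨g, x, hx1, hxH, hxK⟩
      · refine ⟨⟨J, hJ, ?_, htop⟩, Or.inl h1, Or.inr h2, fun h => hHK.2 (h2.trans h.1),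
          fun h => hHK.1 (h1.trans h.1)⟩
        rintro rfl
        obtain ⟨g, hg⟩ := h1
        refine H.2.2.1 ((Subgroup.eq_bot_iff_forall _).2 fun x hx => ?_)
        simpa using hg x hx
      · have hle : ConjInto (H.1 ⊓ K.1.map (MulAut.conj g⁻¹).toMonoidHom) K.1 := by
          refine ⟨g, ?_⟩
          rintro _ ⟨_, k, hk, rfl⟩
          simpa [mul_assoc] using hk
        have hle' : ConjInto (H.1 ⊓ K.1.map (MulAut.conj g⁻¹).toMonoidHom) H.1 :=
          ⟨1, fun h hh => by simpa using hh.1⟩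
        refine ⟨⟨H.1 ⊓ K.1.map (MulAut.conj g⁻¹).toMonoidHom, H.2.1.inf (K.2.1.map _), ?_, ?_⟩,
          Or.inr hle', Or.inl hle, fun h => hHK.1 (h.2.trans hle),
          fun h => hHK.2 (h.2.trans hle')⟩
        · intro h
          refine hx1 ((Subgroup.eq_bot_iff_forall _).1 h x ⟨hxH, _, hxK, ?_⟩)
          simp [mul_assoc]
        · intro h
          exact H.2.2.2 (top_le_iff.1 (h.ge.trans inf_le_left))
    have hconj : ∀ {H K : ProperFreeFactor n}, freeFactorClass H = freeFactorClass K →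
      ConjInto H.1 K.1 ∧ ConjInto K.1 H.1 := fun {H K} h =>
        SubgroupConj.conjInto (Quotient.exact h)
    refine ⟨freeFactorClass L, ?_, ?_⟩
    · exact (freeFactorClass_eq_or_adj_iff.2 hL1).resolve_left fun h => hL2.2.1 (hconj h).symm
    · exact (freeFactorClass_eq_or_adj_iff.2 hL2.1).resolve_left fun h => hL2.2.2 (hconj h)

end Distance

/-! ### Paths in folded graphs -/

section FoldedGraph

/-- The word `w` labels a path from `x` to `y` in the quotient by `r` of the graph with edges
`E`. -/
def FoldedPath {X α : Type*} (r : X → X → Prop) (E : X → α × Bool → X → Prop) :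
    List (α × Bool) → X → X → Prop
  | [], x, y => r x y
  | a :: w, x, y => ∃ s t, r x s ∧ E s a t ∧ FoldedPath r E w t y

variable {X α : Type*} {r : X → X → Prop} {E : X → α × Bool → X → Prop}

theorem FoldedPath.of_rel (htrans : ∀ x y z, r x y → r y z → r x z) {w : List (α × Bool)}
    {x y z : X} (h : r x y) (hw : FoldedPath r E w y z) : FoldedPath r E w x z := by
  cases w with
  | nil => exact htrans _ _ _ h hw
  | cons a w =>
    obtain ⟨s, t, h1, h2⟩ := hw
    exact ⟨s, t, htrans _ _ _ h h1, h2⟩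

theorem FoldedPath.append (htrans : ∀ x y z, r x y → r y z → r x z) {u v : List (α × Bool)}
    {x y z : X} (hu : FoldedPath r E u x y) (hv : FoldedPath r E v y z) :
    FoldedPath r E (u ++ v) x z := by
  induction u generalizing x with
  | nil => exact hv.of_rel htrans hu
  | cons a u ih =>
    obtain ⟨s, t, h1, h2, h3⟩ := hu
    exact ⟨s, t, h1, h2, ih h3⟩

theorem FoldedPath.invRev (hsymm : ∀ x y, r x y → r y x)
    (htrans : ∀ x y z, r x y → r y z → r x z)
    (hinv : ∀ s a t, E s a t → E t (a.1, !a.2) s) {u : List (α × Bool)} {x y : X}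
    (hu : FoldedPath r E u x y) : FoldedPath r E (FreeGroup.invRev u) y x := by
  induction u generalizing x with
  | nil => exact hsymm _ _ hu
  | cons a u ih =>
    obtain ⟨s, t, h1, h2, h3⟩ := hu
    -- The relation is not assumed reflexive; at a point related to something, reflexivity follows
    -- from symmetry and transitivity.
    have h4 : r t t := by
      have h5 := ih h3
      clear ih
      cases u with
      | nil => exact htrans _ _ _ h3 (hsymm _ _ h3)
      | cons b u =>
        obtain ⟨s', t', h6, -⟩ := h3
        exact htrans _ _ _ h6 (hsymm _ _ h6)
    rw [FreeGroup.invRev_cons]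
    refine (ih h3).append htrans ?_
    exact ⟨t, s, h4, hinv _ _ _ h2, hsymm _ _ h1⟩

/-- In a folded graph the second edge of a cancelling pair must retrace the first, so both can be
dropped. -/
theorem FoldedPath.red_step
    (htrans : ∀ x y z, r x y → r y z → r x z)
    (hinv : ∀ s a t, E s a t → E t (a.1, !a.2) s)
    (hdet : ∀ s t s' t' a, E s a t → E s' a t' → r s s' → r t t')
    {u v : List (α × Bool)} (h : FreeGroup.Red.Step u v) {x y : X}
    (hu : FoldedPath r E u x y) : FoldedPath r E v x y := by
  obtain @⟨L₁, L₂, z, b⟩ := h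
  induction L₁ generalizing x with
  | nil =>
    obtain ⟨s, t, h1, h2, s', t', h3, h4, h5⟩ := hu
    exact h5.of_rel htrans (htrans _ _ _ h1 (hdet _ _ _ _ _ (hinv _ _ _ h2) h4 h3))
  | cons a L₁ ih =>
    obtain ⟨s, t, h1, h2, h3⟩ := hu
    exact ⟨s, t, h1, h2, ih h3⟩

theorem FoldedPath.red
    (htrans : ∀ x y z, r x y → r y z → r x z)
    (hinv : ∀ s a t, E s a t → E t (a.1, !a.2) s)
    (hdet : ∀ s t s' t' a, E s a t → E s' a t' → r s s' → r t t')
    {u v : List (α × Bool)} (h : FreeGroup.Red u v) {x y : X}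
    (hu : FoldedPath r E u x y) : FoldedPath r E v x y := by
  induction h with
  | refl => exact hu
  | tail _ hstep ih => exact ih.red_step htrans hinv hdet hstep

/-- Foldedness makes the class of the end point a function of the class of the start and the word.
-/
theorem FoldedPath.rel (hsymm : ∀ x y, r x y → r y x)
    (htrans : ∀ x y z, r x y → r y z → r x z)
    (hdet : ∀ s t s' t' a, E s a t → E s' a t' → r s s' → r t t')
    {w : List (α × Bool)} {x x' y y' : X} (hx : r x x')
    (h : FoldedPath r E w x y) (h' : FoldedPath r E w x' y') : r y y' := by
  induction w generalizing x x' with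
  | nil => exact htrans _ _ _ (htrans _ _ _ (hsymm _ _ h) hx) h'
  | cons a w ih =>
    obtain ⟨s, t, h1, h2, h3⟩ := h
    obtain ⟨s', t', h1', h2', h3'⟩ := h'
    exact ih (hdet _ _ _ _ _ h2 h2' (htrans _ _ _ (htrans _ _ _ (hsymm _ _ h1) hx) h1')) h3 h3'

/-- A word that represents an element of the subgroup generated by labels of loops labels only
loops. -/
theorem FoldedPath.rel_of_mem_closure (hsymm : ∀ x y, r x y → r y x)
    (htrans : ∀ x y z, r x y → r y z → r x z)
    (hinv : ∀ s a t, E s a t → E t (a.1, !a.2) s)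
    (hdet : ∀ s t s' t' a, E s a t → E s' a t' → r s s' → r t t') {x₀ : X} (hx₀ : r x₀ x₀)
    {V : List (List (α × Bool))} (hV : ∀ v ∈ V, FoldedPath r E v x₀ x₀) {h : List (α × Bool)}
    {y : X} (hh : FoldedPath r E h x₀ y)
    (hmem : FreeGroup.mk h ∈ Subgroup.closure {g | ∃ w ∈ V, g = FreeGroup.mk w}) : r x₀ y := by
  have key : ∀ g ∈ Subgroup.closure {g | ∃ w ∈ V, g = FreeGroup.mk w},
      ∃ w, FreeGroup.mk w = g ∧ FoldedPath r E w x₀ x₀ := by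
    intro g hg
    induction hg using Subgroup.closure_induction with
    | mem g hg =>
      obtain ⟨w, hw, rfl⟩ := hg
      exact ⟨w, rfl, hV w hw⟩
    | one => exact ⟨[], FreeGroup.one_eq_mk.symm, hx₀⟩
    | mul g g' _ _ ih ih' =>
      obtain ⟨w, rfl, hw⟩ := ih
      obtain ⟨w', rfl, hw'⟩ := ih'
      exact ⟨w ++ w', FreeGroup.mul_mk.symm, hw.append htrans hw'⟩
    | inv g _ ih =>
      obtain ⟨w, rfl, hw⟩ := ih
      exact ⟨_, FreeGroup.inv_mk.symm, hw.invRev hsymm htrans hinv⟩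
  obtain ⟨w, hw, hpath⟩ := key _ hmem
  -- By confluence the loop and the given word have a common reduct, which labels paths with both
  -- pairs of end points.
  obtain ⟨v, hv1, hv2⟩ := FreeGroup.Red.exact.1 hw
  exact (hpath.red htrans hinv hdet hv1).rel hsymm htrans hdet hx₀
    (hh.red htrans hinv hdet hv2)

end FoldedGraph

/-! ### A membership test for finitely generated subgroups -/

section MembershipTest

variable {α : Type*}

/-- The edge, in both directions, that joins a non-empty word to its longest proper prefix. -/
def wordEdges (p : List (α × Bool)) : List (List (α × Bool) × (α × Bool) × List (α × Bool)) :=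
  match p.reverse with
  | [] => []
  | a :: q => [(q.reverse, a, p), (p, (a.1, !a.2), q.reverse)]

theorem mem_wordEdges {p : List (α × Bool)}
    {e : List (α × Bool) × (α × Bool) × List (α × Bool)} : e ∈ wordEdges p ↔
      ∃ q a, p = q ++ [a] ∧ (e = (q, a, p) ∨ e = (p, (a.1, !a.2), q)) := by
  rcases List.eq_nil_or_concat' p with rfl | ⟨q, a, rfl⟩
  · simp [wordEdges]
  · simp only [wordEdges, List.reverse_append, List.reverse_cons, List.reverse_nil, List.nil_append,
      List.singleton_append, List.reverse_reverse, List.mem_cons, List.not_mem_nil, or_false]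
    constructor
    · exact fun h => ⟨q, a, rfl, h⟩
    · rintro ⟨q', a', h, h'⟩
      obtain ⟨rfl, h0⟩ := List.append_inj' h rfl
      obtain rfl := List.singleton_inj.1 h0
      exact h'

variable [DecidableEq α]

/-- Whether `R` is an equivalence relation on the words `W` whose quotient is a folded graph in
which the words `V` label loops. -/
def isFolding (V W : List (List (α × Bool)))
    (R : List (List (α × Bool) × List (α × Bool))) : Bool :=
  (W.all fun p => decide ((p, p) ∈ R)) &&
  ((R.all fun x => decide ((x.2, x.1) ∈ R)) &&
  ((R.all fun x => R.all fun y => !decide (x.2 = y.1) || decide ((x.1, y.2) ∈ R)) &&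
  ((V.all fun v => decide (([], v) ∈ R)) &&
  ((W.flatMap wordEdges).all fun e => (W.flatMap wordEdges).all fun f =>
    !decide (e.2.1 = f.2.1) || (!decide ((e.1, f.1) ∈ R) || decide ((e.2.2, f.2.2) ∈ R))))))

theorem isFolding_iff {V W : List (List (α × Bool))}
    {R : List (List (α × Bool) × List (α × Bool))} : isFolding V W R = true ↔
      (∀ p ∈ W, (p, p) ∈ R) ∧ (∀ p q, (p, q) ∈ R → (q, p) ∈ R) ∧
      (∀ p q s, (p, q) ∈ R → (q, s) ∈ R → (p, s) ∈ R) ∧ (∀ v ∈ V, ([], v) ∈ R) ∧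
      ∀ p s a q t, (p, a, s) ∈ W.flatMap wordEdges → (q, a, t) ∈ W.flatMap wordEdges →
        (p, q) ∈ R → (s, t) ∈ R := by
  unfold isFolding
  simp only [Bool.and_eq_true, List.all_eq_true, decide_eq_true_eq, Bool.or_eq_true,
    Bool.not_eq_true', decide_eq_false_iff_not, Prod.forall, ← imp_iff_not_or]
  refine and_congr_right fun _ => and_congr_right fun _ => and_congr ?_ (and_congr_right fun _ => ?_)
  · constructor
    · exact fun h p q s h1 h2 => h p q h1 q s h2 rfl
    · rintro h p q h1 _ s h2 rfl
      exact h p q s h1 h2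
  · constructor
    · rintro h p s a b q t h1 h2 h3
      exact h _ _ _ _ h1 _ _ _ _ h2 rfl h3
    · rintro h p a b s h1 q a' b' s' h2 h3 h4
      rw [← h3] at h2
      exact h _ _ _ _ _ _ h1 h2 h4

/-- Whether the word `h` represents an element of the subgroup generated by the words `V`. -/
def memTest (h : List (α × Bool)) (V : List (List (α × Bool))) : Bool :=
  ((wordPrefixes (h :: V)).product (wordPrefixes (h :: V))).sublists'.all fun R =>
    !isFolding V (wordPrefixes (h :: V)) R || decide (([], h) ∈ R)

/-- The generators and `h` are drawn as paths from the empty word on the finite set of their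
prefixes. An element of H closes up in every folded quotient in which the generators are loops;
conversely, equality of H-cosets is one such quotient, and there closing up means membership. -/
theorem memTest_iff {h : List (α × Bool)} {V : List (List (α × Bool))} : memTest h V = true ↔
    FreeGroup.mk h ∈ Subgroup.closure {g | ∃ w ∈ V, g = FreeGroup.mk w} := by
  classical
  set H := Subgroup.closure {g | ∃ w ∈ V, g = FreeGroup.mk w} with hH
  set W := wordPrefixes (h :: V) with hW
  have hnil : [] ∈ W := mem_wordPrefixes.2 (Or.inl rfl)
  have hhW : h ∈ W := mem_wordPrefixes.2 (Or.inr ⟨h, by simp, List.prefix_rfl⟩)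
  have hVW : ∀ v ∈ V, v ∈ W := fun v hv =>
    mem_wordPrefixes.2 (Or.inr ⟨v, by simp [hv], List.prefix_rfl⟩)
  have hpre : ∀ p q : List (α × Bool), p <+: q → q ∈ W → p ∈ W := by
    intro p q hpq hq
    rcases mem_wordPrefixes.1 hq with rfl | ⟨u, hu, hqu⟩
    · rwa [List.prefix_nil.1 hpq]
    · exact mem_wordPrefixes.2 (Or.inr ⟨u, hu, hpq.trans hqu⟩)
  have htest : memTest h V = true ↔ ∀ R, R.Sublist (W.product W) → isFolding V W R = true →
      ([], h) ∈ R := by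
    simp only [memTest, ← hW, List.all_eq_true, List.mem_sublists', Bool.or_eq_true,
      Bool.not_eq_true', decide_eq_true_eq, ← Bool.not_eq_true, ← imp_iff_not_or]
  rw [htest]
  constructor
  · intro htest
    -- The coset relation is obtained by filtering all pairs, so it occurs among the tested
    -- sublists.
    let P : List (α × Bool) × List (α × Bool) → Prop := fun x =>
      FreeGroup.mk x.2 * (FreeGroup.mk x.1)⁻¹ ∈ H
    have hmem : ∀ p q, (p, q) ∈ (W.product W).filter (fun x => decide (P x)) ↔
        (p ∈ W ∧ q ∈ W) ∧ FreeGroup.mk q * (FreeGroup.mk p)⁻¹ ∈ H := by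
      intro p q
      rw [List.mem_filter, List.pair_mem_product, decide_eq_true_eq]
    suffices hfold : isFolding V W ((W.product W).filter fun x => decide (P x)) = true by
      have h1 := htest _ List.filter_sublist hfold
      simpa [← FreeGroup.one_eq_mk] using ((hmem _ _).1 h1).2
    refine isFolding_iff.2 ⟨?_, ?_, ?_, ?_, ?_⟩
    · intro p hp
      rw [hmem]
      exact ⟨⟨hp, hp⟩, by rw [mul_inv_cancel]; exact H.one_mem⟩
    · intro p q hpq
      rw [hmem] at hpq ⊢
      refine ⟨hpq.1.symm, ?_⟩
      convert H.inv_mem hpq.2 using 1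
      group
    · intro p q s hpq hqs
      rw [hmem] at hpq hqs ⊢
      refine ⟨⟨hpq.1.1, hqs.1.2⟩, ?_⟩
      convert H.mul_mem hqs.2 hpq.2 using 1
      group
    · intro v hv
      rw [hmem]
      refine ⟨⟨hnil, hVW v hv⟩, ?_⟩
      rw [← FreeGroup.one_eq_mk, inv_one, mul_one]
      exact Subgroup.subset_closure ⟨v, hv, rfl⟩
    · have hedge : ∀ p a s, (p, a, s) ∈ W.flatMap wordEdges →
          s ∈ W ∧ FreeGroup.mk s = FreeGroup.mk p * FreeGroup.mk [a] := by
        intro p a s he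
        obtain ⟨w, hw, he⟩ := List.mem_flatMap.1 he
        obtain ⟨q, b, rfl, he | he⟩ := mem_wordEdges.1 he
        · obtain ⟨rfl, rfl, rfl⟩ := he
          exact ⟨hw, FreeGroup.mul_mk.symm⟩
        · obtain ⟨rfl, rfl, rfl⟩ := he
          refine ⟨hpre _ _ (List.prefix_append _ _) hw, ?_⟩
          have : FreeGroup.mk [(b.1, !b.2)] = (FreeGroup.mk [b])⁻¹ := by
            simp [FreeGroup.inv_mk, FreeGroup.invRev]
          rw [this, ← FreeGroup.mul_mk, mul_inv_cancel_right]
      intro p s a q t h1 h2 h3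
      rw [hmem] at h3 ⊢
      refine ⟨⟨(hedge _ _ _ h1).1, (hedge _ _ _ h2).1⟩, ?_⟩
      rw [(hedge _ _ _ h1).2, (hedge _ _ _ h2).2]
      convert h3.2 using 1
      group
  · intro hmem R _ hR
    obtain ⟨hrefl, hsymm, htrans, hV, hdet⟩ := isFolding_iff.1 hR
    -- The word `h` labels the path from the empty word to `h`; as it represents a product of loops,
    -- its two ends are identified.
    let r : List (α × Bool) → List (α × Bool) → Prop := fun p q => (p, q) ∈ R
    let E : List (α × Bool) → α × Bool → List (α × Bool) → Prop := fun p a q =>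
      (p, a, q) ∈ W.flatMap wordEdges
    have hinv : ∀ s a t, E s a t → E t (a.1, !a.2) s := by
      intro s a t he
      obtain ⟨w, hw, he⟩ := List.mem_flatMap.1 he
      refine List.mem_flatMap.2 ⟨w, hw, ?_⟩
      obtain ⟨q, b, rfl, he | he⟩ := mem_wordEdges.1 he
      · obtain ⟨rfl, rfl, rfl⟩ := he
        exact mem_wordEdges.2 ⟨_, _, rfl, Or.inr rfl⟩
      · obtain ⟨rfl, rfl, rfl⟩ := he
        exact mem_wordEdges.2 ⟨_, _, rfl, Or.inl (by simp)⟩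
    have hpath : ∀ w, w ∈ W → FoldedPath r E w [] w := by
      intro w
      induction w using List.reverseRecOn with
      | nil => exact fun h => hrefl _ h
      | append_singleton w a ih =>
        intro hw
        have hw' : w ∈ W := hpre _ _ (List.prefix_append _ _) hw
        refine (ih hw').append htrans ⟨w, w ++ [a], hrefl _ hw', ?_, hrefl _ hw⟩
        exact List.mem_flatMap.2 ⟨_, hw, mem_wordEdges.2 ⟨_, _, rfl, Or.inl rfl⟩⟩
    refine FoldedPath.rel_of_mem_closure (r := r) (E := E) hsymm htrans hinv
      (fun s t s' t' a h1 h2 h3 => hdet _ _ _ _ _ h1 h2 h3) (hrefl _ hnil) ?_ (hpath h hhW)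
      hmem
    intro v hv
    have := (hpath v (hVW v hv)).append htrans (v := []) (hsymm _ _ (hV v hv))
    rwa [List.append_nil] at this

end MembershipTest

/-! ### The decision procedure -/

section Algorithm

variable {α : Type*} [DecidableEq α]

/-- Whether some conjugate of the subgroup generated by `U` is contained in the one generated
by `V`. -/
def conjTest (U V : List (List (α × Bool))) : Bool :=
  (wordPrefixes V).any fun q => (wordPrefixes U).any fun p => U.all fun u =>
    memTest (q ++ (FreeGroup.invRev p ++ (u ++ (p ++ FreeGroup.invRev q)))) V

/-- The words of length at most `k` in the letters `L`. -/
def wordsUpTo {β : Type*} (L : List β) (k : ℕ) : List (List β) :=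
  (fun l => [] :: l.flatMap fun w => L.map fun a => a :: w)^[k] [[]]

/-- Whether the subgroup generated by `U` contains a non-trivial element, some conjugate of which
lies in the subgroup generated by `V`; the letters to be used are `L`. -/
def meetTest (L : List (α × Bool)) (U V : List (List (α × Bool))) : Bool :=
  (wordPrefixes U).any fun q => (wordPrefixes V).any fun r =>
    (wordsUpTo L ((wordPrefixes U).length * (wordPrefixes V).length)).any fun w =>
      !memTest w [] && (memTest (q ++ (w ++ FreeGroup.invRev q)) U &&
        memTest (r ++ (w ++ FreeGroup.invRev r)) V)

/-- The image of a letter under the Whitehead automorphism `(A, a)`. -/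
def moveLetter (a : α × Bool) (A : List (α × Bool)) (y : α × Bool) : List (α × Bool) :=
  if y.1 = a.1 then [y] else
    (if y ∈ A then [a] else []) ++ y :: (if (y.1, !y.2) ∈ A then [(a.1, !a.2)] else [])

/-- The image of a list of words under the Whitehead automorphism `(A, a)`. -/
def moveWords (a : α × Bool) (A : List (α × Bool)) (U : List (List (α × Bool))) :
    List (List (α × Bool)) :=
  U.map fun w => w.flatMap (moveLetter a A)

/-- The images of a pair of lists of words under all Whitehead automorphisms. -/
def moves (L : List (α × Bool)) (S : List (List (α × Bool)) × List (List (α × Bool))) :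
    List (List (List (α × Bool)) × List (List (α × Bool))) :=
  L.flatMap fun a => L.sublists'.map fun A => (moveWords a A S.1, moveWords a A S.2)

/-- The images of the members of a list of pairs of lists of words under products of at most `k`
Whitehead automorphisms. -/
def reach (L : List (α × Bool)) (k : ℕ)
    (l : List (List (List (α × Bool)) × List (List (α × Bool)))) :
    List (List (List (α × Bool)) × List (List (α × Bool))) :=
  (fun l => l ++ l.flatMap (moves L))^[k] l

/-- The letters of rank `n`. -/
def letters (n : ℕ) : List (ℕ × Bool) :=
  (List.range n).flatMap fun i => [(i, true), (i, false)]

/-- The generators other than `x_i`, as words. -/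
def coordWords (n i : ℕ) : List (List (ℕ × Bool)) :=
  ((List.range n).filter fun j => !decide (j = i)).map fun j => [(j, true)]

/-- Whether conjugates of the free factors generated by `U` and `V` lie in a common proper free
factor of the free group of rank `n`. -/
def commonFactorTest (n : ℕ) (U V : List (List (ℕ × Bool))) : Bool :=
  (reach (letters n) ((wordPrefixes U).length + (wordPrefixes V).length) [(U, V)]).any fun S =>
    (List.range n).any fun i =>
      conjTest S.1 (coordWords n i) && conjTest S.2 (coordWords n i)

/-- Whether the free factors generated by `U` and `V` are at distance two in the free factor complex
of rank `n`. -/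
def distTwoTest (x : ℕ × List (List (ℕ × Bool)) × List (List (ℕ × Bool))) : Bool :=
  !conjTest x.2.1 x.2.2 && (!conjTest x.2.2 x.2.1 &&
    (commonFactorTest x.1 x.2.1 x.2.2 || meetTest (letters x.1) x.2.1 x.2.2))

end Algorithm

/-! ### Transfer from letters in `Fin n` to letters in `ℕ` -/

section Encoding

variable {n : ℕ}

/-- A letter, written with a natural number in place of an element of `Fin n`. -/
def encodeLetter (a : Fin n × Bool) : ℕ × Bool := (a.1.val, a.2)

theorem encodeLetter_injective : Function.Injective (encodeLetter (n := n)) := by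
  rintro ⟨i, s⟩ ⟨j, t⟩ h
  obtain ⟨h1, h2⟩ := Prod.mk.inj h
  exact Prod.ext (Fin.ext h1) h2

theorem encodeWords_eq (U : List (List (Fin n × Bool))) :
    encodeWords U = U.map (List.map encodeLetter) := rfl

theorem map_encodeLetter_invRev (w : List (Fin n × Bool)) :
    (FreeGroup.invRev w).map encodeLetter = FreeGroup.invRev (w.map encodeLetter) := by
  simp [FreeGroup.invRev, encodeLetter]

theorem wordPrefixes_encodeWords (U : List (List (Fin n × Bool))) :
    wordPrefixes (encodeWords U) = (wordPrefixes U).map (List.map encodeLetter) := by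
  simp [wordPrefixes, encodeWords_eq, List.flatMap_map, List.map_flatMap, List.map_inits]

/-- Enlarging the alphabet embeds F_n into the free group on ℕ, and an injective map does not affect
membership. -/
theorem memTest_encode {h : List (Fin n × Bool)} {V : List (List (Fin n × Bool))} :
    memTest (h.map encodeLetter) (encodeWords V) = true ↔ FreeGroup.mk h ∈ wordSubgroup V := by
  have hinj : Function.Injective (FreeGroup.map (Fin.val : Fin n → ℕ)) :=
    FreeGroup.map_injective Fin.val_injective
  have hmk : ∀ w : List (Fin n × Bool), FreeGroup.mk (w.map encodeLetter) =
      FreeGroup.map Fin.val (FreeGroup.mk w) := fun w => FreeGroup.map.mk.symm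
  have hcl : Subgroup.closure {g | ∃ w ∈ encodeWords V, g = FreeGroup.mk w} =
      (wordSubgroup V).map (FreeGroup.map Fin.val) := by
    rw [wordSubgroup, MonoidHom.map_closure]
    congr 1
    ext g
    constructor
    · rintro ⟨w, hw, rfl⟩
      obtain ⟨v, hv, rfl⟩ := List.mem_map.1 hw
      exact ⟨_, ⟨v, hv, rfl⟩, (hmk v).symm⟩
    · rintro ⟨_, ⟨v, hv, rfl⟩, rfl⟩
      exact ⟨_, List.mem_map.2 ⟨v, hv, rfl⟩, (hmk v).symm⟩
  rw [memTest_iff, hcl, hmk]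
  exact Subgroup.mem_map_iff_mem hinj

theorem mem_letters {n : ℕ} {x : ℕ × Bool} :
    x ∈ letters n ↔ ∃ a : Fin n × Bool, encodeLetter a = x := by
  obtain ⟨i, s⟩ := x
  simp only [letters, List.mem_flatMap, List.mem_range, List.mem_cons, Prod.mk.injEq,
    List.not_mem_nil, or_false]
  constructor
  · rintro ⟨j, hj, ⟨rfl, rfl⟩ | ⟨rfl, rfl⟩⟩
    · exact ⟨(⟨i, hj⟩, true), rfl⟩
    · exact ⟨(⟨i, hj⟩, false), rfl⟩
  · rintro ⟨⟨j, t⟩, h⟩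
    obtain ⟨rfl, rfl⟩ := Prod.mk.inj h
    exact ⟨j, j.2, by cases t <;> simp⟩

theorem exists_map_encodeLetter {w : List (ℕ × Bool)} (hw : ∀ x ∈ w, x ∈ letters n) :
    ∃ v : List (Fin n × Bool), v.map encodeLetter = w := by
  induction w with
  | nil => exact ⟨[], rfl⟩
  | cons x w ih =>
    obtain ⟨v, rfl⟩ := ih fun y hy => hw y (List.mem_cons_of_mem _ hy)
    obtain ⟨a, rfl⟩ := mem_letters.1 (hw x List.mem_cons_self)
    exact ⟨a :: v, rfl⟩

theorem mem_wordsUpTo {β : Type*} {L : List β} {k : ℕ} {w : List β} :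
    w ∈ wordsUpTo L k ↔ w.length ≤ k ∧ ∀ x ∈ w, x ∈ L := by
  induction k generalizing w with
  | zero =>
    simp only [wordsUpTo, Function.iterate_zero, id_eq, List.mem_singleton, Nat.le_zero,
      List.length_eq_zero_iff]
    constructor
    · rintro rfl; simp
    · exact fun h => h.1
  | succ k ih =>
    have hsucc : wordsUpTo L (k + 1) =
        [] :: (wordsUpTo L k).flatMap fun w => L.map fun a => a :: w := by
      simp only [wordsUpTo, Function.iterate_succ_apply']
    rw [hsucc]
    cases w with
    | nil => simp
    | cons a w =>
      simp only [List.mem_cons, List.mem_flatMap, List.mem_map, reduceCtorEq, false_or]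
      constructor
      · rintro ⟨v, hv, b, hb, h⟩
        obtain ⟨rfl, rfl⟩ := List.cons.inj h
        rw [ih] at hv
        exact ⟨by simpa using hv.1, by rintro x (rfl | hx); exacts [hb, hv.2 x hx]⟩
      · rintro ⟨h1, h2⟩
        exact ⟨w, ih.2 ⟨by simpa using h1, fun x hx => h2 x (Or.inr hx)⟩, a, h2 a (Or.inl rfl), rfl⟩

end Encoding

/-! ### Correctness of the conjugacy and intersection tests -/

section Tests

variable {n : ℕ}

theorem CoreVert.conj {H K : Subgroup (FreeGroup (Fin n))} {x g : FreeGroup (Fin n)}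
    (hx : CoreVert H x) (hg : ∀ h ∈ H, g * h * g⁻¹ ∈ K) : CoreVert K (g * x) := by
  obtain ⟨a, y, hy, h1, h2⟩ := hx
  refine ⟨a, y, ?_, h1, h2⟩
  convert hg _ hy using 1
  group

theorem CoreVert.of_pathIn_append {H : Subgroup (FreeGroup (Fin n))} {g : FreeGroup (Fin n)}
    (hg : CoreVert H g) {u v : List (Fin n × Bool)} (h : PathIn (CoreDart H) g (u ++ v)) :
    CoreVert H (g * FreeGroup.mk u) := by
  rcases List.eq_nil_or_concat' u with rfl | ⟨u, b, rfl⟩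
  · rwa [← FreeGroup.one_eq_mk, mul_one]
  · rw [List.append_assoc, pathIn_append] at h
    rw [← FreeGroup.mul_mk, ← mul_assoc]
    exact h.2.1.coreVert_mul

/-- A conjugator `g` takes a core vertex x of the first group to a core vertex gx of the second.
Both are represented by prefixes `p` and `q` of generators, and then q p⁻¹ also conjugates the first
group into the second. -/
theorem conjTest_encode {U V : List (List (Fin n × Bool))} (hU : wordSubgroup U ≠ ⊥) :
    conjTest (encodeWords U) (encodeWords V) = true ↔
      ConjInto (wordSubgroup U) (wordSubgroup V) := by
  have h0 : conjTest (encodeWords U) (encodeWords V) = true ↔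
      ∃ q ∈ wordPrefixes V, ∃ p ∈ wordPrefixes U, ∀ u ∈ U,
        FreeGroup.mk q * (FreeGroup.mk p)⁻¹ * FreeGroup.mk u *
          (FreeGroup.mk q * (FreeGroup.mk p)⁻¹)⁻¹ ∈ wordSubgroup V := by
    unfold conjTest
    rw [wordPrefixes_encodeWords, wordPrefixes_encodeWords]
    simp only [List.any_map, List.any_eq_true, Function.comp_apply]
    refine exists_congr fun q => and_congr_right fun _ => exists_congr fun p =>
      and_congr_right fun _ => ?_
    rw [encodeWords_eq U, List.all_map, List.all_eq_true]
    refine forall_congr' fun u => imp_congr_right fun _ => ?_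
    rw [Function.comp_apply, ← map_encodeLetter_invRev, ← map_encodeLetter_invRev,
      ← List.map_append, ← List.map_append, ← List.map_append, ← List.map_append, memTest_encode]
    simp only [← FreeGroup.mul_mk, ← FreeGroup.inv_mk, mul_inv_rev, inv_inv, mul_assoc]
  rw [h0]
  constructor
  · rintro ⟨q, _, p, _, h⟩
    refine ⟨FreeGroup.mk q * (FreeGroup.mk p)⁻¹, ?_⟩
    have hle : wordSubgroup U ≤ (wordSubgroup V).comap
        (MulAut.conj (FreeGroup.mk q * (FreeGroup.mk p)⁻¹)).toMonoidHom := by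
      refine (Subgroup.closure_le _).2 ?_
      rintro _ ⟨u, hu, rfl⟩
      exact h u hu
    exact fun x hx => hle hx
  · rintro ⟨g, hg⟩
    obtain ⟨x, hx⟩ := exists_coreVert hU
    obtain ⟨p, hp, hxp⟩ := hx.exists_prefix
    obtain ⟨q, hq, hxq⟩ := (hx.conj hg).exists_prefix
    rw [rcoset_eq_iff] at hxp hxq
    refine ⟨q, hq, p, hp, fun u hu => ?_⟩
    have h1 := hg _ ((wordSubgroup U).mul_mem ((wordSubgroup U).mul_mem
      ((wordSubgroup U).inv_mem hxp) (mk_mem_wordSubgroup hu)) hxp)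
    have h2 := (wordSubgroup V).mul_mem ((wordSubgroup V).mul_mem hxq h1)
      ((wordSubgroup V).inv_mem hxq)
    convert h2 using 1
    group

/-- A loop shared by the two cores visits pairs of core vertices, represented by pairs of prefixes.
If it is longer than the number of such pairs, one pair repeats early, and the segment between the
repetitions is a shorter shared loop. -/
theorem meetTest_encode {U V : List (List (Fin n × Bool))} :
    meetTest (letters n) (encodeWords U) (encodeWords V) = true ↔
      ∃ g x, x ≠ 1 ∧ x ∈ wordSubgroup U ∧ g * x * g⁻¹ ∈ wordSubgroup V := by
  set N := (wordPrefixes U).length * (wordPrefixes V).length with hN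
  have hbot : wordSubgroup ([] : List (List (Fin n × Bool))) = ⊥ := by
    simp [wordSubgroup]
  have h0 : meetTest (letters n) (encodeWords U) (encodeWords V) = true ↔
      ∃ q ∈ wordPrefixes U, ∃ r ∈ wordPrefixes V, ∃ w : List (Fin n × Bool), w.length ≤ N ∧
        FreeGroup.mk w ≠ 1 ∧
        FreeGroup.mk q * FreeGroup.mk w * (FreeGroup.mk q)⁻¹ ∈ wordSubgroup U ∧
        FreeGroup.mk r * FreeGroup.mk w * (FreeGroup.mk r)⁻¹ ∈ wordSubgroup V := by
    unfold meetTest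
    rw [wordPrefixes_encodeWords, wordPrefixes_encodeWords]
    simp only [List.any_map, List.any_eq_true, Function.comp_apply, List.length_map, ← hN]
    refine exists_congr fun q => and_congr_right fun _ => exists_congr fun r =>
      and_congr_right fun _ => ?_
    have key : ∀ w : List (Fin n × Bool),
        (!memTest (w.map encodeLetter) [] && (memTest (q.map encodeLetter ++
          (w.map encodeLetter ++ FreeGroup.invRev (q.map encodeLetter))) (encodeWords U) &&
          memTest (r.map encodeLetter ++ (w.map encodeLetter ++
            FreeGroup.invRev (r.map encodeLetter))) (encodeWords V))) = true ↔
        FreeGroup.mk w ≠ 1 ∧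
        FreeGroup.mk q * FreeGroup.mk w * (FreeGroup.mk q)⁻¹ ∈ wordSubgroup U ∧
        FreeGroup.mk r * FreeGroup.mk w * (FreeGroup.mk r)⁻¹ ∈ wordSubgroup V := by
      intro w
      have h1 := memTest_encode (h := w) (V := [])
      rw [hbot, Subgroup.mem_bot] at h1
      rw [← map_encodeLetter_invRev, ← map_encodeLetter_invRev,
        ← List.map_append, ← List.map_append, ← List.map_append, ← List.map_append,
        Bool.and_eq_true, Bool.and_eq_true, memTest_encode, memTest_encode, Bool.not_eq_true',
        ← Bool.not_eq_true]
      refine and_congr (not_congr h1) ?_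
      simp only [← FreeGroup.mul_mk, ← FreeGroup.inv_mk, mul_assoc]
    constructor
    · rintro ⟨w, hw, h⟩
      rw [mem_wordsUpTo] at hw
      obtain ⟨v, rfl⟩ := exists_map_encodeLetter hw.2
      exact ⟨v, by simpa using hw.1, (key v).1 h⟩
    · rintro ⟨w, hw, h⟩
      refine ⟨w.map encodeLetter, mem_wordsUpTo.2 ⟨by simpa using hw, ?_⟩, (key w).2 h⟩
      intro x hx
      obtain ⟨a, _, rfl⟩ := List.mem_map.1 hx
      exact mem_letters.2 ⟨a, rfl⟩
  rw [h0]
  set H := wordSubgroup U with hH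
  set K := wordSubgroup V with hK
  constructor
  · rintro ⟨q, _, r, _, w, _, h1, h2, h3⟩
    refine ⟨FreeGroup.mk r * (FreeGroup.mk q)⁻¹, _, ?_, h2, ?_⟩
    · rwa [Ne, conj_eq_one_iff]
    · convert h3 using 1
      group
  · rintro ⟨g, x, hx1, hxH, hxK⟩
    -- Passing to a cyclically reduced conjugate places all vertices of the loop in both cores.
    obtain ⟨u, c, a, rfl, hc1, hc2⟩ := exists_conj_startsWith hx1
    have hcK : g * u * c * (g * u)⁻¹ ∈ K := by
      convert hxK using 1
      group
    have hu : CoreVert H u := ⟨a, c, hxH, hc1, hc2⟩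
    have hgu : CoreVert K (g * u) := ⟨a, c, hcK, hc1, hc2⟩
    have hc : c ≠ 1 := by
      rintro rfl
      simp at hx1
    have hvH : ∀ i, CoreVert H (u * FreeGroup.mk (c.toWord.take i)) := fun i => by
      refine hu.of_pathIn_append (v := c.toWord.drop i) ?_
      rw [List.take_append_drop]
      exact hu.pathIn hxH
    have hvK : ∀ i, CoreVert K (g * u * FreeGroup.mk (c.toWord.take i)) := fun i => by
      refine hgu.of_pathIn_append (v := c.toWord.drop i) ?_
      rw [List.take_append_drop]
      exact hgu.pathIn hcK
    have hvH' := fun i => (hvH i).exists_prefix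
    have hvK' := fun i => (hvK i).exists_prefix
    choose q hq1 hq2 using hvH'
    choose r hr1 hr2 using hvK'
    simp only [rcoset_eq_iff] at hq2 hr2
    by_cases hlen : c.toWord.length ≤ N
    · refine ⟨q 0, hq1 0, r 0, hr1 0, c.toWord, hlen, by rwa [FreeGroup.mk_toWord], ?_, ?_⟩
      · have h1 := hq2 0
        rw [List.take_zero, ← FreeGroup.one_eq_mk, mul_one] at h1
        rw [FreeGroup.mk_toWord]
        convert H.mul_mem (H.mul_mem h1 hxH) (H.inv_mem h1) using 1
        group
      · have h1 := hr2 0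
        rw [List.take_zero, ← FreeGroup.one_eq_mk, mul_one] at h1
        rw [FreeGroup.mk_toWord]
        convert K.mul_mem (K.mul_mem h1 hcK) (K.inv_mem h1) using 1
        group
    · push Not at hlen
      -- The N + 1 positions 0, …, N are mapped to at most N pairs of prefixes.
      obtain ⟨i, j, hij, hjN, hqr⟩ : ∃ i j, i < j ∧ j ≤ N ∧ (q i, r i) = (q j, r j) := by
        obtain ⟨i, hi, j, hj, hne, h⟩ := Finset.exists_ne_map_eq_of_card_lt_of_maps_to
          (s := Finset.range (N + 1))
          (t := (wordPrefixes U).toFinset ×ˢ (wordPrefixes V).toFinset)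
          (f := fun i => (q i, r i)) (by
            rw [Finset.card_product, Finset.card_range]
            exact Nat.lt_succ_of_le
              (Nat.mul_le_mul (List.toFinset_card_le _) (List.toFinset_card_le _)))
          (fun i _ => by simp [hq1, hr1])
        rw [Finset.mem_range] at hi hj
        rcases lt_or_gt_of_ne hne with hlt | hlt
        · exact ⟨i, j, hlt, by omega, h⟩
        · exact ⟨j, i, hlt, by omega, h.symm⟩
      obtain ⟨hqij, hrij⟩ := Prod.mk.inj hqr
      set w := (c.toWord.take j).drop i with hw
      have hlenw : w.length = j - i := by
        rw [hw, List.length_drop, List.length_take]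
        omega
      have htake : FreeGroup.mk (c.toWord.take j) = FreeGroup.mk (c.toWord.take i) *
          FreeGroup.mk w := by
        rw [FreeGroup.mul_mk, hw]
        congr 1
        conv_lhs => rw [← List.take_append_drop i (c.toWord.take j)]
        rw [List.take_take, min_eq_left hij.le]
      have hred : FreeGroup.IsReduced w :=
        FreeGroup.isReduced_toWord.infix
          ((List.drop_suffix _ _).isInfix.trans (List.take_prefix _ _).isInfix)
      refine ⟨q i, hq1 i, r i, hr1 i, w, by omega, ?_, ?_, ?_⟩
      -- The segment is a non-empty piece of a reduced word, hence represents a non-trivial element.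
      · intro h1
        have h2 := toWord_eq_of_isReduced hred
        rw [h1, FreeGroup.toWord_one] at h2
        rw [← h2] at hlenw
        simp at hlenw
        omega
      · have h1 := hq2 j
        rw [← hqij, htake] at h1
        convert H.mul_mem (hq2 i) (H.inv_mem h1) using 1
        group
      · have h1 := hr2 j
        rw [← hrij, htake] at h1
        convert K.mul_mem (hr2 i) (K.inv_mem h1) using 1
        group

end Tests

/-! ### Whitehead's algorithm for a common proper free factor -/

section Moves

variable {n : ℕ}

theorem map_encodeLetter_moveLetter (a : Fin n × Bool) (A : List (Fin n × Bool))
    (y : Fin n × Bool) : (moveLetter a A y).map encodeLetter =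
      moveLetter (encodeLetter a) (A.map encodeLetter) (encodeLetter y) := by
  have h1 : (encodeLetter y).1 = (encodeLetter a).1 ↔ y.1 = a.1 := Fin.val_inj
  have h2 : ∀ z, encodeLetter z ∈ A.map encodeLetter ↔ z ∈ A := fun z =>
    List.mem_map_of_injective encodeLetter_injective
  have h3 : ((encodeLetter y).1, !(encodeLetter y).2) = encodeLetter (y.1, !y.2) := rfl
  have h4 : ((encodeLetter a).1, !(encodeLetter a).2) = encodeLetter (a.1, !a.2) := rfl
  unfold moveLetter
  simp only [h1, h3, h4, h2]
  split_ifs <;> simp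

theorem encodeWords_moveWords (a : Fin n × Bool) (A : List (Fin n × Bool))
    (U : List (List (Fin n × Bool))) : encodeWords (moveWords a A U) =
      moveWords (encodeLetter a) (A.map encodeLetter) (encodeWords U) := by
  simp only [encodeWords_eq, moveWords, List.map_map]
  refine List.map_congr_left fun w _ => ?_
  simp only [Function.comp_apply, List.map_flatMap, List.flatMap_map, map_encodeLetter_moveLetter]

theorem mk_moveLetter (a : Fin n × Bool) (A : List (Fin n × Bool)) (y : Fin n × Bool) :
    FreeGroup.mk (moveLetter a A y) = whiteheadEquiv a {x | x ∈ A} (letterVal y) := by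
  classical
  rw [whiteheadEquiv_apply, moveLetter]
  by_cases h : y.1 = a.1
  · rw [if_pos h, whiteheadHom_of_fst _ _ h]; rfl
  · rw [if_neg h, whiteheadHom_of_ne _ _ h]
    have ha' : letterVal (a.1, !a.2) = (letterVal a)⁻¹ := letterVal_letterInv a
    have hy' : letterInv y = (y.1, !y.2) := rfl
    simp only [Set.mem_ofPred_eq, hy']
    split_ifs <;>
      simp only [List.nil_append, List.cons_append, mk_cons, ha', ← FreeGroup.one_eq_mk, mul_one,
        one_mul, mul_assoc]

theorem wordSubgroup_moveWords (a : Fin n × Bool) (A : List (Fin n × Bool))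
    (U : List (List (Fin n × Bool))) : wordSubgroup (moveWords a A U) =
      (wordSubgroup U).map (whiteheadEquiv a {x | x ∈ A}).toMonoidHom := by
  have hmk : ∀ w : List (Fin n × Bool), FreeGroup.mk (w.flatMap (moveLetter a A)) =
      (whiteheadEquiv a {x | x ∈ A}).toMonoidHom (FreeGroup.mk w) := by
    intro w
    induction w with
    | nil => rw [List.flatMap_nil, ← FreeGroup.one_eq_mk, map_one]
    | cons y w ih =>
      rw [List.flatMap_cons, ← FreeGroup.mul_mk, ih, mk_cons, map_mul, mk_moveLetter]
      rfl
  rw [wordSubgroup, wordSubgroup, MonoidHom.map_closure]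
  congr 1
  ext g
  constructor
  · rintro ⟨_, hw, rfl⟩
    obtain ⟨w, hw', rfl⟩ := List.mem_map.1 hw
    exact ⟨_, ⟨w, hw', rfl⟩, (hmk w).symm⟩
  · rintro ⟨_, ⟨w, hw, rfl⟩, rfl⟩
    exact ⟨_, List.mem_map.2 ⟨w, hw, rfl⟩, (hmk w).symm⟩

/-- A pair of lists of words with letters in `Fin n`, written with natural numbers. -/
def encodePair (S : List (List (Fin n × Bool)) × List (List (Fin n × Bool))) :
    List (List (ℕ × Bool)) × List (List (ℕ × Bool)) :=
  (encodeWords S.1, encodeWords S.2)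

theorem mem_moves_encode {S : List (List (Fin n × Bool)) × List (List (Fin n × Bool))}
    {T : List (List (ℕ × Bool)) × List (List (ℕ × Bool))}
    (hT : T ∈ moves (letters n) (encodePair S)) :
    ∃ a A, T = encodePair (moveWords a A S.1, moveWords a A S.2) := by
  obtain ⟨a, ha, hT⟩ := List.mem_flatMap.1 hT
  obtain ⟨A, hA, rfl⟩ := List.mem_map.1 hT
  obtain ⟨a, rfl⟩ := mem_letters.1 ha
  obtain ⟨A, rfl⟩ := exists_map_encodeLetter fun x hx => (List.mem_sublists'.1 hA).subset hx
  exact ⟨a, A, (Prod.ext (encodeWords_moveWords _ _ _) (encodeWords_moveWords _ _ _)).symm⟩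

/-- Filtering the list of letters represents any set A by one of its sublists, so the finite search
misses no Whitehead automorphism. -/
theorem exists_mem_moves_encode (S : List (List (Fin n × Bool)) × List (List (Fin n × Bool)))
    (a : Fin n × Bool) (A : Set (Fin n × Bool)) :
    ∃ B, {x | x ∈ B} = A ∧
      encodePair (moveWords a B S.1, moveWords a B S.2) ∈ moves (letters n) (encodePair S) := by
  classical
  let A' := (letters n).filter fun x => decide (∃ y ∈ A, encodeLetter y = x)
  have hA' : A'.Sublist (letters n) := List.filter_sublist
  obtain ⟨B, hB⟩ := exists_map_encodeLetter fun x hx => hA'.subset hx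
  refine ⟨B, ?_, ?_⟩
  · ext x
    have h1 : x ∈ B ↔ encodeLetter x ∈ A' := by
      rw [← hB, List.mem_map_of_injective encodeLetter_injective]
    rw [Set.mem_ofPred_eq, h1, List.mem_filter, decide_eq_true_eq]
    constructor
    · rintro ⟨-, y, hy, hxy⟩
      rwa [← encodeLetter_injective hxy]
    · exact fun hx => ⟨mem_letters.2 ⟨x, rfl⟩, x, hx, rfl⟩
  · refine List.mem_flatMap.2 ⟨encodeLetter a, mem_letters.2 ⟨a, rfl⟩, ?_⟩
    refine List.mem_map.2 ⟨A', List.mem_sublists'.2 hA', ?_⟩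
    rw [← hB]
    exact (Prod.ext (encodeWords_moveWords _ _ _) (encodeWords_moveWords _ _ _)).symm

theorem reach_succ {α : Type*} [DecidableEq α] (L : List (α × Bool)) (k : ℕ)
    (l : List (List (List (α × Bool)) × List (List (α × Bool)))) :
    reach L (k + 1) l = reach L k (l ++ l.flatMap (moves L)) := rfl

theorem subset_reach {α : Type*} [DecidableEq α] (L : List (α × Bool)) (k : ℕ)
    (l : List (List (List (α × Bool)) × List (List (α × Bool)))) : l ⊆ reach L k l := by
  induction k generalizing l with
  | zero => exact List.Subset.refl l
  | succ k ih =>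
    rw [reach_succ]
    exact List.Subset.trans (List.subset_append_left _ _) (ih _)

theorem exists_of_mem_reach {S : List (List (Fin n × Bool)) × List (List (Fin n × Bool))} (k : ℕ)
    {T : List (List (ℕ × Bool)) × List (List (ℕ × Bool))}
    (hT : T ∈ reach (letters n) k [encodePair S]) :
    ∃ (φ : FreeGroup (Fin n) ≃* FreeGroup (Fin n)) (S' : _), T = encodePair S' ∧
      wordSubgroup S'.1 = (wordSubgroup S.1).map φ.toMonoidHom ∧
      wordSubgroup S'.2 = (wordSubgroup S.2).map φ.toMonoidHom := by
  induction k generalizing T with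
  | zero =>
    obtain rfl := List.mem_singleton.1 hT
    refine ⟨MulEquiv.refl _, S, rfl, ?_, ?_⟩ <;>
    exact (Subgroup.map_id _).symm
  | succ k ih =>
    rw [reach, Function.iterate_succ_apply'] at hT
    rcases List.mem_append.1 hT with hT | hT
    · exact ih hT
    · obtain ⟨T', hT', hT⟩ := List.mem_flatMap.1 hT
      obtain ⟨φ, S', rfl, h1, h2⟩ := ih hT'
      obtain ⟨a, A, rfl⟩ := mem_moves_encode hT
      refine ⟨φ.trans (whiteheadEquiv a {x | x ∈ A}), _, rfl, ?_, ?_⟩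
      · rw [wordSubgroup_moveWords, h1, Subgroup.map_map]; rfl
      · rw [wordSubgroup_moveWords, h2, Subgroup.map_map]; rfl

theorem exists_label_iff {H K : Subgroup (FreeGroup (Fin n))} {i : Fin n} :
    (∃ e, ((coreGraph H).disjUnion (coreGraph K)).label e = i) ↔
      (∃ g, CoreDart H g (i, true)) ∨ ∃ g, CoreDart K g (i, true) := by
  constructor
  · rintro ⟨⟨⟨q, j⟩, hq⟩ | ⟨⟨q, j⟩, hq⟩, he⟩
    · obtain ⟨g, rfl⟩ := exists_rcoset q
      obtain rfl : j = i := he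
      exact Or.inl ⟨g, mem_coreE_iff.1 hq⟩
    · obtain ⟨g, rfl⟩ := exists_rcoset q
      obtain rfl : j = i := he
      exact Or.inr ⟨g, mem_coreE_iff.1 hq⟩
  · rintro (⟨g, hg⟩ | ⟨g, hg⟩)
    · exact ⟨Sum.inl ⟨(rcoset H g, i), mem_coreE_iff.2 hg⟩, rfl⟩
    · exact ⟨Sum.inr ⟨(rcoset K g, i), mem_coreE_iff.2 hg⟩, rfl⟩

theorem map_ne_bot {H : Subgroup (FreeGroup (Fin n))} (hH : H ≠ ⊥)
    (φ : FreeGroup (Fin n) ≃* FreeGroup (Fin n)) : H.map φ.toMonoidHom ≠ ⊥ := by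
  rwa [Ne, Subgroup.map_eq_bot_iff_of_injective]
  exact φ.injective

theorem card_core_disjUnion_V (H K : Subgroup (FreeGroup (Fin n))) :
    ENat.card ((coreGraph H).disjUnion (coreGraph K)).V =
      (coverGraph H).coreV.encard + (coverGraph K).coreV.encard := ENat.card_sum _ _

/-- Whitehead's algorithm: free factors that have conjugates in a common proper free factor are
moved into a common coordinate factor by few Whitehead automorphisms. -/
theorem exists_mem_reach {J : Subgroup (FreeGroup (Fin n))} (hJ : IsFreeFactor J) (hJtop : J ≠ ⊤)
    (k : ℕ) {S : List (List (Fin n × Bool)) × List (List (Fin n × Bool))}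
    (h1 : IsFreeFactor (wordSubgroup S.1)) (h1b : wordSubgroup S.1 ≠ ⊥)
    (h2 : IsFreeFactor (wordSubgroup S.2)) (h2b : wordSubgroup S.2 ≠ ⊥)
    (h1J : ConjInto (wordSubgroup S.1) J) (h2J : ConjInto (wordSubgroup S.2) J)
    (hk : ENat.card ((coreGraph (wordSubgroup S.1)).disjUnion (coreGraph (wordSubgroup S.2))).V ≤ k)
    {l : List (List (List (ℕ × Bool)) × List (List (ℕ × Bool)))} (hl : encodePair S ∈ l) :
    ∃ S' : List (List (Fin n × Bool)) × List (List (Fin n × Bool)),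
      encodePair S' ∈ reach (letters n) k l ∧
      wordSubgroup S'.1 ≠ ⊥ ∧ wordSubgroup S'.2 ≠ ⊥ ∧
      ∃ i, ConjInto (wordSubgroup S'.1) (coordFactor i) ∧
        ConjInto (wordSubgroup S'.2) (coordFactor i) := by
  by_cases hlab : ∀ i : Fin n, ∃ e,
      ((coreGraph (wordSubgroup S.1)).disjUnion (coreGraph (wordSubgroup S.2))).label e = i
  · obtain ⟨H', hH', hH'J⟩ := conjInto_iff.1 h1J
    obtain ⟨K', hK', hK'J⟩ := conjInto_iff.1 h2J
    obtain ⟨φ, hφ, hV, -⟩ := exists_whitehead_reduction _ _ h1 h2 hlab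
      ⟨H', K', J, hH', hK', hJ, hJtop, hH'J, hK'J⟩
    -- The budget `k` bounds the number of core vertices. The reduction removes at least one, so the
    -- budget is not 0, and one less suffices for the new pair.
    cases k with
    | zero => exact absurd (hV.trans_le hk) not_lt_zero
    | succ k =>
      obtain ⟨a, A, rfl⟩ := exists_eq_whiteheadEquiv hφ
      obtain ⟨B, rfl, hB⟩ := exists_mem_moves_encode S a A
      have hJtop' : J.map (whiteheadEquiv a {x | x ∈ B}).toMonoidHom ≠ ⊤ := by
        intro h
        rw [← Subgroup.map_top_of_surjective (whiteheadEquiv a {x | x ∈ B}).toMonoidHom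
          (whiteheadEquiv a {x | x ∈ B}).surjective] at h
        exact hJtop (Subgroup.map_injective (whiteheadEquiv a {x | x ∈ B}).injective h)
      rw [← wordSubgroup_moveWords, ← wordSubgroup_moveWords] at hV
      rw [reach_succ]
      refine exists_mem_reach (hJ.map (whiteheadEquiv a {x | x ∈ B})) hJtop' k
        (S := (moveWords a B S.1, moveWords a B S.2)) ?_ ?_ ?_ ?_ ?_ ?_ ?_ ?_
      · rw [wordSubgroup_moveWords]; exact h1.map _
      · rw [wordSubgroup_moveWords]; exact map_ne_bot h1b _
      · rw [wordSubgroup_moveWords]; exact h2.map _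
      · rw [wordSubgroup_moveWords]; exact map_ne_bot h2b _
      · rw [wordSubgroup_moveWords]; exact h1J.map _
      · rw [wordSubgroup_moveWords]; exact h2J.map _
      · have h3 := hV.trans_le hk
        rw [Nat.cast_add, Nat.cast_one] at h3
        exact Order.le_of_lt_add_one h3
      · exact List.mem_append_right _ (List.mem_flatMap.2 ⟨_, hl, hB⟩)
  -- A label missing from both cores means that both groups are already conjugate into the
  -- corresponding coordinate factor.
  · push Not at hlab
    obtain ⟨i, hi⟩ := hlab
    have hi' := mt exists_label_iff.2 (not_exists.2 hi)
    push Not at hi'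
    exact ⟨S, subset_reach _ _ _ hl, h1b, h2b, i, conjInto_coordFactor h1b hi'.1,
      conjInto_coordFactor h2b hi'.2⟩
termination_by k

/-- The words `coordWords` generate a coordinate factor. -/
theorem exists_encodeWords_coordWords (i : Fin n) : ∃ V : List (List (Fin n × Bool)),
    encodeWords V = coordWords n i ∧ wordSubgroup V = coordFactor i := by
  refine ⟨((List.finRange n).filter fun j => !decide (j = i)).map fun j => [(j, true)], ?_, ?_⟩
  · have h1 : List.range n = (List.finRange n).map Fin.val := by simp
    rw [coordWords, h1, List.filter_map, encodeWords_eq, List.map_map, List.map_map]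
    have h2 : ((fun j => !decide (j = i.val)) ∘ Fin.val) = fun j : Fin n => !decide (j = i) := by
      funext j
      simp [Fin.val_inj]
    rw [h2]
    rfl
  · rw [wordSubgroup, coordFactor]
    congr 1
    ext g
    constructor
    · rintro ⟨w, hw, rfl⟩
      obtain ⟨j, hj, rfl⟩ := List.mem_map.1 hw
      exact ⟨j, by simpa using hj, rfl⟩
    · rintro ⟨j, hj, rfl⟩
      exact ⟨_, List.mem_map.2 ⟨j, by simpa using hj, rfl⟩, rfl⟩

/-- The number of prefixes bounds the number of core vertices, hence the number of Whitehead
automorphisms that have to be tried. -/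
theorem commonFactorTest_encode {U V : List (List (Fin n × Bool))}
    (hU : IsFreeFactor (wordSubgroup U)) (hUb : wordSubgroup U ≠ ⊥)
    (hV : IsFreeFactor (wordSubgroup V)) (hVb : wordSubgroup V ≠ ⊥) :
    commonFactorTest n (encodeWords U) (encodeWords V) = true ↔
      ∃ J, IsFreeFactor J ∧ J ≠ ⊤ ∧ ConjInto (wordSubgroup U) J ∧ ConjInto (wordSubgroup V) J := by
  have hlen : ∀ U : List (List (Fin n × Bool)),
      (wordPrefixes (encodeWords U)).length = (wordPrefixes U).length := fun U => by
    rw [wordPrefixes_encodeWords, List.length_map]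
  have hpair : (encodeWords U, encodeWords V) = encodePair (U, V) := rfl
  unfold commonFactorTest
  simp only [List.any_eq_true, hlen, hpair, Bool.and_eq_true, List.mem_range]
  constructor
  · rintro ⟨T, hT, i, hi, h1, h2⟩
    obtain ⟨φ, S, rfl, hS1, hS2⟩ := exists_of_mem_reach _ hT
    obtain ⟨W, hW1, hW2⟩ := exists_encodeWords_coordWords ⟨i, hi⟩
    have hWi : coordWords n i = encodeWords W := hW1.symm
    rw [hWi] at h1 h2
    have h1' := (conjTest_encode (by rw [hS1]; exact map_ne_bot hUb φ)).1 h1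
    have h2' := (conjTest_encode (by rw [hS2]; exact map_ne_bot hVb φ)).1 h2
    rw [hW2] at h1' h2'
    rw [hS1] at h1'
    rw [hS2] at h2'
    have hmap : ∀ H : Subgroup (FreeGroup (Fin n)),
        (H.map φ.toMonoidHom).map φ.symm.toMonoidHom = H := by
      intro H
      rw [Subgroup.map_map]
      convert Subgroup.map_id H
      ext
      simp
    -- The coordinate factor found by the search is pulled back along the automorphism that led to
    -- it.
    refine ⟨(coordFactor ⟨i, hi⟩).map φ.symm.toMonoidHom, (isFreeFactor_coordFactor _).map _,
      ?_, ?_, ?_⟩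
    · intro h
      rw [← Subgroup.map_top_of_surjective φ.symm.toMonoidHom φ.symm.surjective] at h
      exact coordFactor_ne_top _ (Subgroup.map_injective φ.symm.injective h)
    · simpa only [hmap] using h1'.map φ.symm
    · simpa only [hmap] using h2'.map φ.symm
  · rintro ⟨J, hJ, hJtop, h1J, h2J⟩
    obtain ⟨S, hS, hS1, hS2, i, hi1, hi2⟩ := exists_mem_reach hJ hJtop
      ((wordPrefixes U).length + (wordPrefixes V).length) (S := (U, V)) hU hUb hV hVb h1J h2J (by
        rw [card_core_disjUnion_V, Nat.cast_add]
        exact add_le_add (encard_coreV_le U) (encard_coreV_le V)) (List.mem_singleton.2 rfl)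
    obtain ⟨W, hW1, hW2⟩ := exists_encodeWords_coordWords i
    refine ⟨_, hS, i, i.2, ?_, ?_⟩
    · rw [← hW1]
      exact (conjTest_encode hS1).2 (hW2 ▸ hi1)
    · rw [← hW1]
      exact (conjTest_encode hS2).2 (hW2 ▸ hi2)

theorem distTwoTest_encode {U V : List (List (Fin n × Bool))} {H K : ProperFreeFactor n}
    (hU : H.1 = wordSubgroup U) (hV : K.1 = wordSubgroup V) :
    distTwoTest (n, encodeWords U, encodeWords V) = true ↔
      (freeFactorGraph n).dist (freeFactorClass H) (freeFactorClass K) = 2 := by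
  have hH : IsFreeFactor (wordSubgroup U) := hU ▸ H.2.1
  have hHb : wordSubgroup U ≠ ⊥ := hU ▸ H.2.2.1
  have hK : IsFreeFactor (wordSubgroup V) := hV ▸ K.2.1
  have hKb : wordSubgroup V ≠ ⊥ := hV ▸ K.2.2.1
  rw [freeFactorGraph_dist_eq_two_iff, hU, hV, distTwoTest]
  simp only [Bool.and_eq_true, Bool.or_eq_true, Bool.not_eq_true', ← Bool.not_eq_true]
  rw [conjTest_encode hHb, conjTest_encode hKb, commonFactorTest_encode hH hHb hK hKb,
    meetTest_encode]

end Moves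

/-! ### Primitive recursiveness of the procedure -/

section PrimitiveRecursive

variable {α β γ : Type*} [Primcodable α] [Primcodable β] [Primcodable γ]

theorem Primrec.and' {p q : α → Bool} (hp : Primrec p) (hq : Primrec q) :
    Primrec fun a => p a && q a := (Primrec.dom_bool₂ _).comp hp hq

theorem Primrec.or' {p q : α → Bool} (hp : Primrec p) (hq : Primrec q) :
    Primrec fun a => p a || q a := (Primrec.dom_bool₂ _).comp hp hq

theorem Primrec.not' {p : α → Bool} (hp : Primrec p) : Primrec fun a => !p a :=
  (Primrec.dom_bool _).comp hp

theorem Primrec.append' {f g : α → List β} (hf : Primrec f) (hg : Primrec g) :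
    Primrec fun a => f a ++ g a := Primrec.list_append.comp hf hg

theorem Primrec.cons' {f : α → β} {g : α → List β} (hf : Primrec f) (hg : Primrec g) :
    Primrec fun a => f a :: g a := Primrec.list_cons.comp hf hg

theorem Primrec.decide_eq {f g : α → β} {inst : ∀ a, Decidable (f a = g a)} (hf : Primrec f)
    (hg : Primrec g) : Primrec fun a => decide (f a = g a) :=
  PrimrecPred.decide (Primrec.eq.comp hf hg)

/-- Bounded search over a list is recast as a fold, which is primitive recursive; all the searches
in the tests reduce to this. -/
theorem Primrec.list_any {f : α → List β} {p : α → β → Bool} (hf : Primrec f)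
    (hp : Primrec fun x : α × β => p x.1 x.2) : Primrec fun a => (f a).any (p a) := by
  have h : Primrec fun a => (f a).foldr (fun b r => p a b || r) false :=
    Primrec.list_foldr hf (Primrec.const false) ((hp.comp (Primrec.pair Primrec.fst
      (Primrec.fst.comp Primrec.snd))).or' (Primrec.snd.comp Primrec.snd)).to₂
  refine h.of_eq fun a => ?_
  induction f a with
  | nil => rfl
  | cons b l ih => rw [List.foldr_cons, ih, List.any_cons]

theorem Primrec.list_all {f : α → List β} {p : α → β → Bool} (hf : Primrec f)
    (hp : Primrec fun x : α × β => p x.1 x.2) : Primrec fun a => (f a).all (p a) := by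
  refine ((Primrec.list_any (p := fun a b => !p a b) hf hp.not').not').of_eq fun a => ?_
  induction f a with
  | nil => rfl
  | cons b l ih => rw [List.any_cons, List.all_cons, Bool.not_or, ih, Bool.not_not]

theorem Primrec.decide_mem {f : α → β} {l : α → List β} {inst : ∀ a, Decidable (f a ∈ l a)}
    (hf : Primrec f) (hl : Primrec l) : Primrec fun a => decide (f a ∈ l a) := by
  classical
  have h : Primrec fun a => (l a).any fun b => decide (f a = b) :=
    Primrec.list_any hl (Primrec.decide_eq (hf.comp Primrec.fst) Primrec.snd)
  refine h.of_eq fun a => ?_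
  rw [Bool.eq_iff_iff]
  simp

theorem Primrec.sublists' {f : α → List β} (hf : Primrec f) :
    Primrec fun a => (f a).sublists' := by
  have h : Primrec fun a => (f a).foldr (fun b r => r ++ r.map (List.cons b)) [[]] :=
    Primrec.list_foldr hf (Primrec.const [[]])
      ((Primrec.snd.comp Primrec.snd).append' (Primrec.list_map (Primrec.snd.comp Primrec.snd)
        ((Primrec.fst.comp (Primrec.snd.comp Primrec.fst)).cons' Primrec.snd).to₂)).to₂
  refine h.of_eq fun a => ?_
  induction f a with
  | nil => rfl
  | cons b l ih => rw [List.foldr_cons, ih, List.sublists'_cons]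

theorem Primrec.inits {f : α → List β} (hf : Primrec f) : Primrec fun a => (f a).inits := by
  have h : Primrec fun a => (f a).foldr (fun b r => [] :: r.map (List.cons b)) [[]] :=
    Primrec.list_foldr hf (Primrec.const [[]])
      ((Primrec.const []).cons' (Primrec.list_map (Primrec.snd.comp Primrec.snd)
        ((Primrec.fst.comp (Primrec.snd.comp Primrec.fst)).cons' Primrec.snd).to₂)).to₂
  refine h.of_eq fun a => ?_
  induction f a with
  | nil => rfl
  | cons b l ih => rw [List.foldr_cons, ih, List.inits_cons]

theorem Primrec.filter {f : α → List β} {p : α → β → Bool} (hf : Primrec f) (hp : Primrec₂ p) :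
    Primrec fun a => (f a).filter (p a) := by
  have h : Primrec fun a => (f a).flatMap fun b => bif p a b then [b] else [] :=
    Primrec.list_flatMap hf (Primrec.cond hp (Primrec.snd.cons' (Primrec.const []))
      (Primrec.const []))
  refine h.of_eq fun a => ?_
  induction f a with
  | nil => rfl
  | cons b l ih =>
    rw [List.flatMap_cons, List.filter_cons, ih]
    cases p a b <;> rfl

theorem Primrec.list_product {f : α → List β} {g : α → List γ} (hf : Primrec f)
    (hg : Primrec g) : Primrec fun a => (f a).product (g a) :=
  Primrec.list_flatMap hf (Primrec.list_map (hg.comp Primrec.fst)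
    (Primrec.pair (Primrec.snd.comp Primrec.fst) Primrec.snd).to₂).to₂

theorem Primrec.invRev {f : α → List (β × Bool)} (hf : Primrec f) :
    Primrec fun a => FreeGroup.invRev (f a) :=
  Primrec.list_reverse.comp (Primrec.list_map hf
    (Primrec.pair (Primrec.fst.comp Primrec.snd) (Primrec.snd.comp Primrec.snd).not').to₂)

theorem Primrec.wordPrefixes {U : α → List (List β)} (hU : Primrec U) :
    Primrec fun a => wordPrefixes (U a) :=
  (Primrec.const []).cons' (Primrec.list_flatMap hU (Primrec.inits Primrec.snd).to₂)

theorem Primrec.wordEdges {p : α → List (β × Bool)} (hp : Primrec p) :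
    Primrec fun a => wordEdges (p a) := by
  have hq : Primrec₂ fun (_ : α) (x : (β × Bool) × List (β × Bool)) => x.2.reverse :=
    (Primrec.list_reverse.comp (Primrec.snd.comp Primrec.snd)).to₂
  have hx : Primrec₂ fun (_ : α) (x : (β × Bool) × List (β × Bool)) => x.1 :=
    (Primrec.fst.comp Primrec.snd).to₂
  have hp' : Primrec₂ fun (a : α) (_ : (β × Bool) × List (β × Bool)) => p a :=
    (hp.comp Primrec.fst).to₂
  have h : Primrec fun a => List.casesOn (motive := fun _ => List (List (β × Bool) × (β × Bool) ×
      List (β × Bool))) (p a).reverse [] fun x q =>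
      [(q.reverse, x, p a), (p a, (x.1, !x.2), q.reverse)] :=
    Primrec.list_casesOn (Primrec.list_reverse.comp hp) (Primrec.const [])
      (h := fun a x => [(x.2.reverse, x.1, p a), (p a, (x.1.1, !x.1.2), x.2.reverse)])
      ((Primrec.pair hq (Primrec.pair hx hp')).cons' ((Primrec.pair hp' (Primrec.pair
        (Primrec.pair (Primrec.fst.comp hx) (Primrec.snd.comp hx).not') hq)).cons'
        (Primrec.const [])))
  refine h.of_eq fun a => ?_
  unfold _root_.wordEdges
  cases (p a).reverse <;> rfl

theorem Primrec.wordsUpTo {L : α → List β} {k : α → ℕ} (hL : Primrec L) (hk : Primrec k) :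
    Primrec fun a => wordsUpTo (L a) (k a) :=
  Primrec.nat_iterate hk (Primrec.const [[]])
    (h := fun a l => [] :: l.flatMap fun w => (L a).map fun b => b :: w)
    ((Primrec.const []).cons' (Primrec.list_flatMap Primrec.snd
      (Primrec.list_map (hL.comp (Primrec.fst.comp Primrec.fst))
        (Primrec.snd.cons' (Primrec.snd.comp Primrec.fst)).to₂).to₂)).to₂

variable [DecidableEq β]

theorem Primrec.isFolding {V W : α → List (List (β × Bool))}
    {R : α → List (List (β × Bool) × List (β × Bool))} (hV : Primrec V) (hW : Primrec W)
    (hR : Primrec R) : Primrec fun a => isFolding (V a) (W a) (R a) := by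
  have hE : Primrec fun a => (W a).flatMap _root_.wordEdges :=
    Primrec.list_flatMap hW (Primrec.wordEdges Primrec.snd).to₂
  refine .and' ?_ (.and' ?_ (.and' ?_ (.and' ?_ ?_)))
  · refine Primrec.list_all hW ?_
    exact Primrec.decide_mem (Primrec.pair Primrec.snd Primrec.snd) (hR.comp Primrec.fst)
  · refine Primrec.list_all hR ?_
    exact Primrec.decide_mem (Primrec.pair (Primrec.snd.comp Primrec.snd)
      (Primrec.fst.comp Primrec.snd)) (hR.comp Primrec.fst)
  · refine Primrec.list_all hR ?_
    refine Primrec.list_all (hR.comp Primrec.fst) ?_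
    refine Primrec.or' (Primrec.not' ?_) ?_
    · exact Primrec.decide_eq (Primrec.snd.comp (Primrec.snd.comp Primrec.fst))
        (Primrec.fst.comp Primrec.snd)
    · exact Primrec.decide_mem (Primrec.pair (Primrec.fst.comp (Primrec.snd.comp Primrec.fst))
        (Primrec.snd.comp Primrec.snd)) (hR.comp (Primrec.fst.comp Primrec.fst))
  · refine Primrec.list_all hV ?_
    exact Primrec.decide_mem (Primrec.pair (Primrec.const []) Primrec.snd) (hR.comp Primrec.fst)
  · refine Primrec.list_all hE ?_
    refine Primrec.list_all (hE.comp Primrec.fst) ?_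
    refine Primrec.or' (Primrec.not' ?_) (Primrec.or' (Primrec.not' ?_) ?_)
    · exact Primrec.decide_eq (Primrec.fst.comp (Primrec.snd.comp (Primrec.snd.comp Primrec.fst)))
        (Primrec.fst.comp (Primrec.snd.comp Primrec.snd))
    · exact Primrec.decide_mem (Primrec.pair (Primrec.fst.comp (Primrec.snd.comp Primrec.fst))
        (Primrec.fst.comp Primrec.snd)) (hR.comp (Primrec.fst.comp Primrec.fst))
    · exact Primrec.decide_mem (Primrec.pair
        (Primrec.snd.comp (Primrec.snd.comp (Primrec.snd.comp Primrec.fst)))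
        (Primrec.snd.comp (Primrec.snd.comp Primrec.snd))) (hR.comp (Primrec.fst.comp Primrec.fst))

theorem Primrec.memTest {h : α → List (β × Bool)} {V : α → List (List (β × Bool))}
    (hh : Primrec h) (hV : Primrec V) : Primrec fun a => memTest (h a) (V a) := by
  have hW := Primrec.wordPrefixes (hh.cons' hV)
  refine Primrec.list_all (Primrec.sublists' (Primrec.list_product hW hW)) ?_
  refine Primrec.or' (Primrec.not' ?_) ?_
  · exact Primrec.isFolding (hV.comp Primrec.fst) (hW.comp Primrec.fst) Primrec.snd
  · exact Primrec.decide_mem (Primrec.pair (Primrec.const []) (hh.comp Primrec.fst)) Primrec.snd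

theorem Primrec.conjTest {U V : α → List (List (β × Bool))} (hU : Primrec U) (hV : Primrec V) :
    Primrec fun a => conjTest (U a) (V a) := by
  refine Primrec.list_any (Primrec.wordPrefixes hV) ?_
  refine Primrec.list_any ((Primrec.wordPrefixes hU).comp Primrec.fst) ?_
  refine Primrec.list_all (hU.comp (Primrec.fst.comp Primrec.fst)) ?_
  refine Primrec.memTest ?_ (hV.comp (Primrec.fst.comp (Primrec.fst.comp Primrec.fst)))
  have hq : Primrec fun x : ((α × List (β × Bool)) × List (β × Bool)) × List (β × Bool) =>
      x.1.1.2 := Primrec.snd.comp (Primrec.fst.comp Primrec.fst)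
  have hp : Primrec fun x : ((α × List (β × Bool)) × List (β × Bool)) × List (β × Bool) =>
      x.1.2 := Primrec.snd.comp Primrec.fst
  exact hq.append' (hp.invRev.append' (Primrec.snd.append' (hp.append' hq.invRev)))

theorem Primrec.meetTest {L : α → List (β × Bool)} {U V : α → List (List (β × Bool))}
    (hL : Primrec L) (hU : Primrec U) (hV : Primrec V) :
    Primrec fun a => meetTest (L a) (U a) (V a) := by
  have hpU := Primrec.wordPrefixes hU
  have hpV := Primrec.wordPrefixes hV
  have hw := Primrec.wordsUpTo hL (Primrec.nat_mul.comp (Primrec.list_length.comp hpU)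
    (Primrec.list_length.comp hpV))
  refine Primrec.list_any hpU ?_
  refine Primrec.list_any (hpV.comp Primrec.fst) ?_
  refine Primrec.list_any (hw.comp (Primrec.fst.comp Primrec.fst)) ?_
  have ha : Primrec fun x : ((α × List (β × Bool)) × List (β × Bool)) × List (β × Bool) =>
      x.1.1.1 := Primrec.fst.comp (Primrec.fst.comp Primrec.fst)
  have hq : Primrec fun x : ((α × List (β × Bool)) × List (β × Bool)) × List (β × Bool) =>
      x.1.1.2 := Primrec.snd.comp (Primrec.fst.comp Primrec.fst)
  have hr : Primrec fun x : ((α × List (β × Bool)) × List (β × Bool)) × List (β × Bool) =>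
      x.1.2 := Primrec.snd.comp Primrec.fst
  exact (Primrec.memTest Primrec.snd (Primrec.const [])).not'.and'
    ((Primrec.memTest (hq.append' (Primrec.snd.append' hq.invRev)) (hU.comp ha)).and'
      (Primrec.memTest (hr.append' (Primrec.snd.append' hr.invRev)) (hV.comp ha)))

/-- The case distinctions are rewritten as Boolean conditionals, to which `Primrec.cond` applies. -/
theorem Primrec.moveLetter {a y : α → β × Bool} {A : α → List (β × Bool)} (ha : Primrec a)
    (hA : Primrec A) (hy : Primrec y) : Primrec fun x => moveLetter (a x) (A x) (y x) := by
  have h : Primrec fun x => bif decide ((y x).1 = (a x).1) then [y x] else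
      ((bif decide (y x ∈ A x) then [a x] else []) ++
        y x :: (bif decide (((y x).1, !(y x).2) ∈ A x) then [((a x).1, !(a x).2)] else [])) := by
    have hnil : Primrec fun _ : α => ([] : List (β × Bool)) := Primrec.const []
    have hinv : ∀ {z : α → β × Bool}, Primrec z → Primrec fun x => ((z x).1, !(z x).2) :=
      fun hz => Primrec.pair (Primrec.fst.comp hz) (Primrec.snd.comp hz).not'
    exact Primrec.cond (Primrec.decide_eq (Primrec.fst.comp hy) (Primrec.fst.comp ha))
      (hy.cons' hnil) ((Primrec.cond (Primrec.decide_mem hy hA) (ha.cons' hnil) hnil).append'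
        (hy.cons' (Primrec.cond (Primrec.decide_mem (hinv hy) hA) ((hinv ha).cons' hnil) hnil)))
  refine h.of_eq fun x => ?_
  simp only [_root_.moveLetter, Bool.cond_decide]

theorem Primrec.moveWords {a : α → β × Bool} {A : α → List (β × Bool)}
    {U : α → List (List (β × Bool))} (ha : Primrec a) (hA : Primrec A) (hU : Primrec U) :
    Primrec fun x => moveWords (a x) (A x) (U x) :=
  Primrec.list_map hU (Primrec.list_flatMap Primrec.snd (Primrec.moveLetter
    (ha.comp (Primrec.fst.comp Primrec.fst)) (hA.comp (Primrec.fst.comp Primrec.fst))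
    Primrec.snd).to₂).to₂

theorem Primrec.moves {L : α → List (β × Bool)}
    {S : α → List (List (β × Bool)) × List (List (β × Bool))} (hL : Primrec L) (hS : Primrec S) :
    Primrec fun x => moves (L x) (S x) := by
  have ha : Primrec fun x : (α × (β × Bool)) × List (β × Bool) => x.1.2 :=
    Primrec.snd.comp Primrec.fst
  have hS' : Primrec fun x : (α × (β × Bool)) × List (β × Bool) => S x.1.1 :=
    hS.comp (Primrec.fst.comp Primrec.fst)
  exact Primrec.list_flatMap hL (Primrec.list_map ((Primrec.sublists' hL).comp Primrec.fst)
    (Primrec.pair (Primrec.moveWords ha Primrec.snd (Primrec.fst.comp hS'))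
      (Primrec.moveWords ha Primrec.snd (Primrec.snd.comp hS'))).to₂).to₂

theorem Primrec.reach {L : α → List (β × Bool)} {k : α → ℕ}
    {l : α → List (List (List (β × Bool)) × List (List (β × Bool)))} (hL : Primrec L)
    (hk : Primrec k) (hl : Primrec l) : Primrec fun x => reach (L x) (k x) (l x) := by
  have h : Primrec₂ fun (x : α) (l : List (List (List (β × Bool)) × List (List (β × Bool)))) =>
      l ++ l.flatMap (_root_.moves (L x)) :=
    (Primrec.snd.append' (Primrec.list_flatMap Primrec.snd
      (Primrec.moves (hL.comp (Primrec.fst.comp Primrec.fst)) Primrec.snd).to₂)).to₂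
  exact Primrec.nat_iterate hk hl h

theorem primrec_letters : Primrec letters :=
  Primrec.list_flatMap Primrec.list_range
    ((Primrec.pair Primrec.snd (Primrec.const true)).cons'
      ((Primrec.pair Primrec.snd (Primrec.const false)).cons' (Primrec.const []))).to₂

theorem primrec_coordWords : Primrec₂ coordWords :=
  Primrec.list_map (Primrec.filter (Primrec.list_range.comp Primrec.fst)
    (Primrec.decide_eq Primrec.snd (Primrec.snd.comp Primrec.fst)).not'.to₂)
    (((Primrec.pair Primrec.snd (Primrec.const true)).cons' (Primrec.const [])).to₂)

theorem Primrec.commonFactorTest {n : α → ℕ} {U V : α → List (List (ℕ × Bool))} (hn : Primrec n)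
    (hU : Primrec U) (hV : Primrec V) :
    Primrec fun a => commonFactorTest (n a) (U a) (V a) := by
  have hlen := Primrec.nat_add.comp (Primrec.list_length.comp (Primrec.wordPrefixes hU))
    (Primrec.list_length.comp (Primrec.wordPrefixes hV))
  have hreach := Primrec.reach (primrec_letters.comp hn) hlen
    ((Primrec.pair hU hV).cons' (Primrec.const []))
  have hc : Primrec fun x : (α × (List (List (ℕ × Bool)) × List (List (ℕ × Bool)))) × ℕ =>
      coordWords (n x.1.1) x.2 :=
    primrec_coordWords.comp (hn.comp (Primrec.fst.comp Primrec.fst)) Primrec.snd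
  have hS : Primrec fun x : (α × (List (List (ℕ × Bool)) × List (List (ℕ × Bool)))) × ℕ =>
      x.1.2 := Primrec.snd.comp Primrec.fst
  refine Primrec.list_any hreach ?_
  refine Primrec.list_any (Primrec.list_range.comp (hn.comp Primrec.fst)) ?_
  exact (Primrec.conjTest (Primrec.fst.comp hS) hc).and' (Primrec.conjTest (Primrec.snd.comp hS) hc)

theorem primrec_distTwoTest : Primrec distTwoTest := by
  have hU : Primrec fun x : ℕ × List (List (ℕ × Bool)) × List (List (ℕ × Bool)) => x.2.1 :=
    Primrec.fst.comp Primrec.snd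
  have hV : Primrec fun x : ℕ × List (List (ℕ × Bool)) × List (List (ℕ × Bool)) => x.2.2 :=
    Primrec.snd.comp Primrec.snd
  exact (Primrec.conjTest hU hV).not'.and' ((Primrec.conjTest hV hU).not'.and'
    ((Primrec.commonFactorTest Primrec.fst hU hV).or'
      (Primrec.meetTest (primrec_letters.comp Primrec.fst) hU hV)))

end PrimitiveRecursive

theorem mainTheorem7 :
    (∀ (n : ℕ) (H K : Subgroup (FreeGroup (Fin n))),
      IsFreeFactor H → H ≠ ⊥ → IsFreeFactor K → K ≠ ⊥ →
      (∀ i : Fin n, ∃ e, ((coreGraph H).disjUnion (coreGraph K)).label e = i) →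
      (∃ H' K' J : Subgroup (FreeGroup (Fin n)), SubgroupConj H H' ∧ SubgroupConj K K' ∧
        IsFreeFactor J ∧ J ≠ ⊤ ∧ H' ≤ J ∧ K' ≤ J) →
      ∃ φ : FreeGroup (Fin n) ≃* FreeGroup (Fin n), IsWhiteheadAut φ ∧
        ENat.card ((coreGraph (H.map φ.toMonoidHom)).disjUnion (coreGraph (K.map φ.toMonoidHom))).V
          < ENat.card ((coreGraph H).disjUnion (coreGraph K)).V ∧
        ENat.card ((coreGraph (H.map φ.toMonoidHom)).disjUnion (coreGraph (K.map φ.toMonoidHom))).E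
          < ENat.card ((coreGraph H).disjUnion (coreGraph K)).E) ∧
    (∃ f : ℕ × List (List (ℕ × Bool)) × List (List (ℕ × Bool)) → Bool, Computable f ∧
      ∀ (n : ℕ) (U V : List (List (Fin n × Bool))) (H K : ProperFreeFactor n),
        H.1 = wordSubgroup U → K.1 = wordSubgroup V →
        (f (n, encodeWords U, encodeWords V) = true ↔
          (freeFactorGraph n).dist (freeFactorClass H) (freeFactorClass K) = 2)) := by
  refine ⟨fun n H K hH _ hK _ hlab hJ => exists_whitehead_reduction H K hH hK hlab hJ,
    distTwoTest, primrec_distTwoTest.to_comp, fun n U V H K hU hV => distTwoTest_encode hU hV⟩
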